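/- Let $(\Omega,\mathcal F,P)$ be a complete probability space, let $U$ and $V$ be separable real Hilbert spaces (identified with their duals), and let $T>0$. A cylindrical process in $U$ is a family $L=(L(t))_{t\ge 0}$ of linear maps $L(t):U\to L^0_P(\Omega,\mathcal F;\mathbb R)$ that are continuous for convergence in probability. It is a cylindrical Lévy process if for all $n$ and $u_1,\dots,u_n\in U$ the process $(L(t)u_1,\dots,L(t)u_n)_{t\ge0}$ is a Lévy process in $\mathbb R^n$ (it starts at $0$ almost surely, has independent and stationary increments and is continuous in probability). It has weak second moments if $E[|L(1)u|^2]<\infty$ for all $u\in U$. Let $\mathcal F_t=\sigma(L(s)u: u\in U,\ 0\le s\le t)$; since the $L(s)u$ are equivalence classes, $\mathcal F_t$ contains all $P$-null sets. $L$ is a cylindrical martingale if $(L(t)u)_{t\ge0}$ is a real-valued $(\mathcal F_t)$-martingale for every $u\in U$. Let $\mathcal L_2=\mathcal L_2(U,V)$ be the space of Hilbert–Schmidt operators with the Hilbert–Schmidt norm, and let $\mathcal H(\mathcal L_2)$ be the space of $(\mathcal F_t)$-predictable $\Psi:[0,T]\times\Omega\to\mathcal L_2$ with $\|\Psi\|_{\mathcal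 H}^2=E\int_0^T\|\Psi(s)\|_{\mathcal L_2}^2\,ds<\infty$. The stochastic integral is defined as follows. 1. For $0\le s\le t$ and $\varphi\in\mathcal L_2$, $X_\varphi\in L^2_P(\Omega;V)$ denotes the random variable with $\langle X_\varphi,v\rangle=(L(t)-L(s))(\varphi^*v)$ $P$-a.s. for each $v\in V$. For a simple $\Phi=\sum_{i=1}^m 1_{A_i}\varphi_i$ with disjoint $A_i\in\mathcal F_s$ and $\varphi_i\in\mathcal L_2$ put $J_{s,t}(\Phi)=\sum_{i=1}^m 1_{A_i}X_{\varphi_i}$, and extend $J_{s,t}$ by continuity to $L^2_P(\Omega,\mathcal F_s;\mathcal L_2)$. 2. For $\Psi=\sum_{k=0}^{N-1}\Phi_k1_{(t_k,t_{k+1}]}$ with $0=t_0<\dots<t_N=T$ and $\Phi_k\in L^2_P(\Omega,\mathcal F_{t_k};\mathcal L_2)$ put $\int_0^T\Psi\,dL=\sum_{k=0}^{N-1}J_{t_k,t_{k+1}}(\Phi_k)$, and extend this operator by continuity from these processes to $\mathcal H(\mathcal L_2)\to L^2_P(\Omega;V)$ with respect to $\|\cdot\|_{\mathcal H}$. 3.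 For $t\in[0,T]$ put $\int_0^t\Psi\,dL=\int_0^T1_{[0,t]}(s)\Psi(s)\,dL(s)$. Statement. Let $L$ be a cylindrical Lévy process in $U$ with weak second moments. Then for every $\Psi\in\mathcal H(\mathcal L_2)$ the integrals $\int_0^t\Psi\,dL$, $t\in[0,T]$, exist in this sense, and there is a $V$-valued process $I=(I(t))_{t\in[0,T]}$ that is adapted to $(\mathcal F_t)_{t\in[0,T]}$, satisfies $E[\|I(t)\|_V^2]<\infty$ for all $t\in[0,T]$, has càdlàg paths in $V$, and is a modification of $\left(\int_0^t\Psi(s)\,dL(s)\right)_{t\in[0,T]}$, that is, $I(t)=\int_0^t\Psi(s)\,dL(s)$ $P$-a.s. for each $t\in[0,T]$. If in addition $L$ is a cylindrical martingale, then $I$ is a $V$-valued $(\mathcal F_t)_{t\in[0,T]}$-martingale (with $E[\|I(t)\|_V^2]<\infty$ for all $t$). -/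

import Mathlib

open MeasureTheory ProbabilityTheory Filter Topology
open scoped NNReal ENNReal

noncomputable section

namespace CylLevy

/-! ### Hilbert-Schmidt operators -/

section HilbertSchmidt

/-- Index set of a fixed orthonormal basis of the real Hilbert space `U`. -/
def onbIndex (U : Type*) [NormedAddCommGroup U] [InnerProductSpace ℝ U] [CompleteSpace U] :
    Set U :=
  (exists_hilbertBasis ℝ U).choose

/-- A fixed orthonormal basis `(e_k)` of the real Hilbert space `U`. -/
def onb (U : Type*) [NormedAddCommGroup U] [InnerProductSpace ℝ U] [CompleteSpace U] :
    HilbertBasis (onbIndex U) ℝ U :=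
  (exists_hilbertBasis ℝ U).choose_spec.choose

variable (U V : Type*) [NormedAddCommGroup U] [InnerProductSpace ℝ U] [CompleteSpace U]
  [NormedAddCommGroup V] [InnerProductSpace ℝ V]

/-- The operators `φ : U → V` with `∑ₖ ‖φ eₖ‖² < ∞`, as a subspace of the bounded operators. -/
def hilbertSchmidtSubmodule : Submodule ℝ (U →L[ℝ] V) where
  carrier := {φ | Summable fun k => ‖φ (onb U k)‖ ^ 2}
  zero_mem' := by simp
  add_mem' := by
    intro φ ψ hφ hψ
    refine Summable.of_nonneg_of_le (fun _ => sq_nonneg _) (fun k => ?_)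
      ((Summable.add hφ hψ).mul_left 2)
    have h : ‖(φ + ψ) (onb U k)‖ ≤ ‖φ (onb U k)‖ + ‖ψ (onb U k)‖ := norm_add_le _ _
    exact (pow_le_pow_left₀ (norm_nonneg _) h 2).trans (add_sq_le)
  smul_mem' := by
    intro c φ hφ
    have h : Summable fun k => ‖c‖ ^ 2 * ‖φ (onb U k)‖ ^ 2 := Summable.mul_left _ hφ
    exact h.congr fun k => by
      rw [← mul_pow, ← norm_smul]; rfl

/-- The space `L₂(U, V)` of Hilbert-Schmidt operators. It is a separate type, so that it carries
the Hilbert-Schmidt norm below and not the operator norm. -/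
def HilbertSchmidt : Type _ := hilbertSchmidtSubmodule U V

instance : AddCommGroup (HilbertSchmidt U V) :=
  inferInstanceAs (AddCommGroup (hilbertSchmidtSubmodule U V))

instance : Module ℝ (HilbertSchmidt U V) :=
  inferInstanceAs (Module ℝ (hilbertSchmidtSubmodule U V))

variable {U V}

/-- The bounded operator underlying a Hilbert-Schmidt operator. -/
def HilbertSchmidt.toCLM : HilbertSchmidt U V →ₗ[ℝ] (U →L[ℝ] V) :=
  (hilbertSchmidtSubmodule U V).subtype

/-- The square summable family `(φ eₖ)ₖ`. -/
def HilbertSchmidt.toLp : HilbertSchmidt U V →ₗ[ℝ] lp (fun _ : onbIndex U => V) 2 where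
  toFun φ := ⟨fun k => φ.toCLM (onb U k), memℓp_gen (by
    have h : Summable fun k => ‖φ.toCLM (onb U k)‖ ^ 2 := φ.2
    simpa using h)⟩
  map_add' φ ψ := by ext k; simp; rfl
  map_smul' c φ := by ext k; simp

theorem HilbertSchmidt.toLp_injective :
    Function.Injective (HilbertSchmidt.toLp : HilbertSchmidt U V →ₗ[ℝ] _) := by
  intro φ ψ h
  apply Subtype.ext
  have h' : ∀ k, φ.toCLM (onb U k) = ψ.toCLM (onb U k) := fun k =>
    congrFun (congrArg Subtype.val h) k
  refine ContinuousLinearMap.ext_on (s := Set.range (onb U)) ?_ ?_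
  · rw [← Submodule.dense_iff_topologicalClosure_eq_top.symm.eq]
    exact (onb U).dense_span
  · rintro _ ⟨k, rfl⟩
    exact h' k

/-- The Hilbert-Schmidt norm `‖φ‖ = (∑ₖ ‖φ eₖ‖²)^{1/2}`, that is, the `ℓ²`-norm of `(φ eₖ)ₖ`. -/
instance : NormedAddCommGroup (HilbertSchmidt U V) :=
  NormedAddCommGroup.induced (HilbertSchmidt U V) (lp (fun _ : onbIndex U => V) 2)
    HilbertSchmidt.toLp HilbertSchmidt.toLp_injective

end HilbertSchmidt

/-! ### Cylindrical Lévy processes -/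

section CylindricalLevy

variable {Ω : Type*} [mΩ : MeasurableSpace Ω] (P : Measure Ω)

/-- `X` is a Lévy process: it starts at `0` almost surely, has independent and stationary
increments, and is continuous in probability. -/
structure IsLevyProcess {E : Type*} [NormedAddCommGroup E] [MeasurableSpace E]
    (X : ℝ≥0 → Ω → E) : Prop where
  zero : X 0 =ᵐ[P] 0
  indep : HasIndepIncrements X P
  stationary : ∀ s h : ℝ≥0, IdentDistrib (fun ω => X (s + h) ω - X s ω) (X h) P P
  stochContinuous : ∀ t, TendstoInMeasure P X (𝓝 t) (X t)

variable {U : Type*} [NormedAddCommGroup U] [InnerProductSpace ℝ U]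

/-- A cylindrical process in `U`: each `L t : U → L⁰(Ω; ℝ)` is linear and continuous for
convergence in probability. It is a cylindrical Lévy process if `(L(t)u₁, …, L(t)uₙ)` is a
Lévy process in `ℝⁿ` for all `u₁, …, uₙ`. -/
structure IsCylindricalLevy (L : ℝ≥0 → U →ₗ[ℝ] (Ω →ₘ[P] ℝ)) : Prop where
  continuous : ∀ t u, TendstoInMeasure P (fun w ω => L t w ω) (𝓝 u) (fun ω => L t u ω)
  levy : ∀ (n : ℕ) (u : Fin n → U),
    IsLevyProcess P (fun (t : ℝ≥0) ω => (fun i => L t (u i) ω : Fin n → ℝ))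

/-- Weak second moments: `E|L(1)u|² < ∞` for all `u`. -/
def HasWeakSecondMoments (L : ℝ≥0 → U →ₗ[ℝ] (Ω →ₘ[P] ℝ)) : Prop :=
  ∀ u, MemLp (fun ω => L 1 u ω) 2 P

/-- `F_t = σ(L(s)u : u ∈ U, s ≤ t)`. Since `L(s)u` is an equivalence class of random variables,
all its measurable representatives are taken; in particular `F_t` contains the null sets. -/
def cylFiltration (L : ℝ≥0 → U →ₗ[ℝ] (Ω →ₘ[P] ℝ)) : Filtration ℝ≥0 mΩ where
  seq t := ⨆ (s : ℝ≥0) (_ : s ≤ t) (u : U) (f : Ω → ℝ) (_ : Measurable f ∧ f =ᵐ[P] L s u),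
    MeasurableSpace.comap f inferInstance
  mono' := fun _ _ h => iSup_mono fun _ => iSup_mono' fun hs => ⟨hs.trans h, le_rfl⟩
  le' := fun _ => iSup_le fun _ => iSup_le fun _ => iSup_le fun _ => iSup_le fun _ =>
    iSup_le fun hf => hf.1.comap_le

/-- `L` is a cylindrical martingale: `(L(t)u)` is a real martingale for every `u`. -/
def IsCylindricalMartingale (L : ℝ≥0 → U →ₗ[ℝ] (Ω →ₘ[P] ℝ)) : Prop :=
  ∀ u, Martingale (fun (t : ℝ≥0) ω => L t u ω) (cylFiltration P L) P

/-- The restriction of the filtration to the time interval `[0, T]`. -/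
def cylFiltrationOn (L : ℝ≥0 → U →ₗ[ℝ] (Ω →ₘ[P] ℝ)) (T : ℝ≥0) : Filtration (Set.Iic T) mΩ where
  seq t := cylFiltration P L t
  mono' := fun _ _ h => (cylFiltration P L).mono h
  le' := fun t => (cylFiltration P L).le t

end CylindricalLevy

/-! ### The stochastic integral -/

section Integral

/-- Continuous extension by density. `R f Y` is the graph of an operator from a subspace of
`L²(μ; E)` to `L²(P; V)`. `ExtendsTo μ P R f Y` says that the continuous extension of this
operator is defined at `f` and has the value `Y` there: `f` is an `L²`-limit of elements of the
subspace whose images tend to `Y`, and the images tend to `Y` for every sequence in the subspace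
which tends to `f`. -/
def ExtendsTo {S E Ω V : Type*} [MeasurableSpace S] [NormedAddCommGroup E] [MeasurableSpace Ω]
    [NormedAddCommGroup V] (μ : Measure S) (P : Measure Ω) (R : (S → E) → (Ω → V) → Prop)
    (f : S → E) (Y : Ω → V) : Prop :=
  MemLp Y 2 P ∧
  (∃ (g : ℕ → S → E) (Z : ℕ → Ω → V), (∀ n, R (g n) (Z n)) ∧
    Tendsto (fun n => eLpNorm (g n - f) 2 μ) atTop (𝓝 0) ∧
    Tendsto (fun n => eLpNorm (Z n - Y) 2 P) atTop (𝓝 0)) ∧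
  ∀ (g : ℕ → S → E) (Z : ℕ → Ω → V), (∀ n, R (g n) (Z n)) →
    Tendsto (fun n => eLpNorm (g n - f) 2 μ) atTop (𝓝 0) →
    Tendsto (fun n => eLpNorm (Z n - Y) 2 P) atTop (𝓝 0)

variable {Ω : Type*} [mΩ : MeasurableSpace Ω] (P : Measure Ω)
  {U V : Type*} [NormedAddCommGroup U] [InnerProductSpace ℝ U] [CompleteSpace U]
  [NormedAddCommGroup V] [InnerProductSpace ℝ V] [CompleteSpace V]
  (L : ℝ≥0 → U →ₗ[ℝ] (Ω →ₘ[P] ℝ))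

/-- `X = X_φ`: the random variable `X ∈ L²(Ω; V)` satisfies `⟨X, v⟩ = (L(t) - L(s))(φ* v)` almost
surely, for every `v ∈ V`. -/
def IsRadonification (s t : ℝ≥0) (φ : HilbertSchmidt U V) (X : Ω → V) : Prop :=
  MemLp X 2 P ∧ ∀ v : V, (fun ω => inner ℝ (X ω) v) =ᵐ[P]
    (L t - L s) (ContinuousLinearMap.adjoint φ.toCLM v)

/-- `Y = J_{s,t}(Φ)` for a simple `F_s`-measurable `Φ = ∑ᵢ 1_{Aᵢ} φᵢ`, with disjoint `Aᵢ ∈ F_s`;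
that is, `Y = ∑ᵢ 1_{Aᵢ} X_{φᵢ}`. -/
def IsSimpleIncrement (s t : ℝ≥0) (Φ : Ω → HilbertSchmidt U V) (Y : Ω → V) : Prop :=
  ∃ (m : ℕ) (A : Fin m → Set Ω) (φ : Fin m → HilbertSchmidt U V) (X : Fin m → Ω → V),
    (∀ i, MeasurableSet[cylFiltration P L s] (A i)) ∧
    Pairwise (fun i j => Disjoint (A i) (A j)) ∧
    (∀ ω, Φ ω = ∑ i, (A i).indicator (fun _ => φ i) ω) ∧
    (∀ i, IsRadonification P L s t (φ i) (X i)) ∧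
    Y =ᵐ[P] fun ω => ∑ i, (A i).indicator (X i) ω

/-- `Y = J_{s,t}(Φ)` for `Φ ∈ L²(Ω, F_s; L₂(U, V))`, by continuous extension. -/
def IsIncrement (s t : ℝ≥0) (Φ : Ω → HilbertSchmidt U V) (Y : Ω → V) : Prop :=
  StronglyMeasurable[cylFiltration P L s] Φ ∧ MemLp Φ 2 P ∧
    ExtendsTo P P (IsSimpleIncrement P L s t) Φ Y

/-- Lebesgue measure on `[0, T]`. -/
def timeMeasure (T : ℝ≥0) : Measure (Set.Iic T) :=
  Measure.comap (fun t : Set.Iic T => ((t : ℝ≥0) : ℝ)) volume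

/-- `Y = I(Ψ)` for a simple process `Ψ = ∑_{k<N} Φₖ 1_{(tₖ, tₖ₊₁]}` with
`0 = t₀ < ⋯ < t_N = T` and `Φₖ ∈ L²(Ω, F_{tₖ}; L₂(U, V))`; that is, `Y = ∑ₖ J_{tₖ,tₖ₊₁}(Φₖ)`. -/
def IsSimpleIntegral (T : ℝ≥0) (Ψ : Set.Iic T × Ω → HilbertSchmidt U V) (Y : Ω → V) : Prop :=
  ∃ (N : ℕ) (τ : ℕ → Set.Iic T) (Φ : ℕ → Ω → HilbertSchmidt U V) (X : ℕ → Ω → V),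
    ((τ 0 : ℝ≥0) = 0) ∧ ((τ N : ℝ≥0) = T) ∧ (∀ k < N, τ k < τ (k + 1)) ∧
    (∀ k < N, IsIncrement P L (τ k) (τ (k + 1)) (Φ k) (X k)) ∧
    (∀ t ω, Ψ (t, ω) =
      ∑ k ∈ Finset.range N, (Set.Ioc (τ k) (τ (k + 1))).indicator (fun _ => Φ k ω) t) ∧
    Y =ᵐ[P] fun ω => ∑ k ∈ Finset.range N, X k ω

/-- `Ψ ∈ H(L₂)`: the process `Ψ` on `[0, T]` is predictable and `E ∫₀ᵀ ‖Ψ(s)‖² ds < ∞`. -/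
def IsIntegrand (T : ℝ≥0) (Ψ : Set.Iic T → Ω → HilbertSchmidt U V) : Prop :=
  IsStronglyPredictable (cylFiltrationOn P L T) Ψ ∧
    ∫⁻ ω, ∫⁻ t, ‖Ψ t ω‖ₑ ^ 2 ∂(timeMeasure T) ∂P < ∞

/-- `Y = ∫₀ᵀ Ψ(s) dL(s)` for `Ψ ∈ H(L₂)`, by continuous extension from the simple processes with
respect to the norm `(E ∫₀ᵀ ‖Ψ(s)‖² ds)^{1/2}`. -/
def IsStochIntegral (T : ℝ≥0) (Ψ : Set.Iic T → Ω → HilbertSchmidt U V) (Y : Ω → V) : Prop :=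
  IsIntegrand P L T Ψ ∧
    ExtendsTo ((timeMeasure T).prod P) P (IsSimpleIntegral P L T) (Function.uncurry Ψ) Y

/-- `Y = ∫₀ᵗ Ψ(s) dL(s) := ∫₀ᵀ 1_{[0,t]}(s) Ψ(s) dL(s)` for `t ∈ [0, T]`. -/
def IsStochIntegralUpTo (T : ℝ≥0) (Ψ : Set.Iic T → Ω → HilbertSchmidt U V) (t : Set.Iic T)
    (Y : Ω → V) : Prop :=
  IsStochIntegral P L T (fun s ω => (Set.Iic t).indicator (fun r => Ψ r ω) s) Y

/-- Right-continuous with left limits. -/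
def IsCadlag {ι E : Type*} [LinearOrder ι] [TopologicalSpace ι] [TopologicalSpace E]
    (x : ι → E) : Prop :=
  ∀ t, ContinuousWithinAt x (Set.Ioi t) t ∧ ∃ l, Tendsto x (𝓝[<] t) (𝓝 l)

end Integral

end CylLevy

end

/-!
The integral is bounded in `L²`, its increments have a small conditional mean, and these two facts
alone yield a càdlàg modification; when `L` is a martingale, the conditional means vanish.

**Bounds for the increments of `L`.** Variance and mean of `L(t)u` are additive in `t` and tend to
`0` at `0`, so they are linear in `t` (`IsLevyProcess.variance_eq`, `IsLevyProcess.integral_eq`).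
Together with the closed graph theorem this gives second moments of order `t - s` and means of order
`t - s` for `(L(t) - L(s))u`, uniformly for `‖u‖ ≤ 1`, and these increments are independent of `F_s`
(`IsCylindricalLevy.indep_increment`, `exists_isNoise_increment`).

**Integration.** For an `F_s`-measurable random Hilbert-Schmidt operator `Φ` the increment
`J_{s,t}(Φ)` is the `L²`-sum `∑_k (L(t) - L(s))(e_k) Φ e_k`. By independence and the Schur product
theorem its second moment is at most `K₁ (t - s) E‖Φ‖²` (`IsNoise.integral_norm_sum_sq_le`), and its
conditional mean given `F_s` is at most `K₂ (t - s) ‖Φ‖` (`IsNoiseIntegral.abs_integral_inner_le`).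
The increments over different intervals need not be orthogonal, as `L` may have a drift; a discrete
Gronwall argument replaces the Itô isometry (`integral_norm_sum_increments_sq_le`). The integral is
treated as the `L²`-closure of its graph on dyadic simple processes (`IsItoIntegral`). It is a
bounded operator, it agrees with the continuous extension from all simple processes
(`IsItoIntegral.isStochIntegral`), and its domain contains every square integrable predictable
process, by a π-λ argument on the generators of the predictable σ-algebra (`exists_isItoIntegral`).

**Regularity.** Let `Y(t) = ∫₀ᵗ Ψ dL`. Then `E‖Y(t) - Y(s)‖²` is bounded by an increment of a
right-continuous function `A`, and `|E⟪W, Y(t) - Y(s)⟫|` by `c` times an increment of a function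
`B`, for every `F_s`-measurable `W` with `‖W‖ ≤ c` (`HasControlledIncrements`). No maximal
inequality in `V` is used. Instead an anchor follows the path along a dyadic grid and moves to its
current position whenever their distance reaches `ε`. Expanding the square of the distance between
path and anchor shows that `ε²` times the number of moves is at most `∑ ‖ΔY‖² + 2 ∑ ⟪Y - anchor,
ΔY⟫` (`sq_mul_moves_le`); as `‖Y - anchor‖ < ε`, the expectation is bounded uniformly in the grid.
By Fatou's lemma almost all paths oscillate finitely often along the dyadic points
(`HasControlledIncrements.ae_finitelyOscillating`), so they have one-sided limits there, and the
right limits form the desired modification (`HasControlledIncrements.exists_isCadlag`). It is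
adapted because `F_t` contains the null sets. If `L` is a cylindrical martingale, then `B = 0` and
the process is a martingale (`HasControlledIncrements.martingale`).
-/

namespace CylLevy

/-! ### Independence of the past and the increments -/

section Independence

variable {Ω : Type*} [mΩ : MeasurableSpace Ω] {P : Measure Ω}

/-- If a process with independent increments starts at `0`, then its values up to time `s` are
independent of its increment after `s`. -/
theorem IsLevyProcess.indepFun_past_increment {E : Type*} [NormedAddCommGroup E]
    [MeasurableSpace E] [MeasurableAdd₂ E] [MeasurableSub₂ E]
    {X : ℝ≥0 → Ω → E} (hX : IsLevyProcess P X) (hm : ∀ t, Measurable (X t))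
    {s t : ℝ≥0} (hst : s ≤ t) {n : ℕ} (r : Fin n → ℝ≥0) (hr : ∀ i, r i ≤ s) :
    IndepFun (fun ω i => X (r i) ω) (fun ω => X t ω - X s ω) P := by
  classical
  set S : Finset ℝ≥0 := insert 0 (insert s (insert t (Finset.univ.image r))) with hS
  have h0S : (0 : ℝ≥0) ∈ S := by simp [hS]
  have hsS : s ∈ S := by simp [hS]
  have htS : t ∈ S := by simp [hS]
  have hrS : ∀ i, r i ∈ S := fun i => by simp [hS]
  have hc : 0 < S.card := Finset.card_pos.2 ⟨0, h0S⟩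
  set e := S.orderEmbOfFin rfl with he
  -- the elements of `S` in increasing order, continued constantly
  let p : ℕ → ℝ≥0 := fun k => e ⟨min k (S.card - 1), by omega⟩
  have hp : Monotone p := fun a b hab => e.monotone (by
    simp only [Fin.mk_le_mk]; omega)
  have hidx : ∀ x ∈ S, ∃ k : Fin S.card, e k = x := fun x hx => by
    have : x ∈ Set.range e := by rw [he, Finset.range_orderEmbOfFin]; exact hx
    exact this
  have hpe : ∀ k : Fin S.card, p k = e k := fun k => by
    have : min (k : ℕ) (S.card - 1) = k := by omega
    simp only [p, this]
  obtain ⟨a, ha⟩ := hidx s hsS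
  obtain ⟨b, hb⟩ := hidx t htS
  choose k hk using fun i => hidx (r i) (hrS i)
  have hab : a ≤ b := e.le_iff_le.1 (by rw [ha, hb]; exact hst)
  have hka : ∀ i, k i ≤ a := fun i => e.le_iff_le.1 (by rw [ha, hk i]; exact hr i)
  have hp0 : p 0 = 0 := by
    obtain ⟨z, hz⟩ := hidx 0 h0S
    have : p 0 ≤ p z := hp (Nat.zero_le _)
    rw [hpe, hz] at this
    exact le_antisymm this zero_le
  set D : ℕ → Ω → E := fun j ω => X (p (j + 1)) ω - X (p j) ω with hD
  have hDm : ∀ j, Measurable (D j) := fun j => (hm _).sub (hm _)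
  have hind := (hX.indep.nat hp).indepFun_finset (Finset.range a) (Finset.Ico a b)
    (by rw [Finset.disjoint_left]; intro x hx hx'; simp at hx hx'; omega) hDm
  have hcomp := hind.comp
    (φ := fun (x : Finset.range a → E) (i : Fin n) =>
      ∑ j : Finset.range a, if (j : ℕ) < k i then x j else 0)
    (ψ := fun (y : Finset.Ico (a : ℕ) b → E) => ∑ j, y j)
    (by
      refine measurable_pi_lambda _ fun i => Finset.measurable_sum _ fun j _ => ?_
      split_ifs
      · exact measurable_pi_apply _
      · exact measurable_const)
    (Finset.measurable_sum _ fun j _ => measurable_pi_apply _)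
  have htel : ∀ (N : ℕ) ω, ∑ j ∈ Finset.range N, D j ω = X (p N) ω - X (p 0) ω := fun N ω =>
    Finset.sum_range_sub (fun j => X (p j) ω) N
  refine hcomp.congr ?_ ?_
  · filter_upwards [hX.zero] with ω hω
    funext i
    have h1 : ∑ j : Finset.range a, (if (j : ℕ) < k i then D j ω else 0)
        = ∑ j ∈ Finset.range a, if j < k i then D j ω else 0 :=
      Finset.sum_coe_sort (Finset.range a) fun j => if j < (k i : ℕ) then D j ω else 0
    have h2 : (Finset.range a).filter (fun j => j < (k i : ℕ)) = Finset.range (k i) := by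
      ext j; have := hka i; simp; omega
    simp only [Function.comp]
    rw [h1, ← Finset.sum_filter, h2, htel, hpe, hk, hp0, hω]
    simp
  · refine Filter.Eventually.of_forall fun ω => ?_
    simp only [Function.comp]
    have h1 : ∑ j : Finset.Ico (a : ℕ) b, D j ω = ∑ j ∈ Finset.Ico (a : ℕ) b, D j ω :=
      Finset.sum_coe_sort (Finset.Ico (a : ℕ) b) fun j => D j ω
    rw [h1, Finset.sum_Ico_eq_sub _ (by exact_mod_cast hab), htel, htel, hpe, hpe, ha, hb]
    abel

variable {U : Type*} [NormedAddCommGroup U] [InnerProductSpace ℝ U]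
  {L : ℝ≥0 → U →ₗ[ℝ] (Ω →ₘ[P] ℝ)}

theorem coeFn_increment (s t : ℝ≥0) (u : U) :
    (fun ω => (L t - L s) u ω) =ᵐ[P] fun ω => L t u ω - L s u ω := by
  rw [LinearMap.sub_apply]
  exact AEEqFun.coeFn_sub _ _

/-- The increment after `s` is independent of `F_s`. The finite intersections of events of the form
`{L(r)u ∈ B}` with `r ≤ s` are a π-system generating `F_s`, and for these the claim concerns a Lévy
process in some `ℝⁿ`. -/
theorem IsCylindricalLevy.indep_increment [IsProbabilityMeasure P] (hL : IsCylindricalLevy P L)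
    {s t : ℝ≥0} (hst : s ≤ t) {m : ℕ} (w : Fin m → U) :
    Indep (cylFiltration P L s)
      (MeasurableSpace.comap (fun ω j => (L t - L s) (w j) ω) inferInstance) P := by
  classical
  -- the index set of the generators of the past
  let ι : Type _ := {x : ℝ≥0 × U × (Ω → ℝ) // x.1 ≤ s ∧ Measurable x.2.2 ∧ x.2.2 =ᵐ[P] L x.1 x.2.1}
  have hle : cylFiltration P L s ≤ ⨆ i ∈ (Set.univ : Set ι),
      MeasurableSpace.comap i.1.2.2 inferInstance := by
    refine iSup_le fun r => iSup_le fun hr => iSup_le fun u => iSup_le fun f => iSup_le fun hf => ?_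
    exact le_iSup₂_of_le (⟨(r, u, f), hr, hf.1, hf.2⟩ : ι) (Set.mem_univ _) le_rfl
  refine indep_of_indep_of_le_left ?_ hle
  rw [← generateFrom_piiUnionInter_measurableSet]
  have hmeas : Measurable fun ω (j : Fin m) => (L t - L s) (w j) ω :=
    measurable_pi_lambda _ fun j => AEEqFun.measurable _
  refine IndepSets.indep (generateFrom_piiUnionInter_le _ (fun i => ?_) _) hmeas.comap_le
    (isPiSystem_piiUnionInter _ (fun i : ι =>
      @MeasurableSpace.isPiSystem_measurableSet _ (MeasurableSpace.comap i.1.2.2 inferInstance))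
      Set.univ)
    (@MeasurableSpace.isPiSystem_measurableSet _
      (MeasurableSpace.comap (fun ω j => (L t - L s) (w j) ω) inferInstance)) rfl
    (@MeasurableSpace.generateFrom_measurableSet _
      (MeasurableSpace.comap (fun ω j => (L t - L s) (w j) ω) inferInstance)).symm ?_
  · rw [@MeasurableSpace.generateFrom_measurableSet _ (MeasurableSpace.comap i.1.2.2 inferInstance)]
    exact i.2.2.1.comap_le
  rw [IndepSets_iff]
  rintro _ _ ⟨F, -, B, hB, rfl⟩ ⟨C, hC, rfl⟩
  choose! B' hB' hBB' using hB
  let f : Fin F.card → ι := fun i => (F.equivFin.symm i : ι)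
  set q : Fin (F.card + m) → U := Fin.append (fun i => (f i).1.2.1) w with hq
  have h1 := (hL.levy _ q).indepFun_past_increment
    (fun t => measurable_pi_lambda _ fun i => AEEqFun.measurable _) hst
    (fun i => (f i).1.1) (fun i => (f i).2.1)
  have h2 : IndepFun (fun ω i => (f i).1.2.2 ω) (fun ω j => (L t - L s) (w j) ω) P := by
    have h3 := h1.comp (φ := fun x (i : Fin F.card) => x i (Fin.castAdd m i))
      (ψ := fun y (j : Fin m) => y (Fin.natAdd F.card j)) (by fun_prop) (by fun_prop)
    refine h3.congr ?_ ?_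
    · have : ∀ i, (f i).1.2.2 =ᵐ[P] L (f i).1.1 (f i).1.2.1 := fun i => (f i).2.2.2
      filter_upwards [ae_all_iff.2 this] with ω hω
      funext i
      simp [hq, hω i]
    · have : ∀ j, _ := fun j => coeFn_increment (L := L) s t (w j)
      filter_upwards [ae_all_iff.2 this] with ω hω
      funext j
      rw [hω j]
      simp [hq]
  have h3 := h2.measure_inter_preimage_eq_mul (Set.univ.pi fun i => B' (f i)) C
    (MeasurableSet.univ_pi fun i => hB' _ (F.equivFin.symm i).2) hC
  convert h3 using 2
  all_goals
    congr 1
    ext ω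
    simp only [Set.mem_iInter, Set.mem_preimage, Set.mem_pi, Set.mem_univ, true_imp_iff]
    constructor
    · intro h i
      have := h _ (F.equivFin.symm i).2
      rw [← hBB' _ (F.equivFin.symm i).2] at this
      exact this
    · intro h i hi
      rw [← hBB' i hi]
      simpa [f] using h (F.equivFin ⟨i, hi⟩)

end Independence

/-! ### Moments of Lévy processes -/

/-- An additive function on `[0, ∞)` which tends to `0` at `0` is linear. -/
theorem eq_mul_of_additive_of_tendsto_zero {g : ℝ≥0 → ℝ} (hadd : ∀ s t, g (s + t) = g s + g t)
    (h0 : Tendsto g (𝓝 0) (𝓝 0)) (t : ℝ≥0) : g t = t * g 1 := by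
  have hg0 : g 0 = 0 := by have := hadd 0 0; simp at this; exact this
  let h : ℝ≥0 →+ ℝ :=
    { toFun := fun t => g t - t * g 1
      map_zero' := by simp [hg0]
      map_add' := fun s t => by rw [hadd]; push_cast; ring }
  have hh1 : h 1 = 0 := by simp [h]
  have hh0 : Tendsto h (𝓝 0) (𝓝 0) := by
    have : Tendsto (fun t : ℝ≥0 => g t - (t : ℝ) * g 1) (𝓝 0) (𝓝 (0 - ((0 : ℝ≥0) : ℝ) * g 1)) :=
      h0.sub ((NNReal.continuous_coe.tendsto 0).mul_const _)
    simpa [h] using this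
  have hrat : ∀ (k n : ℕ), 0 < n → h ((k : ℝ≥0) / n) = 0 := fun k n hn => by
    have h1 : n • h ((k : ℝ≥0) / n) = k • h 1 := by
      rw [← map_nsmul, ← map_nsmul]
      congr 1
      simp only [nsmul_eq_mul, mul_one]
      rw [mul_div_cancel₀]
      exact_mod_cast hn.ne'
    rw [hh1, smul_zero] at h1
    simpa [hn.ne'] using h1
  -- `t` is approximated from below by fractions with denominator `n + 1`
  let r : ℕ → ℝ≥0 := fun n => t - (⌊t * (n + 1)⌋₊ : ℝ≥0) / ((n + 1 : ℕ) : ℝ≥0)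
  have hle : ∀ n : ℕ, (⌊t * (n + 1)⌋₊ : ℝ≥0) / ((n + 1 : ℕ) : ℝ≥0) ≤ t := fun n => by
    rw [div_le_iff₀ (by positivity)]
    push_cast
    exact Nat.floor_le (by positivity)
  have hr : ∀ n, h (r n) = h t := fun n => by
    have h1 : r n + (⌊t * (n + 1)⌋₊ : ℝ≥0) / ((n + 1 : ℕ) : ℝ≥0) = t :=
      tsub_add_cancel_of_le (hle n)
    conv_rhs => rw [← h1, map_add, hrat _ _ n.succ_pos, add_zero]
  have hr0 : Tendsto r atTop (𝓝 0) := by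
    refine tendsto_of_tendsto_of_tendsto_of_le_of_le (g := fun _ => 0)
      (h := fun n : ℕ => 1 / ((n : ℝ≥0) + 1)) tendsto_const_nhds
      tendsto_one_div_add_atTop_nhds_zero_nat (fun n => bot_le) (fun n => ?_)
    simp only [r]
    rw [tsub_le_iff_right, Nat.cast_add, Nat.cast_one, ← add_div, le_div_iff₀ (by positivity)]
    rw [add_comm (1 : ℝ≥0)]
    exact (Nat.lt_floor_add_one (t * ((n : ℝ≥0) + 1))).le
  have h1 : Tendsto (fun n => h (r n)) atTop (𝓝 0) := hh0.comp hr0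
  simp only [hr] at h1
  have h2 : h t = 0 := tendsto_nhds_unique tendsto_const_nhds h1
  have h3 : g t - t * g 1 = 0 := h2
  linarith

section Moments

variable {Ω : Type*} [mΩ : MeasurableSpace Ω] {P : Measure Ω}

/-- A summand of a square integrable sum of two independent random variables is itself square
integrable: by Fubini, the sum is square integrable for almost every fixed value of the other
summand. -/
theorem memLp_two_of_indepFun_add [IsProbabilityMeasure P] {X Y : Ω → ℝ} (hX : Measurable X)
    (hY : Measurable Y) (hXY : IndepFun X Y P) (h : MemLp (fun ω => X ω + Y ω) 2 P) : MemLp X 2 P := by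
  have hmap := (indepFun_iff_map_prod_eq_prod_map_map hX.aemeasurable hY.aemeasurable).1 hXY
  have : IsProbabilityMeasure (P.map X) := Measure.isProbabilityMeasure_map hX.aemeasurable
  have : IsProbabilityMeasure (P.map Y) := Measure.isProbabilityMeasure_map hY.aemeasurable
  have h1 : Integrable (fun z : ℝ × ℝ => (z.1 + z.2) ^ 2) ((P.map X).prod (P.map Y)) := by
    rw [← hmap, integrable_map_measure (by fun_prop) (by fun_prop)]
    exact h.integrable_sq
  obtain ⟨y, hy⟩ := h1.prod_left_ae.exists
  have h2 : MemLp (fun x : ℝ => x + y) 2 (P.map X) :=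
    (memLp_two_iff_integrable_sq (by fun_prop)).2 hy
  have h3 : MemLp (fun x : ℝ => x) 2 (P.map X) := by
    refine (memLp_congr_ae (Eventually.of_forall fun x => ?_)).1 (h2.sub (memLp_const y))
    simp
  exact (memLp_map_measure_iff (by fun_prop) hX.aemeasurable).1 h3

variable {X : ℝ≥0 → Ω → ℝ}

namespace IsLevyProcess

theorem indepFun_increment (hX : IsLevyProcess P X) {s t : ℝ≥0} (hst : s ≤ t) :
    IndepFun (X s) (X t - X s) P :=
  hX.indep.indepFun_eval_sub zero_le hst (by filter_upwards [hX.zero] with ω hω using hω)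

theorem memLp_two [IsProbabilityMeasure P] (hX : IsLevyProcess P X) (hm : ∀ t, Measurable (X t))
    (h1 : MemLp (X 1) 2 P) (t : ℝ≥0) : MemLp (X t) 2 P := by
  have hnat : ∀ n : ℕ, MemLp (X n) 2 P := by
    intro n
    induction n with
    | zero => exact (memLp_congr_ae (by simpa using hX.zero)).2 (MemLp.zero (ε := ℝ))
    | succ n ih =>
      have h2 : MemLp (fun ω => X (n + 1) ω - X n ω) 2 P := (hX.stationary n 1).memLp_iff.2 h1
      have h3 := ih.add h2
      refine (memLp_congr_ae ?_).2 h3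
      exact Eventually.of_forall fun ω => by simp
  obtain ⟨n, hn⟩ := exists_nat_ge t
  refine memLp_two_of_indepFun_add (hm t) ((hm n).sub (hm t)) (hX.indepFun_increment hn) ?_
  refine (memLp_congr_ae ?_).2 (hnat n)
  exact Eventually.of_forall fun ω => by simp

/-- The variance is additive in time; since it is monotone, its value at `r < 1 / n` is at most `1 /
n` times its value at `1`, so it tends to `0` at `0`. -/
theorem variance_eq [IsProbabilityMeasure P] (hX : IsLevyProcess P X) (hm : ∀ t, Measurable (X t))
    (h1 : MemLp (X 1) 2 P) (t : ℝ≥0) : variance (X t) P = t * variance (X 1) P := by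
  have h2 := hX.memLp_two hm h1
  have hadd : ∀ s t, variance (X (s + t)) P = variance (X s) P + variance (X t) P := fun s t => by
    have hi := hX.indepFun_increment (s := s) (t := s + t) le_self_add
    have := hi.variance_add (h2 s) ((h2 (s + t)).sub (h2 s))
    rw [add_sub_cancel] at this
    rw [this]
    congr 1
    exact (hX.stationary s t).variance_eq
  refine eq_mul_of_additive_of_tendsto_zero (g := fun t => variance (X t) P) hadd ?_ t
  have hmul : ∀ (n : ℕ) (r : ℝ≥0), variance (X (n * r)) P = n * variance (X r) P := by
    intro n r
    induction n with
    | zero =>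
      have := hadd 0 0
      simp at this ⊢
      exact this
    | succ n ih => push_cast; rw [add_mul, one_mul, hadd, ih]; ring
  rw [Metric.tendsto_nhds]
  intro ε hε
  obtain ⟨n, hn⟩ := exists_nat_gt (variance (X 1) P / ε)
  have hn0 : (0 : ℝ) < n := lt_of_le_of_lt (div_nonneg (variance_nonneg _ _) hε.le) hn
  have hn0' : (0 : ℝ≥0) < n := by exact_mod_cast hn0
  have : ∀ᶠ r : ℝ≥0 in 𝓝 0, r < 1 / n := Iio_mem_nhds (by positivity)
  filter_upwards [this] with r hr
  rw [dist_zero_right, Real.norm_of_nonneg (variance_nonneg _ _)]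
  have h3 : variance (X 1) P = n * variance (X r) P + variance (X (1 - n * r)) P := by
    rw [← hmul, ← hadd, add_tsub_cancel_of_le]
    rw [lt_div_iff₀ hn0'] at hr
    rw [mul_comm]; exact hr.le
  have h4 := variance_nonneg (X (1 - n * r)) P
  rw [div_lt_iff₀ hε] at hn
  nlinarith

/-- The mean is additive in time. It tends to `0` at `0`, because there the process and the centred
process tend to `0` in probability. -/
theorem integral_eq [IsProbabilityMeasure P] (hX : IsLevyProcess P X) (hm : ∀ t, Measurable (X t))
    (h1 : MemLp (X 1) 2 P) (t : ℝ≥0) : ∫ ω, X t ω ∂P = t * ∫ ω, X 1 ω ∂P := by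
  have h2 := hX.memLp_two hm h1
  have hint : ∀ t, Integrable (X t) P := fun t => (h2 t).integrable one_le_two
  have hadd : ∀ s t, ∫ ω, X (s + t) ω ∂P = ∫ ω, X s ω ∂P + ∫ ω, X t ω ∂P := fun s t => by
    rw [← (hX.stationary s t).integral_eq, integral_sub (hint _) (hint _)]
    ring
  refine eq_mul_of_additive_of_tendsto_zero (g := fun t => ∫ ω, X t ω ∂P) hadd ?_ t
  rw [Metric.tendsto_nhds]
  intro ε hε
  -- both `X t` and `X t - E (X t)` tend to `0` in probability
  have hp1 : Tendsto (fun t => P {ω | ε / 2 ≤ ‖X t ω‖}) (𝓝 0) (𝓝 0) := by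
    have := (hX.stochContinuous 0).congr_right hX.zero
    rw [tendstoInMeasure_iff_norm] at this
    simpa using this (ε / 2) (by positivity)
  have hp2 : Tendsto (fun t => P {ω | ε / 2 ≤ |X t ω - ∫ ω, X t ω ∂P|}) (𝓝 0) (𝓝 0) := by
    refine tendsto_of_tendsto_of_tendsto_of_le_of_le (g := fun _ => 0)
      (h := fun t : ℝ≥0 => ENNReal.ofReal (t * variance (X 1) P / (ε / 2) ^ 2))
      tendsto_const_nhds ?_ (fun _ => bot_le) (fun t => ?_)
    · have : Tendsto (fun t : ℝ≥0 => (t : ℝ) * variance (X 1) P / (ε / 2) ^ 2) (𝓝 0)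
          (𝓝 (((0 : ℝ≥0) : ℝ) * variance (X 1) P / (ε / 2) ^ 2)) :=
        ((NNReal.continuous_coe.tendsto 0).mul_const _).div_const _
      have h3 := (ENNReal.continuous_ofReal.tendsto _).comp this
      simpa [Function.comp_def] using h3
    · have := meas_ge_le_variance_div_sq (h2 t) (c := ε / 2) (by positivity)
      rwa [hX.variance_eq hm h1 t] at this
  have e1 := hp1.eventually (Iio_mem_nhds (show (0 : ℝ≥0∞) < 1 / 2 by simp))
  have e2 := hp2.eventually (Iio_mem_nhds (show (0 : ℝ≥0∞) < 1 / 2 by simp))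
  filter_upwards [e1, e2] with t ht1 ht2
  have hlt : P ({ω | ε / 2 ≤ ‖X t ω‖} ∪ {ω | ε / 2 ≤ |X t ω - ∫ ω, X t ω ∂P|}) < 1 :=
    (measure_union_le _ _).trans_lt (by
      calc _ < (1 / 2 + 1 / 2 : ℝ≥0∞) := ENNReal.add_lt_add ht1 ht2
        _ = 1 := ENNReal.add_halves 1)
  obtain ⟨ω, hω⟩ : ∃ ω, ω ∉ ({ω | ε / 2 ≤ ‖X t ω‖} ∪ {ω | ε / 2 ≤ |X t ω - ∫ ω, X t ω ∂P|}) := by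
    by_contra! hall
    rw [Set.eq_univ_of_forall hall, measure_univ] at hlt
    exact lt_irrefl _ hlt
  simp only [Set.mem_union, Set.mem_ofPred_eq, not_or, not_le, Real.norm_eq_abs] at hω
  rw [Real.dist_eq, sub_zero]
  have h5 := abs_lt.1 hω.1
  have h6 := abs_lt.1 hω.2
  rw [abs_lt]
  constructor <;> linarith [h5.1, h5.2, h6.1, h6.2]

end IsLevyProcess

variable {U : Type*} [NormedAddCommGroup U] [InnerProductSpace ℝ U]
  {L : ℝ≥0 → U →ₗ[ℝ] (Ω →ₘ[P] ℝ)}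

theorem IsCylindricalLevy.isLevyProcess (hL : IsCylindricalLevy P L) (u : U) :
    IsLevyProcess P fun t ω => L t u ω := by
  have h := hL.levy 1 fun _ => u
  refine ⟨?_, ?_, fun s r => ?_, fun t => ?_⟩
  · filter_upwards [h.zero] with ω hω using congrFun hω 0
  · exact h.indep.map (ContinuousLinearMap.proj (R := ℝ) (φ := fun _ : Fin 1 => ℝ) 0)
  · exact (h.stationary s r).comp (measurable_pi_apply 0)
  · intro ε hε
    refine (h.stochContinuous t ε hε).congr fun s => ?_
    congr 1
    ext ω
    simp [edist_pi_const]

theorem memLp_value [IsProbabilityMeasure P] (hL : IsCylindricalLevy P L)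
    (hL2 : HasWeakSecondMoments P L) (t : ℝ≥0) (u : U) : MemLp (L t u) 2 P :=
  (hL.isLevyProcess u).memLp_two (fun _ => AEEqFun.measurable _) (hL2 u) t

variable [CompleteSpace U]

/-- By the closed graph theorem, `u ↦ L(1)u` is bounded from `U` to `L²(P)`. -/
theorem exists_integral_sq_le (hL : IsCylindricalLevy P L) (hL2 : HasWeakSecondMoments P L) :
    ∃ C : ℝ, 0 ≤ C ∧ ∀ u, ∫ ω, (L 1 u ω) ^ 2 ∂P ≤ C * ‖u‖ ^ 2 := by
  let A : U →ₗ[ℝ] Lp ℝ 2 P :=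
    { toFun := fun u => ⟨L 1 u, Lp.mem_Lp_iff_memLp.2 (hL2 u)⟩
      map_add' := fun u w => Subtype.ext (map_add (L 1) u w)
      map_smul' := fun c u => Subtype.ext (map_smul (L 1) c u) }
  have hAL : ∀ u, ((A u : Lp ℝ 2 P) : Ω → ℝ) = fun ω => L 1 u ω := fun _ => rfl
  have hA : Continuous A := by
    refine A.continuous_of_seq_closed_graph fun u x y hu hAu => ?_
    have h1 : TendstoInMeasure P (fun n ω => L 1 (u n) ω) atTop (fun ω => L 1 x ω) :=
      (hL.continuous 1 x).comp hu
    have h2 : TendstoInMeasure P (fun n => ((A (u n) : Lp ℝ 2 P) : Ω → ℝ)) atTop y :=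
      tendstoInMeasure_of_tendsto_Lp hAu
    have h3 : ((A x : Lp ℝ 2 P) : Ω → ℝ) =ᵐ[P] y := tendstoInMeasure_ae_unique h1 h2
    exact (Lp.ext h3).symm
  let A' : U →L[ℝ] Lp ℝ 2 P := ⟨A, hA⟩
  refine ⟨‖A'‖ ^ 2, by positivity, fun u => ?_⟩
  have h1 : ∫ ω, (L 1 u ω) ^ 2 ∂P = ‖A' u‖ ^ 2 := by
    rw [← real_inner_self_eq_norm_sq, L2.inner_def]
    refine integral_congr_ae (Eventually.of_forall fun ω => ?_)
    simp only [RCLike.inner_apply, conj_trivial]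
    rw [← sq]
    rfl
  rw [h1, ← mul_pow]
  exact pow_le_pow_left₀ (norm_nonneg _) (A'.le_opNorm u) 2

end Moments

/-! ### Square integrable functions -/

section L2Facts

variable {Ω : Type*} [mΩ : MeasurableSpace Ω] {P : Measure Ω}
  {V : Type*} [NormedAddCommGroup V]

theorem sq_toReal_eLpNorm_two {f : Ω → V} (hf : MemLp f 2 P) :
    (eLpNorm f 2 P).toReal ^ 2 = ∫ ω, ‖f ω‖ ^ 2 ∂P := by
  have h0 : 0 ≤ ∫ ω, ‖f ω‖ ^ 2 ∂P := integral_nonneg fun ω => by positivity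
  rw [hf.eLpNorm_eq_integral_rpow_norm (by simp) (by simp)]
  simp only [ENNReal.toReal_ofNat, Real.rpow_ofNat]
  rw [ENNReal.toReal_ofReal (by positivity), ← Real.rpow_natCast, ← Real.rpow_mul h0]
  norm_num

variable [InnerProductSpace ℝ V]

theorem abs_integral_inner_le {f g : Ω → V} (hf : MemLp f 2 P) (hg : MemLp g 2 P) :
    |∫ ω, inner ℝ (f ω) (g ω) ∂P| ≤ (eLpNorm f 2 P).toReal * (eLpNorm g 2 P).toReal := by
  have h1 : ∫ ω, inner ℝ (f ω) (g ω) ∂P = inner ℝ (hf.toLp f) (hg.toLp g) := by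
    rw [L2.inner_def]
    refine integral_congr_ae ?_
    filter_upwards [hf.coeFn_toLp, hg.coeFn_toLp] with ω h1 h2
    rw [h1, h2]
  rw [h1, ← Lp.norm_toLp f hf, ← Lp.norm_toLp g hg]
  exact abs_real_inner_le_norm _ _

theorem integrable_inner {f g : Ω → V} (hf : MemLp f 2 P) (hg : MemLp g 2 P) :
    Integrable (fun ω => inner ℝ (f ω) (g ω)) P := by
  refine (L2.integrable_inner (𝕜 := ℝ) (hf.toLp f) (hg.toLp g)).congr ?_
  filter_upwards [hf.coeFn_toLp, hg.coeFn_toLp] with ω h1 h2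
  rw [h1, h2]

theorem tendsto_integral_inner {ι : Type*} {l : Filter ι} {Z Y : Ω → V} {f : ι → Ω → V}
    (hZ : MemLp Z 2 P) (hf : ∀ i, MemLp (f i) 2 P) (hY : MemLp Y 2 P)
    (h : Tendsto (fun i => eLpNorm (f i - Y) 2 P) l (𝓝 0)) :
    Tendsto (fun i => ∫ ω, inner ℝ (Z ω) (f i ω) ∂P) l (𝓝 (∫ ω, inner ℝ (Z ω) (Y ω) ∂P)) := by
  rw [tendsto_iff_norm_sub_tendsto_zero]
  have h1 : Tendsto (fun i => (eLpNorm Z 2 P).toReal * (eLpNorm (f i - Y) 2 P).toReal) l (𝓝 0) := by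
    have := ((ENNReal.tendsto_toReal (by simp)).comp h).const_mul (eLpNorm Z 2 P).toReal
    simpa [Function.comp_def] using this
  refine squeeze_zero (fun _ => norm_nonneg _) (fun i => ?_) h1
  rw [← integral_sub (integrable_inner hZ (hf i)) (integrable_inner hZ hY)]
  simp_rw [← inner_sub_right]
  exact abs_integral_inner_le hZ ((hf i).sub hY)

end L2Facts

/-! ### The Hilbert-Schmidt norm -/

section HilbertSchmidtFacts

variable {U V : Type*} [NormedAddCommGroup U] [InnerProductSpace ℝ U] [CompleteSpace U]
  [NormedAddCommGroup V] [InnerProductSpace ℝ V]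

instance : NormedSpace ℝ (HilbertSchmidt U V) where
  norm_smul_le c φ := by
    change ‖HilbertSchmidt.toLp (c • φ)‖ ≤ ‖c‖ * ‖HilbertSchmidt.toLp φ‖
    rw [map_smul]
    exact norm_smul_le c _

theorem HilbertSchmidt.hasSum_norm_sq (φ : HilbertSchmidt U V) :
    HasSum (fun k => ‖φ.toCLM (onb U k)‖ ^ 2) (‖φ‖ ^ 2) := by
  have h := lp.hasSum_norm (p := 2) (by simp) (HilbertSchmidt.toLp φ)
  simp only [ENNReal.toReal_ofNat, Real.rpow_ofNat] at h
  exact h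

theorem HilbertSchmidt.sum_norm_sq_le (φ : HilbertSchmidt U V) (F : Finset (onbIndex U)) :
    ∑ k ∈ F, ‖φ.toCLM (onb U k)‖ ^ 2 ≤ ‖φ‖ ^ 2 :=
  sum_le_hasSum F (fun _ _ => by positivity) φ.hasSum_norm_sq

theorem HilbertSchmidt.norm_apply_onb_le (φ : HilbertSchmidt U V) (k : onbIndex U) :
    ‖φ.toCLM (onb U k)‖ ≤ ‖φ‖ := by
  have := φ.sum_norm_sq_le {k}
  rw [Finset.sum_singleton] at this
  exact (pow_le_pow_iff_left₀ (norm_nonneg _) (norm_nonneg _) two_ne_zero).1 this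

/-- Evaluation of a Hilbert-Schmidt operator at the basis vector `e_k`. -/
noncomputable def evalOnb (k : onbIndex U) : HilbertSchmidt U V →L[ℝ] V :=
  LinearMap.mkContinuous
    { toFun := fun φ => φ.toCLM (onb U k)
      map_add' := fun φ ψ => by simp
      map_smul' := fun c φ => by simp } 1
    (fun φ => by simpa using φ.norm_apply_onb_le k)

end HilbertSchmidtFacts

/-- The entrywise product of a positive semidefinite matrix and a Gram matrix has nonnegative
entry sum, by the Schur product theorem. -/
theorem sum_mul_inner_nonneg {ι V : Type*} [Fintype ι] [NormedAddCommGroup V]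
    [InnerProductSpace ℝ V] {M : Matrix ι ι ℝ} (hM : M.PosSemidef) (x : ι → V) :
    0 ≤ ∑ j, ∑ k, M j k * inner ℝ (x j) (x k) := by
  have h := (hM.hadamard (Matrix.posSemidef_gram ℝ x)).dotProduct_mulVec_nonneg (fun _ => 1)
  simpa [dotProduct, Matrix.mulVec, Matrix.gram] using h

/-! ### Second moment and mean of one increment -/

section Noise

variable {Ω : Type*} {𝓖 : MeasurableSpace Ω} [mΩ : MeasurableSpace Ω] {P : Measure Ω}
  {U V : Type*} [NormedAddCommGroup U] [InnerProductSpace ℝ U]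
  [NormedAddCommGroup V] [InnerProductSpace ℝ V]

/-- A cylindrical random variable `D` in `U` with weak second moments which is independent of the
σ-algebra `𝓖` (for pairs of vectors), with bounds `κ` and `β` for its covariance and its mean. -/
structure IsNoise (𝓖 : MeasurableSpace Ω) (D : U →ₗ[ℝ] Lp ℝ 2 P) (κ β : ℝ) : Prop where
  le : 𝓖 ≤ mΩ
  indep : ∀ u w, Indep 𝓖 (MeasurableSpace.comap (fun ω => (D u ω, D w ω)) inferInstance) P
  norm_sq_le : ∀ u, ‖D u‖ ^ 2 ≤ κ * ‖u‖ ^ 2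
  abs_integral_le : ∀ u, |∫ ω, D u ω ∂P| ≤ β * ‖u‖
  cov_nonneg : 0 ≤ κ
  mean_nonneg : 0 ≤ β

variable {D : U →ₗ[ℝ] Lp ℝ 2 P} {κ β : ℝ}

theorem lp_measurable (f : Lp ℝ 2 P) : Measurable f := (Lp.stronglyMeasurable f).measurable

theorem IsNoise.indepFun_mul (h : IsNoise 𝓖 D κ β) (u w : U) {f : Ω → ℝ} (hf : Measurable[𝓖] f) :
    IndepFun (fun ω => D u ω * D w ω) f P := by
  have h1 : IndepFun f (fun ω => (D u ω, D w ω)) P := by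
    rw [IndepFun_iff_Indep]
    exact indep_of_indep_of_le_left (h.indep u w) hf.comap_le
  exact (h1.comp (φ := id) (ψ := fun z : ℝ × ℝ => z.1 * z.2) measurable_id (by fun_prop)).symm

theorem IsNoise.indepFun (h : IsNoise 𝓖 D κ β) (u : U) {f : Ω → ℝ} (hf : Measurable[𝓖] f) :
    IndepFun (fun ω => D u ω) f P := by
  have h1 : IndepFun f (fun ω => (D u ω, D u ω)) P := by
    rw [IndepFun_iff_Indep]
    exact indep_of_indep_of_le_left (h.indep u u) hf.comap_le
  exact (h1.comp (φ := id) (ψ := fun z : ℝ × ℝ => z.1) measurable_id (by fun_prop)).symm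

theorem integrable_mul_Lp (u w : U) : Integrable (fun ω => D u ω * D w ω) P :=
  (Lp.memLp (D u)).integrable_mul (Lp.memLp (D w))

theorem integral_mul_Lp (u w : U) : ∫ ω, D u ω * D w ω ∂P = inner ℝ (D u) (D w) := by
  rw [L2.inner_def]
  refine integral_congr_ae (Eventually.of_forall fun ω => ?_)
  simp [mul_comm]

theorem IsNoise.memLp_smul (h : IsNoise 𝓖 D κ β) (u : U) {x : Ω → V}
    (hx : StronglyMeasurable[𝓖] x) (hx2 : MemLp x 2 P) :
    MemLp (fun ω => D u ω • x ω) 2 P := by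
  have hm : AEStronglyMeasurable (fun ω => D u ω • x ω) P :=
    (lp_measurable (D u)).aestronglyMeasurable.smul hx2.1
  rw [memLp_two_iff_integrable_sq_norm hm]
  have h1 := (h.indepFun_mul u u (f := fun ω => ‖x ω‖ ^ 2) 
    (hx.norm.pow 2).measurable).integrable_mul (integrable_mul_Lp u u) (hx2.integrable_norm_pow two_ne_zero)
  refine h1.congr (Eventually.of_forall fun ω => ?_)
  simp only [Pi.mul_apply, norm_smul, mul_pow, Real.norm_eq_abs, sq_abs]
  ring

/-- The Itô inequality for one increment. The covariance matrix of `(D(u_i))` is at most `κ` times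
the identity matrix, and it enters the second moment through its entrywise product with a Gram
matrix. -/
theorem IsNoise.integral_norm_sum_sq_le (h : IsNoise 𝓖 D κ β) {ι : Type*} [Fintype ι] {u : ι → U}
    (hu : Orthonormal ℝ u) {x : ι → Ω → V} (hx : ∀ i, StronglyMeasurable[𝓖] (x i))
    (hx2 : ∀ i, MemLp (x i) 2 P) :
    ∫ ω, ‖∑ i, D (u i) ω • x i ω‖ ^ 2 ∂P ≤ κ * ∫ ω, ∑ i, ‖x i ω‖ ^ 2 ∂P := by
  classical
  have hinner : ∀ i j, StronglyMeasurable[𝓖] fun ω => (inner ℝ (x i ω) (x j ω) : ℝ) := fun i j =>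
    (hx i).inner (hx j)
  have hi2 : ∀ i j, Integrable (fun ω => (inner ℝ (x i ω) (x j ω) : ℝ)) P := fun i j =>
    integrable_inner (hx2 i) (hx2 j)
  have hint : ∀ i j, Integrable (fun ω => D (u i) ω * D (u j) ω * inner ℝ (x i ω) (x j ω)) P :=
    fun i j => (h.indepFun_mul (u i) (u j) (hinner i j).measurable).integrable_mul
      (integrable_mul_Lp _ _) (hi2 i j)
  have hval : ∀ i j, ∫ ω, D (u i) ω * D (u j) ω * inner ℝ (x i ω) (x j ω) ∂P
      = inner ℝ (D (u i)) (D (u j)) * ∫ ω, inner ℝ (x i ω) (x j ω) ∂P := fun i j => by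
    rw [(h.indepFun_mul (u i) (u j) (hinner i j).measurable).integral_fun_mul_eq_mul_integral
      (integrable_mul_Lp _ _).1 (hi2 i j).1, integral_mul_Lp]
  have hexp : ∀ ω, ‖∑ i, D (u i) ω • x i ω‖ ^ 2
      = ∑ i, ∑ j, D (u i) ω * D (u j) ω * inner ℝ (x i ω) (x j ω) := fun ω => by
    rw [← real_inner_self_eq_norm_sq, sum_inner]
    refine Finset.sum_congr rfl fun i _ => ?_
    rw [inner_sum]
    refine Finset.sum_congr rfl fun j _ => ?_
    rw [real_inner_smul_left, real_inner_smul_right]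
    ring
  -- the covariance matrix of `(D u_i)` is dominated by `κ` times the identity
  have hpsd : (κ • (1 : Matrix ι ι ℝ) - Matrix.gram ℝ fun i => D (u i)).PosSemidef := by
    refine Matrix.PosSemidef.of_dotProduct_mulVec_nonneg ?_ fun c => ?_
    · refine Matrix.IsHermitian.sub ?_ (Matrix.posSemidef_gram ℝ _).isHermitian
      simp [Matrix.IsHermitian]
    · have h1 := h.norm_sq_le (∑ i, c i • u i)
      rw [map_sum, ← real_inner_self_eq_norm_sq, ← real_inner_self_eq_norm_sq,
        hu.inner_sum, sum_inner] at h1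
      simp only [inner_sum, map_smul, real_inner_smul_left, real_inner_smul_right] at h1
      simp only [star_trivial, Matrix.sub_mulVec, dotProduct_sub, sub_nonneg, Matrix.smul_mulVec,
        Matrix.one_mulVec, dotProduct_smul]
      simp only [dotProduct, Matrix.mulVec, Matrix.gram_apply, Finset.mul_sum, smul_eq_mul]
      simp only [Finset.mul_sum, conj_trivial] at h1
      refine le_trans (le_of_eq ?_) h1
      refine Finset.sum_congr rfl fun i _ => Finset.sum_congr rfl fun j _ => ?_
      ring
  have key : ∀ ω, ∑ i, ∑ j, inner ℝ (D (u i)) (D (u j)) * inner ℝ (x i ω) (x j ω)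
      ≤ κ * ∑ i, ‖x i ω‖ ^ 2 := fun ω => by
    have := sum_mul_inner_nonneg hpsd fun i => x i ω
    simp only [Matrix.sub_apply, Matrix.smul_apply, Matrix.one_apply, Matrix.gram_apply, sub_mul,
      Finset.sum_sub_distrib, smul_eq_mul, mul_ite, mul_one, mul_zero, ite_mul, zero_mul,
      Finset.sum_ite_eq, Finset.mem_univ, if_true, real_inner_self_eq_norm_sq,
      ← Finset.mul_sum] at this
    linarith
  calc ∫ ω, ‖∑ i, D (u i) ω • x i ω‖ ^ 2 ∂P
      = ∑ i, ∑ j, inner ℝ (D (u i)) (D (u j)) * ∫ ω, inner ℝ (x i ω) (x j ω) ∂P := by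
        simp_rw [hexp]
        rw [integral_finsetSum _ fun i _ => integrable_finsetSum _ fun j _ => hint i j]
        refine Finset.sum_congr rfl fun i _ => ?_
        rw [integral_finsetSum _ fun j _ => hint i j]
        exact Finset.sum_congr rfl fun j _ => hval i j
    _ = ∫ ω, ∑ i, ∑ j, inner ℝ (D (u i)) (D (u j)) * inner ℝ (x i ω) (x j ω) ∂P := by
        rw [integral_finsetSum _ fun i _ => integrable_finsetSum _ fun j _ => (hi2 i j).const_mul _]
        refine Finset.sum_congr rfl fun i _ => ?_
        rw [integral_finsetSum _ fun j _ => (hi2 i j).const_mul _]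
        exact Finset.sum_congr rfl fun j _ => (integral_const_mul _ _).symm
    _ ≤ ∫ ω, κ * ∑ i, ‖x i ω‖ ^ 2 ∂P := by
        refine integral_mono ?_ ?_ key
        · exact integrable_finsetSum _ fun i _ => integrable_finsetSum _ fun j _ =>
            (hi2 i j).const_mul _
        · exact (integrable_finsetSum _ fun i _ =>
            (hx2 i).integrable_norm_pow two_ne_zero).const_mul _
    _ = κ * ∫ ω, ∑ i, ‖x i ω‖ ^ 2 ∂P := integral_const_mul _ _

/-- The mean of one increment: by independence, `D(u_i)` may be replaced by its mean, and the means
of an orthonormal family form a vector of norm at most `β`. -/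
theorem IsNoise.abs_integral_inner_sum_le [IsFiniteMeasure P] (h : IsNoise 𝓖 D κ β) {ι : Type*}
    [Fintype ι] {u : ι → U} (hu : Orthonormal ℝ u) {x : ι → Ω → V}
    (hx : ∀ i, StronglyMeasurable[𝓖] (x i)) (hx2 : ∀ i, MemLp (x i) 2 P) {Z : Ω → V}
    (hZ : StronglyMeasurable[𝓖] Z) (hZ2 : MemLp Z 2 P)
    {y : Ω → ℝ} (hy : MemLp y 2 P) (hy0 : ∀ ω, 0 ≤ y ω) (hxy : ∀ ω, ∑ i, ‖x i ω‖ ^ 2 ≤ y ω ^ 2) :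
    |∫ ω, inner ℝ (Z ω) (∑ i, D (u i) ω • x i ω) ∂P| ≤ β * ∫ ω, ‖Z ω‖ * y ω ∂P := by
  set m : ι → ℝ := fun i => ∫ ω, D (u i) ω ∂P with hm
  have hinner : ∀ i, StronglyMeasurable[𝓖] fun ω => (inner ℝ (Z ω) (x i ω) : ℝ) := fun i =>
    hZ.inner (hx i)
  have hi2 : ∀ i, Integrable (fun ω => (inner ℝ (Z ω) (x i ω) : ℝ)) P := fun i =>
    integrable_inner hZ2 (hx2 i)
  have hDi : ∀ u, Integrable (D u) P := fun u => (Lp.memLp (D u)).integrable one_le_two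
  have hint : ∀ i, Integrable (fun ω => D (u i) ω * inner ℝ (Z ω) (x i ω)) P :=
    fun i => (h.indepFun (u i) (hinner i).measurable).integrable_mul (hDi _) (hi2 i)
  have h1 : ∫ ω, inner ℝ (Z ω) (∑ i, D (u i) ω • x i ω) ∂P
      = ∫ ω, inner ℝ (Z ω) (∑ i, m i • x i ω) ∂P := by
    simp_rw [inner_sum, real_inner_smul_right]
    rw [integral_finsetSum _ fun i _ => hint i,
      integral_finsetSum _ fun i _ => (hi2 i).const_mul _]
    refine Finset.sum_congr rfl fun i _ => ?_
    rw [(h.indepFun (u i) (hinner i).measurable).integral_fun_mul_eq_mul_integral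
      (hDi _).1 (hi2 i).1, integral_const_mul]
  have hmsq : ∑ i, m i ^ 2 ≤ β ^ 2 := by
    have h2 := h.abs_integral_le (∑ i, m i • u i)
    have h3 : ∫ ω, D (∑ i, m i • u i) ω ∂P = ∑ i, m i ^ 2 := by
      have : ∀ f : Lp ℝ 2 P, ∫ ω, f ω ∂P = inner ℝ (Lp.const 2 P (1 : ℝ)) f := fun f => by
        rw [L2.inner_def]
        refine integral_congr_ae ?_
        filter_upwards [Lp.coeFn_const (p := 2) (μ := P) (1 : ℝ)] with ω hω
        rw [hω]
        simp
      rw [this, map_sum, inner_sum]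
      refine Finset.sum_congr rfl fun i _ => ?_
      rw [map_smul, real_inner_smul_right, ← this, sq]
    have h4 : ‖∑ i, m i • u i‖ ^ 2 = ∑ i, m i ^ 2 := by
      rw [← real_inner_self_eq_norm_sq, hu.inner_sum]
      simp [sq]
    rw [h3, ← h4, abs_of_nonneg (sq_nonneg _)] at h2
    rw [← h4]
    rcases (norm_nonneg (∑ i, m i • u i)).eq_or_lt with h5 | h5
    · rw [← h5, zero_pow two_ne_zero]; exact sq_nonneg β
    · have : ‖∑ i, m i • u i‖ ≤ β := by
        rw [sq] at h2
        exact le_of_mul_le_mul_right h2 h5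
      exact pow_le_pow_left₀ h5.le this 2
  have hb : ∀ ω, ‖∑ i, m i • x i ω‖ ≤ β * y ω := fun ω => by
    refine abs_le_of_sq_le_sq' ?_ (mul_nonneg h.mean_nonneg (hy0 ω)) |>.2
    calc ‖∑ i, m i • x i ω‖ ^ 2 ≤ (∑ i, |m i| * ‖x i ω‖) ^ 2 := by
          refine pow_le_pow_left₀ (norm_nonneg _) ((norm_sum_le _ _).trans (le_of_eq ?_)) 2
          exact Finset.sum_congr rfl fun i _ => norm_smul _ _
      _ ≤ (∑ i, |m i| ^ 2) * ∑ i, ‖x i ω‖ ^ 2 := Finset.sum_mul_sq_le_sq_mul_sq _ _ _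
      _ ≤ β ^ 2 * y ω ^ 2 := by
          simp_rw [sq_abs]
          exact mul_le_mul hmsq (hxy ω) (by positivity) (by positivity)
      _ = (β * y ω) ^ 2 := by ring
  rw [h1, ← integral_const_mul]
  refine (norm_integral_le_integral_norm (μ := P)
    fun ω => inner ℝ (Z ω) (∑ i, m i • x i ω)).trans ?_
  refine integral_mono_of_nonneg (Eventually.of_forall fun ω => norm_nonneg _)
    ((hZ2.norm.integrable_mul hy).const_mul _) (Eventually.of_forall fun ω => ?_)
  calc ‖inner ℝ (Z ω) (∑ i, m i • x i ω)‖ ≤ ‖Z ω‖ * ‖∑ i, m i • x i ω‖ := norm_inner_le_norm _ _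
    _ ≤ ‖Z ω‖ * (β * y ω) := by gcongr; exact hb ω
    _ = β * (‖Z ω‖ * y ω) := by ring

end Noise

/-! ### Approximation in `L²` -/

section L2Distance

variable {S : Type*} {m : MeasurableSpace S} [mS : MeasurableSpace S] {μ : Measure S}
  {E : Type*} [NormedAddCommGroup E]

theorem eLpNorm_sub_triangle {f g h : S → E} (hf : MemLp f 2 μ) (hg : MemLp g 2 μ)
    (hh : MemLp h 2 μ) : eLpNorm (f - h) 2 μ ≤ eLpNorm (f - g) 2 μ + eLpNorm (g - h) 2 μ := by
  have : f - h = (f - g) + (g - h) := by abel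
  rw [this]
  exact eLpNorm_add_le (hf.sub hg).1 (hg.sub hh).1 one_le_two

theorem ae_eq_of_eLpNorm_sub_eq_zero {f g : S → E} (hf : MemLp f 2 μ) (hg : MemLp g 2 μ)
    (h : eLpNorm (f - g) 2 μ = 0) : f =ᵐ[μ] g := by
  rw [eLpNorm_eq_zero_iff (hf.sub hg).1 two_ne_zero] at h
  filter_upwards [h] with x hx
  exact sub_eq_zero.1 hx

theorem eLpNorm_le_add {f g : S → E} (hf : MemLp f 2 μ) (hg : MemLp g 2 μ) :
    eLpNorm f 2 μ ≤ eLpNorm (g - f) 2 μ + eLpNorm g 2 μ := by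
  have : f = -(g - f) + g := by abel
  conv_lhs => rw [this]
  refine (eLpNorm_add_le (hg.sub hf).neg.1 hg.1 one_le_two).trans ?_
  rw [eLpNorm_neg]

/-- Almost everywhere measurability with respect to a sub-σ-algebra passes to `L²`-limits. -/
theorem aestronglyMeasurable_of_eLpNorm_approx [CompleteSpace E] (hm : m ≤ mS) {f : S → E}
    (hf : MemLp f 2 μ) (h : ∀ ε : ℝ≥0∞, ε ≠ 0 → ∃ g : S → E, MemLp g 2 μ ∧
      AEStronglyMeasurable[m] g μ ∧ eLpNorm (g - f) 2 μ ≤ ε) : AEStronglyMeasurable[m] f μ := by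
  have h1 : hf.toLp f ∈ closure {f : Lp E 2 μ | AEStronglyMeasurable[m] f μ} := by
    refine Metric.mem_closure_iff.2 fun ε hε => ?_
    obtain ⟨g, hg, hgm, hgf⟩ := h (ENNReal.ofReal (ε / 2)) (by simpa using hε)
    refine ⟨hg.toLp g, hgm.congr hg.coeFn_toLp.symm, ?_⟩
    rw [dist_comm, Lp.dist_def, eLpNorm_congr_ae (hg.coeFn_toLp.sub hf.coeFn_toLp)]
    refine (ENNReal.toReal_mono (by simp) hgf).trans_lt ?_
    rw [ENNReal.toReal_ofReal (by positivity)]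
    linarith
  rw [(isClosed_aestronglyMeasurable hm).closure_eq] at h1
  exact AEStronglyMeasurable.congr h1 hf.coeFn_toLp

end L2Distance

/-! ### Integration of random operators against one increment -/

section NoiseIntegral

variable {Ω : Type*} {𝓖 𝓖' m : MeasurableSpace Ω} [mΩ : MeasurableSpace Ω] {P : Measure Ω}
  {U V : Type*} [NormedAddCommGroup U] [InnerProductSpace ℝ U] [CompleteSpace U]
  [NormedAddCommGroup V] [InnerProductSpace ℝ V]

/-- The partial sum `∑_{k ∈ F} D(e_k) Φ e_k` of the integral of `Φ` against the noise `D`. -/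
noncomputable def noiseSum (D : U →ₗ[ℝ] Lp ℝ 2 P) (F : Finset (onbIndex U))
    (Φ : Ω → HilbertSchmidt U V) (ω : Ω) : V :=
  ∑ k ∈ F, D (onb U k) ω • (Φ ω).toCLM (onb U k)

/-- `Y = ∑_k D(e_k) Φ e_k`, with convergence in `L²(P; V)`. For a constant operator this is the
radonification of `D`, for a random operator it is the increment of the stochastic integral. -/
def IsNoiseIntegral (D : U →ₗ[ℝ] Lp ℝ 2 P) (Φ : Ω → HilbertSchmidt U V) (Y : Ω → V) : Prop :=
  MemLp Y 2 P ∧ Tendsto (fun F => eLpNorm (noiseSum D F Φ - Y) 2 P) atTop (𝓝 0)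

variable {D : U →ₗ[ℝ] Lp ℝ 2 P} {κ β : ℝ} {Φ Φ' : Ω → HilbertSchmidt U V} {Y Y' : Ω → V}

omit mΩ in
theorem stronglyMeasurable_apply_onb (hΦ : StronglyMeasurable[𝓖] Φ) (k : onbIndex U) :
    StronglyMeasurable[𝓖] fun ω => (Φ ω).toCLM (onb U k) :=
  (evalOnb (V := V) k).continuous.comp_stronglyMeasurable hΦ

theorem memLp_apply_onb (hΦ : MemLp Φ 2 P) (k : onbIndex U) :
    MemLp (fun ω => (Φ ω).toCLM (onb U k)) 2 P :=
  (evalOnb (V := V) k).comp_memLp' hΦ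

theorem noiseSum_add (F : Finset (onbIndex U)) :
    noiseSum D F (Φ + Φ') = noiseSum D F Φ + noiseSum D F Φ' := by
  ext ω
  simp [noiseSum, Finset.sum_add_distrib]

theorem noiseSum_sub (F : Finset (onbIndex U)) :
    noiseSum D F (Φ - Φ') = noiseSum D F Φ - noiseSum D F Φ' := by
  ext ω
  simp [noiseSum, smul_sub]

theorem noiseSum_indicator (F : Finset (onbIndex U)) (A : Set Ω) :
    noiseSum D F (A.indicator Φ) = A.indicator (noiseSum D F Φ) := by
  classical
  ext ω
  by_cases h : ω ∈ A <;> simp [noiseSum, h]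

theorem IsNoise.memLp_noiseSum (h : IsNoise 𝓖 D κ β) (hΦ : StronglyMeasurable[𝓖] Φ)
    (hΦ2 : MemLp Φ 2 P) (F : Finset (onbIndex U)) : MemLp (noiseSum D F Φ) 2 P :=
  memLp_finsetSum F fun k _ =>
    h.memLp_smul _ (stronglyMeasurable_apply_onb hΦ k) (memLp_apply_onb hΦ2 k)

theorem orthonormal_onb_restrict (F : Finset (onbIndex U)) :
    Orthonormal ℝ fun k : F => onb U (k : onbIndex U) :=
  (onb U).orthonormal.comp _ Subtype.val_injective

theorem noiseSum_eq_sum_coe (F : Finset (onbIndex U)) (ω : Ω) :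
    noiseSum D F Φ ω = ∑ k : F, D (onb U (k : onbIndex U)) ω •
      (Φ ω).toCLM (onb U (k : onbIndex U)) :=
  (Finset.sum_coe_sort F fun k => D (onb U k) ω • (Φ ω).toCLM (onb U k)).symm

theorem IsNoise.integral_norm_noiseSum_sq_le (h : IsNoise 𝓖 D κ β)
    (hΦ : StronglyMeasurable[𝓖] Φ) (hΦ2 : MemLp Φ 2 P) (F : Finset (onbIndex U)) :
    ∫ ω, ‖noiseSum D F Φ ω‖ ^ 2 ∂P
      ≤ κ * ∑ k ∈ F, ∫ ω, ‖(Φ ω).toCLM (onb U k)‖ ^ 2 ∂P := by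
  have h1 := h.integral_norm_sum_sq_le (orthonormal_onb_restrict F)
    (x := fun (k : F) ω => (Φ ω).toCLM (onb U (k : onbIndex U)))
    (fun k => stronglyMeasurable_apply_onb hΦ k) (fun k => memLp_apply_onb hΦ2 k)
  simp_rw [noiseSum_eq_sum_coe]
  refine h1.trans (le_of_eq ?_)
  rw [integral_finsetSum _ fun k _ => (memLp_apply_onb hΦ2 _).integrable_norm_pow two_ne_zero]
  exact congrArg (κ * ·) (Finset.sum_coe_sort F fun k => ∫ ω, ‖(Φ ω).toCLM (onb U k)‖ ^ 2 ∂P)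

theorem sum_integral_norm_sq_le (hΦ2 : MemLp Φ 2 P) (F : Finset (onbIndex U)) :
    ∑ k ∈ F, ∫ ω, ‖(Φ ω).toCLM (onb U k)‖ ^ 2 ∂P ≤ ∫ ω, ‖Φ ω‖ ^ 2 ∂P := by
  have hi : ∀ k, Integrable (fun ω => ‖(Φ ω).toCLM (onb U k)‖ ^ 2) P := fun k =>
    (memLp_apply_onb hΦ2 k).integrable_norm_pow two_ne_zero
  rw [← integral_finsetSum _ fun k _ => hi k]
  exact integral_mono (integrable_finsetSum _ fun k _ => hi k)
    (hΦ2.integrable_norm_pow two_ne_zero) fun ω => (Φ ω).sum_norm_sq_le F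

theorem IsNoise.eLpNorm_noiseSum_le (h : IsNoise 𝓖 D κ β)
    (hΦ : StronglyMeasurable[𝓖] Φ) (hΦ2 : MemLp Φ 2 P) (F : Finset (onbIndex U)) :
    eLpNorm (noiseSum D F Φ) 2 P ≤ ENNReal.ofReal (√κ) * eLpNorm Φ 2 P := by
  have h1 := (h.integral_norm_noiseSum_sq_le hΦ hΦ2 F).trans
    (mul_le_mul_of_nonneg_left (sum_integral_norm_sq_le hΦ2 F) h.cov_nonneg)
  have hm := h.memLp_noiseSum hΦ hΦ2 F
  rw [← sq_toReal_eLpNorm_two hm, ← sq_toReal_eLpNorm_two hΦ2, ← Real.sq_sqrt h.cov_nonneg,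
    ← mul_pow] at h1
  have h2 := (pow_le_pow_iff_left₀ (by positivity) (by positivity) two_ne_zero).1 h1
  rw [← ENNReal.ofReal_toReal hm.2.ne, ← ENNReal.ofReal_toReal hΦ2.2.ne,
    ← ENNReal.ofReal_mul (by positivity)]
  exact ENNReal.ofReal_le_ofReal h2

theorem IsNoise.exists_isNoiseIntegral [CompleteSpace V] (h : IsNoise 𝓖 D κ β)
    (hΦ : StronglyMeasurable[𝓖] Φ) (hΦ2 : MemLp Φ 2 P) : ∃ Y, IsNoiseIntegral D Φ Y := by
  classical
  have hm : ∀ k, MemLp (fun ω => D (onb U k) ω • (Φ ω).toCLM (onb U k)) 2 P := fun k =>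
    h.memLp_smul _ (stronglyMeasurable_apply_onb hΦ k) (memLp_apply_onb hΦ2 k)
  let g : onbIndex U → Lp V 2 P := fun k => (hm k).toLp _
  have hsum : ∀ F : Finset (onbIndex U),
      ∑ k ∈ F, g k = (h.memLp_noiseSum hΦ hΦ2 F).toLp (noiseSum D F Φ) := fun F => by
    induction F using Finset.induction_on with
    | empty =>
      refine Lp.ext ?_
      refine (Lp.coeFn_zero _ _ _).trans ?_
      refine EventuallyEq.trans ?_ (MemLp.coeFn_toLp _).symm
      exact Eventually.of_forall fun ω => by simp [noiseSum]
    | insert k F hk ih =>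
      rw [Finset.sum_insert hk, ih, ← MemLp.toLp_add]
      congr 1
      ext ω
      simp [noiseSum, Finset.sum_insert hk]
  have hsb : Summable fun k => ∫ ω, ‖(Φ ω).toCLM (onb U k)‖ ^ 2 ∂P :=
    summable_of_sum_le (fun k => integral_nonneg fun ω => by positivity)
      (sum_integral_norm_sq_le hΦ2)
  have hsg : Summable g := by
    rw [summable_iff_vanishing_norm]
    intro ε hε
    obtain ⟨s, hs⟩ := summable_iff_vanishing_norm.1 (hsb.mul_left κ) (ε ^ 2) (by positivity)
    refine ⟨s, fun t ht => ?_⟩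
    have h1 := h.integral_norm_noiseSum_sq_le hΦ hΦ2 t
    rw [← sq_toReal_eLpNorm_two (h.memLp_noiseSum hΦ hΦ2 t), Finset.mul_sum] at h1
    rw [hsum, Lp.norm_toLp]
    exact lt_of_pow_lt_pow_left₀ 2 hε.le (h1.trans_lt ((le_abs_self _).trans_lt (hs t ht)))
  refine ⟨(∑' k, g k : Lp V 2 P), Lp.memLp _, ?_⟩
  have h1 : Tendsto (fun F : Finset (onbIndex U) => ∑ k ∈ F, g k) atTop (𝓝 (∑' k, g k)) :=
    hsg.hasSum
  simp_rw [hsum] at h1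
  have h2 := (Lp.tendsto_Lp_iff_tendsto_eLpNorm' _ _).1 h1
  refine h2.congr fun F => eLpNorm_congr_ae ?_
  filter_upwards [(h.memLp_noiseSum hΦ hΦ2 F).coeFn_toLp] with ω hω
  simp [hω]

namespace IsNoiseIntegral

theorem ae_eq (h : IsNoise 𝓖 D κ β) (hΦ : StronglyMeasurable[𝓖] Φ) (hΦ2 : MemLp Φ 2 P)
    (hY : IsNoiseIntegral D Φ Y) (hY' : IsNoiseIntegral D Φ Y') : Y =ᵐ[P] Y' := by
  refine ae_eq_of_eLpNorm_sub_eq_zero hY.1 hY'.1 (le_antisymm ?_ bot_le)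
  have h1 := hY.2.add hY'.2
  rw [add_zero] at h1
  refine ge_of_tendsto' h1 fun F => ?_
  have := eLpNorm_sub_triangle hY.1 (h.memLp_noiseSum hΦ hΦ2 F) hY'.1
  rwa [eLpNorm_sub_comm Y (noiseSum D F Φ)] at this

theorem congr (hY : IsNoiseIntegral D Φ Y) (h : Y =ᵐ[P] Y') : IsNoiseIntegral D Φ Y' := by
  refine ⟨(memLp_congr_ae h).1 hY.1, hY.2.congr fun F => eLpNorm_congr_ae ?_⟩
  filter_upwards [h] with ω hω
  simp [hω]

theorem add (h : IsNoise 𝓖 D κ β) (hΦ : StronglyMeasurable[𝓖] Φ) (hΦ2 : MemLp Φ 2 P)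
    (hΦ' : StronglyMeasurable[𝓖] Φ') (hΦ2' : MemLp Φ' 2 P)
    (hY : IsNoiseIntegral D Φ Y) (hY' : IsNoiseIntegral D Φ' Y') :
    IsNoiseIntegral D (Φ + Φ') (Y + Y') := by
  refine ⟨hY.1.add hY'.1, ?_⟩
  have h1 := hY.2.add hY'.2
  rw [add_zero] at h1
  refine tendsto_of_tendsto_of_tendsto_of_le_of_le tendsto_const_nhds h1 (fun _ => bot_le)
    fun F => ?_
  have : noiseSum D F (Φ + Φ') - (Y + Y') = (noiseSum D F Φ - Y) + (noiseSum D F Φ' - Y') := by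
    rw [noiseSum_add]; abel
  simp only [this]
  exact eLpNorm_add_le ((h.memLp_noiseSum hΦ hΦ2 F).sub hY.1).1
    ((h.memLp_noiseSum hΦ' hΦ2' F).sub hY'.1).1 one_le_two

theorem sub (h : IsNoise 𝓖 D κ β) (hΦ : StronglyMeasurable[𝓖] Φ) (hΦ2 : MemLp Φ 2 P)
    (hΦ' : StronglyMeasurable[𝓖] Φ') (hΦ2' : MemLp Φ' 2 P)
    (hY : IsNoiseIntegral D Φ Y) (hY' : IsNoiseIntegral D Φ' Y') :
    IsNoiseIntegral D (Φ - Φ') (Y - Y') := by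
  refine ⟨hY.1.sub hY'.1, ?_⟩
  have h1 := hY.2.add hY'.2
  rw [add_zero] at h1
  refine tendsto_of_tendsto_of_tendsto_of_le_of_le tendsto_const_nhds h1 (fun _ => bot_le)
    fun F => ?_
  have : noiseSum D F (Φ - Φ') - (Y - Y') = (noiseSum D F Φ - Y) - (noiseSum D F Φ' - Y') := by
    rw [noiseSum_sub]; abel
  simp only [this]
  exact eLpNorm_sub_le ((h.memLp_noiseSum hΦ hΦ2 F).sub hY.1).1
    ((h.memLp_noiseSum hΦ' hΦ2' F).sub hY'.1).1 one_le_two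

theorem zero : IsNoiseIntegral D (0 : Ω → HilbertSchmidt U V) 0 := by
  refine ⟨MemLp.zero, ?_⟩
  have : ∀ F, noiseSum D F (0 : Ω → HilbertSchmidt U V) = 0 := fun F => by ext ω; simp [noiseSum]
  simp [this]

theorem indicator (hY : IsNoiseIntegral D Φ Y) {A : Set Ω} (hA : MeasurableSet A) :
    IsNoiseIntegral D (A.indicator Φ) (A.indicator Y) := by
  refine ⟨hY.1.indicator hA, ?_⟩
  refine tendsto_of_tendsto_of_tendsto_of_le_of_le tendsto_const_nhds hY.2 (fun _ => bot_le)
    fun F => ?_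
  simp only [noiseSum_indicator, ← Set.indicator_sub']
  exact eLpNorm_indicator_le _

theorem eLpNorm_le (h : IsNoise 𝓖 D κ β) (hΦ : StronglyMeasurable[𝓖] Φ) (hΦ2 : MemLp Φ 2 P)
    (hY : IsNoiseIntegral D Φ Y) : eLpNorm Y 2 P ≤ ENNReal.ofReal (√κ) * eLpNorm Φ 2 P := by
  have h1 := hY.2.add_const (ENNReal.ofReal (√κ) * eLpNorm Φ 2 P)
  rw [zero_add] at h1
  refine ge_of_tendsto' h1 fun F => ?_
  exact (eLpNorm_le_add hY.1 (h.memLp_noiseSum hΦ hΦ2 F)).trans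
    (add_le_add le_rfl (h.eLpNorm_noiseSum_le hΦ hΦ2 F))

theorem integral_norm_sq_le (h : IsNoise 𝓖 D κ β) (hΦ : StronglyMeasurable[𝓖] Φ)
    (hΦ2 : MemLp Φ 2 P) (hY : IsNoiseIntegral D Φ Y) :
    ∫ ω, ‖Y ω‖ ^ 2 ∂P ≤ κ * ∫ ω, ‖Φ ω‖ ^ 2 ∂P := by
  rw [← sq_toReal_eLpNorm_two hY.1, ← sq_toReal_eLpNorm_two hΦ2]
  have h1 := ENNReal.toReal_mono (ENNReal.mul_ne_top (by simp) hΦ2.2.ne) (hY.eLpNorm_le h hΦ hΦ2)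
  rw [ENNReal.toReal_mul, ENNReal.toReal_ofReal (by positivity)] at h1
  calc _ ≤ (√κ * (eLpNorm Φ 2 P).toReal) ^ 2 := pow_le_pow_left₀ (by positivity) h1 2
    _ = _ := by rw [mul_pow, Real.sq_sqrt h.cov_nonneg]

theorem abs_integral_inner_le [IsFiniteMeasure P] (h : IsNoise 𝓖 D κ β)
    (hΦ : StronglyMeasurable[𝓖] Φ) (hΦ2 : MemLp Φ 2 P) (hY : IsNoiseIntegral D Φ Y)
    {Z : Ω → V} (hZ : StronglyMeasurable[𝓖] Z) (hZ2 : MemLp Z 2 P) :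
    |∫ ω, inner ℝ (Z ω) (Y ω) ∂P| ≤ β * ∫ ω, ‖Z ω‖ * ‖Φ ω‖ ∂P := by
  have h1 := (tendsto_integral_inner hZ2 (h.memLp_noiseSum hΦ hΦ2) hY.1 hY.2).abs
  refine le_of_tendsto' h1 fun F => ?_
  simp_rw [noiseSum_eq_sum_coe]
  refine h.abs_integral_inner_sum_le (orthonormal_onb_restrict F)
    (x := fun (k : F) ω => (Φ ω).toCLM (onb U (k : onbIndex U)))
    (fun k => stronglyMeasurable_apply_onb hΦ k) (fun k => memLp_apply_onb hΦ2 k)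
    hZ hZ2 hΦ2.norm (fun _ => norm_nonneg _) fun ω => ?_
  rw [Finset.sum_coe_sort F fun k => ‖(Φ ω).toCLM (onb U k)‖ ^ 2]
  exact (Φ ω).sum_norm_sq_le F

theorem add_noise {D' : U →ₗ[ℝ] Lp ℝ 2 P} {κ' β' : ℝ}
    (h : IsNoise 𝓖 D κ β) (h' : IsNoise 𝓖' D' κ' β') (hΦ : StronglyMeasurable[𝓖] Φ)
    (hΦ' : StronglyMeasurable[𝓖'] Φ) (hΦ2 : MemLp Φ 2 P)
    (hY : IsNoiseIntegral D Φ Y) (hY' : IsNoiseIntegral D' Φ Y') :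
    IsNoiseIntegral (D + D') Φ (Y + Y') := by
  refine ⟨hY.1.add hY'.1, ?_⟩
  have h1 := hY.2.add hY'.2
  rw [add_zero] at h1
  refine tendsto_of_tendsto_of_tendsto_of_le_of_le tendsto_const_nhds h1 (fun _ => bot_le)
    fun F => ?_
  have : noiseSum (D + D') F Φ - (Y + Y') =ᵐ[P]
      (noiseSum D F Φ - Y) + (noiseSum D' F Φ - Y') := by
    have h2 : ∀ k ∈ F, ∀ᵐ ω ∂P, (D + D') (onb U k) ω = D (onb U k) ω + D' (onb U k) ω :=
      fun k _ => by
        rw [LinearMap.add_apply]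
        exact Lp.coeFn_add _ _
    filter_upwards [(ae_ball_iff F.countable_toSet).2 h2] with ω hω
    have h3 : noiseSum (D + D') F Φ ω = noiseSum D F Φ ω + noiseSum D' F Φ ω := by
      simp only [noiseSum, ← Finset.sum_add_distrib, ← add_smul]
      exact Finset.sum_congr rfl fun k hk => by rw [hω k hk]
    simp only [Pi.sub_apply, Pi.add_apply, h3]
    abel
  rw [eLpNorm_congr_ae this]
  exact eLpNorm_add_le ((h.memLp_noiseSum hΦ hΦ2 F).sub hY.1).1
    ((h'.memLp_noiseSum hΦ' hΦ2 F).sub hY'.1).1 one_le_two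

theorem aestronglyMeasurable [CompleteSpace V] (h : IsNoise 𝓖 D κ β)
    (hΦ : StronglyMeasurable[𝓖] Φ) (hΦ2 : MemLp Φ 2 P) (hm : 𝓖 ≤ m) (hm' : m ≤ mΩ)
    (hD : ∀ u, AEStronglyMeasurable[m] (D u) P) (hY : IsNoiseIntegral D Φ Y) :
    AEStronglyMeasurable[m] Y P := by
  refine aestronglyMeasurable_of_eLpNorm_approx hm' hY.1 fun ε hε => ?_
  obtain ⟨F, hF⟩ := (ENNReal.tendsto_nhds_zero.1 hY.2 ε (pos_iff_ne_zero.2 hε)).exists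
  refine ⟨_, h.memLp_noiseSum hΦ hΦ2 F, ?_, hF⟩
  refine ⟨fun ω => ∑ k ∈ F, (hD (onb U k)).mk _ ω • (Φ ω).toCLM (onb U k), ?_, ?_⟩
  · exact Finset.stronglyMeasurable_fun_sum F fun k _ =>
      (hD _).stronglyMeasurable_mk.smul ((stronglyMeasurable_apply_onb hΦ k).mono hm)
  · have h1 : ∀ k ∈ F, ∀ᵐ ω ∂P, D (onb U k) ω = (hD (onb U k)).mk _ ω := fun k _ =>
      (hD (onb U k)).ae_eq_mk
    filter_upwards [(ae_ball_iff F.countable_toSet).2 h1] with ω hω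
    exact Finset.sum_congr rfl fun k hk => by rw [hω k hk]

/-- The integral of a constant operator is the radonification of the noise. -/
theorem inner_ae_eq [CompleteSpace V] [IsFiniteMeasure P] (h : IsNoise 𝓖 D κ β)
    {φ : HilbertSchmidt U V} (hY : IsNoiseIntegral D (fun _ => φ) Y) (v : V) :
    (fun ω => inner ℝ (Y ω) v) =ᵐ[P] D (ContinuousLinearMap.adjoint φ.toCLM v) := by
  set w := ContinuousLinearMap.adjoint φ.toCLM v with hw
  have hm := h.memLp_noiseSum (Φ := fun _ => φ) stronglyMeasurable_const (memLp_const φ)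
  have hin : ∀ {f : Ω → V}, MemLp f 2 P → MemLp (fun ω => inner ℝ (f ω) v) 2 P := fun hf =>
    hf.inner_const v
  refine ae_eq_of_eLpNorm_sub_eq_zero (hin hY.1) (Lp.memLp _) (le_antisymm ?_ bot_le)
  have hcont : Continuous D := by
    refine (D.mkContinuous (√κ) fun u => ?_).continuous
    have h1 := h.norm_sq_le u
    rw [← Real.sq_sqrt h.cov_nonneg, ← mul_pow] at h1
    exact (pow_le_pow_iff_left₀ (norm_nonneg _) (by positivity) two_ne_zero).1 h1
  have hsum : Tendsto (fun F : Finset (onbIndex U) => ∑ k ∈ F, inner ℝ (onb U k) w • onb U k)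
      atTop (𝓝 w) := by
    have := (onb U).hasSum_repr w
    simp only [HilbertBasis.repr_apply_apply] at this
    exact this
  have h1 : Tendsto (fun F : Finset (onbIndex U) =>
      eLpNorm (D (∑ k ∈ F, inner ℝ (onb U k) w • onb U k) - D w : Ω → ℝ) 2 P) atTop (𝓝 0) :=
    (Lp.tendsto_Lp_iff_tendsto_eLpNorm' _ _).1 ((hcont.tendsto w).comp hsum)
  have h2 := (ENNReal.Tendsto.const_mul (a := ‖v‖ₑ) hY.2 (Or.inr (by simp))).add h1
  rw [mul_zero, zero_add] at h2
  refine ge_of_tendsto' h2 fun F => ?_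
  have hF : (D (∑ k ∈ F, inner ℝ (onb U k) w • onb U k) : Ω → ℝ) =ᵐ[P]
      fun ω => inner ℝ (noiseSum D F (fun _ => φ) ω) v := by
    rw [map_sum]
    refine (Lp.coeFn_fun_finsetSum _ _).trans ?_
    have h3 : ∀ k ∈ F, ∀ᵐ ω ∂P, D ((inner ℝ (onb U k) w : ℝ) • onb U k) ω
        = (inner ℝ (onb U k) w : ℝ) * D (onb U k) ω := fun k _ => by
      rw [map_smul]
      exact Lp.coeFn_smul _ _
    filter_upwards [(ae_ball_iff F.countable_toSet).2 h3] with ω hω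
    simp only [noiseSum, sum_inner]
    refine Finset.sum_congr rfl fun k hk => ?_
    rw [hω k hk, real_inner_smul_left, hw, ContinuousLinearMap.adjoint_inner_right, mul_comm]
  refine (eLpNorm_sub_triangle (hin hY.1) (hin (hm F)) (Lp.memLp _)).trans (add_le_add ?_ ?_)
  · have : eLpNorm ((fun ω => inner ℝ (Y ω) v) - fun ω =>
        inner ℝ (noiseSum D F (fun _ => φ) ω) v : Ω → ℝ) 2 P
        ≤ ENNReal.ofReal ‖v‖ * eLpNorm (noiseSum D F (fun _ => φ) - Y) 2 P := by
      refine eLpNorm_le_mul_eLpNorm_of_ae_le_mul (Eventually.of_forall fun ω => ?_) 2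
      simp only [Pi.sub_apply, ← inner_sub_left]
      rw [← norm_neg (noiseSum D F (fun _ => φ) ω - Y ω), neg_sub, mul_comm]
      exact norm_inner_le_norm _ _
    rwa [ofReal_norm] at this
  · refine le_of_eq (eLpNorm_congr_ae ?_)
    filter_upwards [hF] with ω hω
    simp only [Pi.sub_apply, hω]

/-- Conversely, the weak characterization of the radonification determines the integral. -/
theorem of_inner_ae_eq [CompleteSpace V] [TopologicalSpace.SeparableSpace V] [IsFiniteMeasure P]
    (h : IsNoise 𝓖 D κ β) {φ : HilbertSchmidt U V}
    (hi : ∀ v, (fun ω => inner ℝ (Y ω) v) =ᵐ[P] D (ContinuousLinearMap.adjoint φ.toCLM v)) :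
    IsNoiseIntegral D (fun _ => φ) Y := by
  obtain ⟨X, hX⟩ := h.exists_isNoiseIntegral (Φ := fun _ => φ) stronglyMeasurable_const
    (memLp_const φ)
  have : SecondCountableTopology V := UniformSpace.secondCountable_of_separable V
  refine hX.congr ?_
  have h0 : X - Y =ᵐ[P] 0 := by
    refine ae_eq_zero_of_forall_inner (𝕜 := ℝ) fun v => ?_
    filter_upwards [hi v, hX.inner_ae_eq h v] with ω h1 h2
    rw [Pi.sub_apply, inner_sub_right, real_inner_comm, h2, real_inner_comm, h1, sub_self,
      Pi.zero_apply]
  filter_upwards [h0] with ω hω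
  exact sub_eq_zero.1 hω

end IsNoiseIntegral
end NoiseIntegral

/-! ### Null sets in the filtration -/

section Completeness

variable {Ω : Type*} [mΩ : MeasurableSpace Ω] {P : Measure Ω} [P.IsComplete]
  {U : Type*} [NormedAddCommGroup U] [InnerProductSpace ℝ U]
  {L : ℝ≥0 → U →ₗ[ℝ] (Ω →ₘ[P] ℝ)}

/-- Null sets belong to `F_t`: their indicators represent `L(0)0 = 0`. -/
theorem measurableSet_cylFiltration_of_null (t : ℝ≥0) {N : Set Ω} (hN : P N = 0) :
    MeasurableSet[cylFiltration P L t] N := by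
  classical
  have hNm : MeasurableSet N := Measure.IsComplete.out' N hN
  let f : Ω → ℝ := N.indicator fun _ => 1
  have hf : Measurable f ∧ f =ᵐ[P] L 0 0 := by
    refine ⟨measurable_const.indicator hNm, ?_⟩
    rw [map_zero]
    refine EventuallyEq.trans ?_ (AEEqFun.coeFn_zero (β := ℝ)).symm
    have : ∀ᵐ ω ∂P, ω ∉ N := measure_eq_zero_iff_ae_notMem.1 hN
    filter_upwards [this] with ω hω
    simp [f, hω]
  have hle : MeasurableSpace.comap f inferInstance ≤ cylFiltration P L t :=
    le_iSup₂_of_le 0 zero_le (le_iSup₂_of_le 0 f (le_iSup_of_le hf le_rfl))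
  refine hle _ ⟨{1}, measurableSet_singleton 1, ?_⟩
  ext ω
  by_cases h : ω ∈ N <;> simp [f, h]

/-- Since `F_t` contains the null sets, almost everywhere `F_t`-measurable maps are
`F_t`-measurable. -/
theorem stronglyMeasurable_cylFiltration {V : Type*} [NormedAddCommGroup V]
    [SecondCountableTopology V] {t : ℝ≥0} {Y : Ω → V}
    (hY : AEStronglyMeasurable[cylFiltration P L t] Y P) :
    StronglyMeasurable[cylFiltration P L t] Y := by
  borelize V
  obtain ⟨g, hg, hgY⟩ := hY
  suffices Measurable[cylFiltration P L t] Y from this.stronglyMeasurable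
  intro B hB
  have h1 : Y ⁻¹' B = (g ⁻¹' B ∩ {ω | Y ω = g ω}) ∪ (Y ⁻¹' B ∩ {ω | Y ω = g ω}ᶜ) := by
    ext ω
    by_cases h : Y ω = g ω <;> simp [h]
  have h0 : P {ω | Y ω = g ω}ᶜ = 0 := hgY
  have h2 := measurableSet_cylFiltration_of_null (L := L) t h0
  rw [h1]
  refine MeasurableSet.union ((hg.measurable hB).inter (MeasurableSet.of_compl h2)) ?_
  exact measurableSet_cylFiltration_of_null t (measure_mono_null Set.inter_subset_right h0)

end Completeness

/-! ### Simple maps -/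

section SimpleMaps

variable {Ω E : Type*} {m : MeasurableSpace Ω} [NormedAddCommGroup E]

/-- An `m`-measurable map with finitely many values, written as a sum of indicators of disjoint
sets. -/
def IsSimpleMap (m : MeasurableSpace Ω) (g : Ω → E) : Prop :=
  ∃ (n : ℕ) (A : Fin n → Set Ω) (φ : Fin n → E), (∀ i, MeasurableSet[m] (A i)) ∧
    Pairwise (fun i j => Disjoint (A i) (A j)) ∧
    ∀ ω, g ω = ∑ i, (A i).indicator (fun _ => φ i) ω

theorem isSimpleMap_simpleFunc (g : SimpleFunc Ω E) : IsSimpleMap m g := by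
  classical
  let φ : Fin g.range.card → E := fun i => (g.range.equivFin.symm i : E)
  have hφ : Function.Injective φ := Subtype.val_injective.comp (Equiv.injective _)
  refine ⟨_, fun i => g ⁻¹' {φ i}, φ, fun i => g.measurableSet_preimage _, fun i j hij => ?_,
    fun ω => ?_⟩
  · refine Set.disjoint_left.2 fun ω h1 h2 => ?_
    simp only [Set.mem_preimage, Set.mem_singleton_iff] at h1 h2
    exact hij (hφ (h1.symm.trans h2))
  · set i₀ := g.range.equivFin ⟨g ω, g.mem_range_self ω⟩ with hi₀
    have h1 : φ i₀ = g ω := by simp [φ, hi₀]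
    rw [Finset.sum_eq_single i₀]
    · simp [h1]
    · intro j _ hj
      refine Set.indicator_of_notMem ?_ _
      simp only [Set.mem_preimage, Set.mem_singleton_iff, ← h1]
      exact fun h2 => hj (hφ h2.symm)
    · simp

theorem exists_isSimpleMap_eLpNorm_sub_le [mΩ : MeasurableSpace Ω] {P : Measure Ω} (hm : m ≤ mΩ)
    {Φ : Ω → E} (hΦ : StronglyMeasurable[m] Φ) (hΦ2 : MemLp Φ 2 P) {ε : ℝ≥0∞} (hε : ε ≠ 0) :
    ∃ g : Ω → E, IsSimpleMap m g ∧ eLpNorm (g - Φ) 2 P ≤ ε := by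
  have h1 : MemLp Φ 2 (P.trim hm) := ⟨hΦ.aestronglyMeasurable, by
    rw [eLpNorm_trim hm hΦ]; exact hΦ2.2⟩
  obtain ⟨g, hg, -⟩ := @MemLp.exists_simpleFunc_eLpNorm_sub_lt Ω m 2 E _ Φ (P.trim hm) h1
    (by simp) ε hε
  refine ⟨_, @isSimpleMap_simpleFunc _ _ m _ g, ?_⟩
  rw [eLpNorm_sub_comm, ← eLpNorm_trim hm (hΦ.sub (@SimpleFunc.stronglyMeasurable _ _ m _ g))]
  exact hg.le

end SimpleMaps

/-! ### The increments of a cylindrical Lévy process -/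

section Increments

variable {Ω : Type*} [mΩ : MeasurableSpace Ω] {P : Measure Ω} [IsProbabilityMeasure P]
  {U V : Type*} [NormedAddCommGroup U] [InnerProductSpace ℝ U]
  [NormedAddCommGroup V] [InnerProductSpace ℝ V]
  {L : ℝ≥0 → U →ₗ[ℝ] (Ω →ₘ[P] ℝ)}

theorem memLp_increment (hL : IsCylindricalLevy P L) (hL2 : HasWeakSecondMoments P L)
    (s t : ℝ≥0) (u : U) : MemLp ((L t - L s) u) 2 P :=
  (memLp_congr_ae (coeFn_increment s t u)).2
    ((memLp_value hL hL2 t u).sub (memLp_value hL hL2 s u))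

/-- The increment `L(t) - L(s)` as a linear map from `U` to `L²(P)`. -/
noncomputable def incrementLp (hL : IsCylindricalLevy P L) (hL2 : HasWeakSecondMoments P L)
    (s t : ℝ≥0) : U →ₗ[ℝ] Lp ℝ 2 P where
  toFun u := ⟨(L t - L s) u, Lp.mem_Lp_iff_memLp.2 (memLp_increment hL hL2 s t u)⟩
  map_add' u w := Subtype.ext (map_add (L t - L s) u w)
  map_smul' c u := Subtype.ext (map_smul (L t - L s) c u)

variable {hL : IsCylindricalLevy P L} {hL2 : HasWeakSecondMoments P L}

theorem incrementLp_add (r s t : ℝ≥0) :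
    incrementLp hL hL2 r s + incrementLp hL hL2 s t = incrementLp hL hL2 r t := by
  ext1 u
  apply Subtype.ext
  change (L s - L r) u + (L t - L s) u = (L t - L r) u
  simp

theorem incrementLp_self (t : ℝ≥0) : incrementLp hL hL2 t t = 0 := by
  ext1 u
  apply Subtype.ext
  change (L t - L t) u = 0
  simp

theorem aestronglyMeasurable_incrementLp {r s t : ℝ≥0} (hs : s ≤ r) (ht : t ≤ r) (u : U) :
    AEStronglyMeasurable[cylFiltration P L r] (incrementLp hL hL2 s t u) P := by
  have h : ∀ q ≤ r, StronglyMeasurable[cylFiltration P L r] fun ω => L q u ω := fun q hq => by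
    have h1 : Measurable[MeasurableSpace.comap (fun ω => L q u ω) inferInstance]
        fun ω => L q u ω := comap_measurable _
    have h2 : MeasurableSpace.comap (fun ω => L q u ω) inferInstance ≤ cylFiltration P L r :=
      le_iSup₂_of_le q hq (le_iSup₂_of_le u (fun ω => L q u ω)
        (le_iSup_of_le ⟨AEEqFun.measurable _, EventuallyEq.rfl⟩ le_rfl))
    exact (h1.mono h2 le_rfl).stronglyMeasurable
  exact ⟨_, (h t ht).sub (h s hs), coeFn_increment s t u⟩

theorem integral_value_one_eq_zero (hL : IsCylindricalLevy P L)
    (hM : IsCylindricalMartingale P L) (u : U) : ∫ ω, L 1 u ω ∂P = 0 := by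
  have h1 := (hM u).2 0 1 zero_le
  rw [← integral_condExp ((cylFiltration P L).le 0), integral_congr_ae h1,
    integral_congr_ae (hL.isLevyProcess u).zero]
  simp

/-- On `[0, T]` the second moment and the mean of `(L(t) - L(s))u` are of order `t - s`. The mean
vanishes if `L` is a cylindrical martingale. -/
theorem exists_isNoise_increment [CompleteSpace U] (hL : IsCylindricalLevy P L)
    (hL2 : HasWeakSecondMoments P L) (T : ℝ≥0) : ∃ K₁ K₂ : ℝ, 0 ≤ K₁ ∧ 0 ≤ K₂ ∧
      (IsCylindricalMartingale P L → K₂ = 0) ∧ ∀ s t : ℝ≥0, s ≤ t → t ≤ T →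
        IsNoise (cylFiltration P L s) (incrementLp hL hL2 s t) (K₁ * (t - s)) (K₂ * (t - s)) := by
  classical
  obtain ⟨C, hC, hCu⟩ := exists_integral_sq_le hL hL2
  have hsq : ∀ u, (∫ ω, L 1 u ω ∂P) ^ 2 ≤ C * ‖u‖ ^ 2 := fun u => by
    have h1 := variance_eq_sub (hL2 u)
    have h2 := variance_nonneg (fun ω => L 1 u ω) P
    have h3 := hCu u
    simp only [Pi.pow_apply] at h1
    linarith
  have hvar : ∀ u, variance (fun ω => L 1 u ω) P ≤ C * ‖u‖ ^ 2 := fun u => by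
    have h1 := variance_eq_sub (hL2 u)
    have h3 := hCu u
    simp only [Pi.pow_apply] at h1
    nlinarith [sq_nonneg (∫ ω, L 1 u ω ∂P)]
  let K₂ : ℝ := if IsCylindricalMartingale P L then 0 else √C
  have hK₂ : 0 ≤ K₂ := by simp only [K₂]; split_ifs <;> positivity
  have hmean : ∀ u, |∫ ω, L 1 u ω ∂P| ≤ K₂ * ‖u‖ := fun u => by
    simp only [K₂]
    split_ifs with hM
    · rw [integral_value_one_eq_zero hL hM]; simp
    · refine abs_le_of_sq_le_sq ?_ (by positivity)
      rw [mul_pow, Real.sq_sqrt hC]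
      exact hsq u
  refine ⟨C * (1 + T), K₂, by positivity, hK₂, fun hM => if_pos hM, fun s t hst htT => ?_⟩
  have hst' : (0 : ℝ) ≤ t - s := sub_nonneg.2 (by exact_mod_cast hst)
  have hid : ∀ u, IdentDistrib (incrementLp hL hL2 s t u) (L (t - s) u) P P := fun u => by
    have h1 := (hL.isLevyProcess u).stationary s (t - s)
    rw [add_tsub_cancel_of_le hst] at h1
    refine (IdentDistrib.of_ae_eq ?_ (coeFn_increment s t u)).trans h1
    exact (AEEqFun.measurable _).aemeasurable
  have hcast : (((t - s : ℝ≥0)) : ℝ) = t - s := NNReal.coe_sub hst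
  refine ⟨(cylFiltration P L).le s, fun u w => ?_, fun u => ?_, fun u => ?_, by positivity,
    by positivity⟩
  · have h1 := hL.indep_increment hst ![u, w]
    refine indep_of_indep_of_le_right h1 ?_
    have h2 : (fun ω => (incrementLp hL hL2 s t u ω, incrementLp hL hL2 s t w ω))
        = (fun x : Fin 2 → ℝ => (x 0, x 1)) ∘ fun ω j => (L t - L s) (![u, w] j) ω := rfl
    rw [h2, ← MeasurableSpace.comap_comp]
    exact MeasurableSpace.comap_mono (Measurable.comap_le (by fun_prop))
  · have h1 : ‖incrementLp hL hL2 s t u‖ ^ 2 = ∫ ω, (L (t - s) u ω) ^ 2 ∂P := by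
      rw [← real_inner_self_eq_norm_sq, ← integral_mul_Lp]
      have h2 := ((hid u).comp (u := fun x => x ^ 2) (by fun_prop)).integral_eq
      simp only [Function.comp_apply] at h2
      rw [← h2]
      exact integral_congr_ae (Eventually.of_forall fun ω => by simp [sq])
    have h2 := variance_eq_sub (memLp_value hL hL2 (t - s) u)
    have h3 := (hL.isLevyProcess u).variance_eq (fun _ => AEEqFun.measurable _) (hL2 u) (t - s)
    have h4 := (hL.isLevyProcess u).integral_eq (fun _ => AEEqFun.measurable _) (hL2 u) (t - s)
    simp only [Pi.pow_apply] at h2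
    rw [h1]
    have h5 : (t : ℝ) - s ≤ T := by
      have : (t : ℝ) ≤ T := by exact_mod_cast htT
      linarith [s.coe_nonneg]
    have h6 : ∫ ω, (L (t - s) u ω) ^ 2 ∂P
        = (t - s) * variance (fun ω => L 1 u ω) P + ((t - s) * ∫ ω, L 1 u ω ∂P) ^ 2 := by
      rw [← hcast, ← h3, ← h4]
      linarith
    rw [h6, mul_pow]
    have h7 := mul_le_mul_of_nonneg_left (hvar u) hst'
    have h8 : ((t : ℝ) - s) ^ 2 * (∫ ω, L 1 u ω ∂P) ^ 2 ≤ ((t - s) * T) * (C * ‖u‖ ^ 2) := by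
      refine mul_le_mul ?_ (hsq u) (sq_nonneg _) (by positivity)
      rw [sq]
      exact mul_le_mul_of_nonneg_left h5 hst'
    calc _ ≤ (t - s) * (C * ‖u‖ ^ 2) + ((t - s) * T) * (C * ‖u‖ ^ 2) := add_le_add h7 h8
      _ = C * (1 + T) * (t - s) * ‖u‖ ^ 2 := by ring
  · rw [(hid u).integral_eq, (hL.isLevyProcess u).integral_eq (fun _ => AEEqFun.measurable _)
      (hL2 u), hcast, abs_mul, abs_of_nonneg hst']
    calc _ ≤ (t - s) * (K₂ * ‖u‖) := mul_le_mul_of_nonneg_left (hmean u) hst'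
      _ = _ := by ring

variable [CompleteSpace U] [CompleteSpace V] {κ β : ℝ} {s t : ℝ≥0}
  {Φ : Ω → HilbertSchmidt U V} {Y : Ω → V}

theorem isRadonification_of_isNoiseIntegral
    (h : IsNoise (cylFiltration P L s) (incrementLp hL hL2 s t) κ β) {φ : HilbertSchmidt U V}
    (hY : IsNoiseIntegral (incrementLp hL hL2 s t) (fun _ => φ) Y) :
    IsRadonification P L s t φ Y :=
  ⟨hY.1, fun v => hY.inner_ae_eq h v⟩

/-- A simple increment is a finite sum of indicators times radonifications, hence an integral
against the noise `L(t) - L(s)`. -/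
theorem IsSimpleIncrement.isNoiseIntegral [TopologicalSpace.SeparableSpace V]
    (h : IsNoise (cylFiltration P L s) (incrementLp hL hL2 s t) κ β)
    (hY : IsSimpleIncrement P L s t Φ Y) :
    StronglyMeasurable[cylFiltration P L s] Φ ∧ MemLp Φ 2 P ∧
      IsNoiseIntegral (incrementLp hL hL2 s t) Φ Y := by
  obtain ⟨m, A, φ, X, hA, -, hΦ, hX, hYX⟩ := hY
  have hA' : ∀ i, MeasurableSet (A i) := fun i => h.le _ (hA i)
  have key : ∀ F : Finset (Fin m),
      StronglyMeasurable[cylFiltration P L s] (∑ i ∈ F, (A i).indicator fun _ => φ i) ∧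
      MemLp (∑ i ∈ F, (A i).indicator fun _ => φ i) 2 P ∧
      IsNoiseIntegral (incrementLp hL hL2 s t) (∑ i ∈ F, (A i).indicator fun _ => φ i)
        (∑ i ∈ F, (A i).indicator (X i)) := fun F => by
    induction F using Finset.induction_on with
    | empty => exact ⟨stronglyMeasurable_zero, MemLp.zero, IsNoiseIntegral.zero⟩
    | insert i F hi ih =>
      simp only [Finset.sum_insert hi]
      have h1 : StronglyMeasurable[cylFiltration P L s] ((A i).indicator fun _ => φ i) :=
        stronglyMeasurable_const.indicator (hA i)
      have h2 : MemLp ((A i).indicator fun _ => φ i) 2 P := (memLp_const (φ i)).indicator (hA' i)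
      exact ⟨h1.add ih.1, h2.add ih.2.1, IsNoiseIntegral.add h h1 h2 ih.1 ih.2.1
        ((IsNoiseIntegral.of_inner_ae_eq h (hX i).2).indicator (hA' i)) ih.2.2⟩
  have hΦ' : Φ = ∑ i, (A i).indicator fun _ => φ i := by
    ext1 ω
    rw [hΦ, Finset.sum_apply]
  have hY' : Y =ᵐ[P] ∑ i, (A i).indicator (X i) := by
    filter_upwards [hYX] with ω hω
    rw [hω, Finset.sum_apply]
  rw [hΦ']
  exact ⟨(key _).1, (key _).2.1, (key _).2.2.congr hY'.symm⟩

theorem exists_isSimpleIncrement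
    (h : IsNoise (cylFiltration P L s) (incrementLp hL hL2 s t) κ β)
    {g : Ω → HilbertSchmidt U V} (hg : IsSimpleMap (cylFiltration P L s) g) :
    ∃ Z, IsSimpleIncrement P L s t g Z := by
  obtain ⟨m, A, φ, hA, hdisj, hgA⟩ := hg
  choose X hX using fun i => h.exists_isNoiseIntegral (Φ := fun _ : Ω => φ i)
    stronglyMeasurable_const (memLp_const _)
  exact ⟨_, m, A, φ, X, hA, hdisj, hgA,
    fun i => isRadonification_of_isNoiseIntegral h (hX i), EventuallyEq.rfl⟩

theorem IsSimpleIncrement.eLpNorm_sub_le [TopologicalSpace.SeparableSpace V]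
    (h : IsNoise (cylFiltration P L s) (incrementLp hL hL2 s t) κ β)
    (hΦ : StronglyMeasurable[cylFiltration P L s] Φ) (hΦ2 : MemLp Φ 2 P)
    (hY : IsNoiseIntegral (incrementLp hL hL2 s t) Φ Y) {g : Ω → HilbertSchmidt U V} {Z : Ω → V}
    (hZ : IsSimpleIncrement P L s t g Z) :
    eLpNorm (Z - Y) 2 P ≤ ENNReal.ofReal (√κ) * eLpNorm (g - Φ) 2 P := by
  obtain ⟨hg, hg2, hgZ⟩ := hZ.isNoiseIntegral h
  exact (hgZ.sub h hg hg2 hΦ hΦ2 hY).eLpNorm_le h (hg.sub hΦ) (hg2.sub hΦ2)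

/-- The integral against the noise `L(t) - L(s)` is the continuous extension `J_{s,t}`. -/
theorem IsNoiseIntegral.isIncrement [TopologicalSpace.SeparableSpace V]
    (h : IsNoise (cylFiltration P L s) (incrementLp hL hL2 s t) κ β)
    (hΦ : StronglyMeasurable[cylFiltration P L s] Φ) (hΦ2 : MemLp Φ 2 P)
    (hY : IsNoiseIntegral (incrementLp hL hL2 s t) Φ Y) : IsIncrement P L s t Φ Y := by
  have hlim : ∀ (g : ℕ → Ω → HilbertSchmidt U V) (Z : ℕ → Ω → V),
      (∀ n, IsSimpleIncrement P L s t (g n) (Z n)) →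
      Tendsto (fun n => eLpNorm (g n - Φ) 2 P) atTop (𝓝 0) →
      Tendsto (fun n => eLpNorm (Z n - Y) 2 P) atTop (𝓝 0) := fun g Z hgZ hg => by
    have h1 := ENNReal.Tendsto.const_mul (a := ENNReal.ofReal (√κ)) hg (Or.inr (by simp))
    rw [mul_zero] at h1
    exact tendsto_of_tendsto_of_tendsto_of_le_of_le tendsto_const_nhds h1 (fun _ => bot_le)
      fun n => (hgZ n).eLpNorm_sub_le h hΦ hΦ2 hY
  refine ⟨hΦ, hΦ2, hY.1, ?_, hlim⟩
  choose g hgm hg using fun n : ℕ =>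
    exists_isSimpleMap_eLpNorm_sub_le h.le hΦ hΦ2 (ε := ((n : ℝ≥0∞) + 1)⁻¹) (by simp)
  choose Z hZ using fun n => exists_isSimpleIncrement h (hgm n)
  have h0 : Tendsto (fun n => eLpNorm (g n - Φ) 2 P) atTop (𝓝 0) := by
    refine tendsto_of_tendsto_of_tendsto_of_le_of_le tendsto_const_nhds ?_ (fun _ => bot_le) hg
    have := (tendsto_add_atTop_iff_nat 1).2 ENNReal.tendsto_inv_nat_nhds_zero
    simpa using this
  exact ⟨g, Z, hZ, h0, hlim _ _ hZ h0⟩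

theorem IsIncrement.isNoiseIntegral [TopologicalSpace.SeparableSpace V]
    (h : IsNoise (cylFiltration P L s) (incrementLp hL hL2 s t) κ β)
    (hY : IsIncrement P L s t Φ Y) : IsNoiseIntegral (incrementLp hL hL2 s t) Φ Y := by
  obtain ⟨hΦ, hΦ2, hY2, ⟨g, Z, hgZ, hg, hZ⟩, -⟩ := hY
  obtain ⟨Y', hY'⟩ := h.exists_isNoiseIntegral hΦ hΦ2
  have h1 := (hY'.isIncrement h hΦ hΦ2).2.2.2.2 g Z hgZ hg
  refine hY'.congr (ae_eq_of_eLpNorm_sub_eq_zero hY'.1 hY2 (le_antisymm ?_ bot_le))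
  have h2 := h1.add hZ
  rw [add_zero] at h2
  refine ge_of_tendsto' h2 fun n => ?_
  have h3 := eLpNorm_sub_triangle hY'.1 ((hgZ n).isNoiseIntegral h).2.2.1 hY2
  rwa [eLpNorm_sub_comm Y' (Z n)] at h3

end Increments

/-! ### Processes on `[0, T] × Ω` -/

section TimeSpace

theorem measurableEmbedding_coe_Iic (T : ℝ≥0) :
    MeasurableEmbedding fun t : Set.Iic T => ((t : ℝ≥0) : ℝ) :=
  (NNReal.isClosedEmbedding_coe.comp isClosed_Iic.isClosedEmbedding_subtypeVal).measurableEmbedding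

theorem timeMeasure_Ioc {T : ℝ≥0} (s t : Set.Iic T) :
    timeMeasure T (Set.Ioc s t) = ENNReal.ofReal ((t : ℝ≥0) - (s : ℝ≥0)) := by
  rw [timeMeasure, (measurableEmbedding_coe_Iic T).comap_apply]
  have : (fun t : Set.Iic T => ((t : ℝ≥0) : ℝ)) '' Set.Ioc s t
      = Set.Ioc ((s : ℝ≥0) : ℝ) ((t : ℝ≥0) : ℝ) := by
    ext x
    constructor
    · rintro ⟨y, ⟨h1, h2⟩, rfl⟩
      exact ⟨by exact_mod_cast h1, by exact_mod_cast h2⟩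
    · rintro ⟨h1, h2⟩
      have hx : 0 ≤ x := (NNReal.coe_nonneg _).trans h1.le
      lift x to ℝ≥0 using hx
      have h3 : x ≤ T := (show x ≤ t by exact_mod_cast h2).trans t.2
      refine ⟨⟨x, h3⟩, ⟨?_, ?_⟩, rfl⟩
      · exact Subtype.coe_lt_coe.1 (by exact_mod_cast h1)
      · exact Subtype.coe_le_coe.1 (by exact_mod_cast h2)
  rw [this, Real.volume_Ioc]

theorem timeMeasure_singleton {T : ℝ≥0} (t : Set.Iic T) : timeMeasure T {t} = 0 := by
  rw [timeMeasure, (measurableEmbedding_coe_Iic T).comap_apply]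
  simp

instance isFiniteMeasure_timeMeasure (T : ℝ≥0) : IsFiniteMeasure (timeMeasure T) := by
  refine ⟨?_⟩
  rw [timeMeasure, (measurableEmbedding_coe_Iic T).comap_apply]
  refine (measure_mono (t := Set.Icc (0 : ℝ) T) ?_).trans_lt (by simp)
  rintro _ ⟨y, -, rfl⟩
  exact ⟨NNReal.coe_nonneg _, by exact_mod_cast y.2⟩

/-- At most one summand is nonzero at each point, so every function vanishing at `0` commutes with
the sum. -/
theorem apply_sum_indicator {ι S E F : Type*} [AddCommMonoid E] [AddCommMonoid F] (I : Finset ι)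
    {A : ι → Set S} (hA : ∀ i ∈ I, ∀ j ∈ I, i ≠ j → Disjoint (A i) (A j)) (f : ι → S → E)
    (q : E → F) (hq : q 0 = 0) (x : S) :
    q (∑ i ∈ I, (A i).indicator (f i) x) = ∑ i ∈ I, (A i).indicator (fun y => q (f i y)) x := by
  classical
  by_cases h : ∃ i ∈ I, x ∈ A i
  · obtain ⟨i, hi, hx⟩ := h
    have hj : ∀ j ∈ I, j ≠ i → x ∉ A j := fun j hj hji hxj =>
      Set.disjoint_left.1 (hA j hj i hi hji) hxj hx
    rw [Finset.sum_eq_single_of_mem i hi fun j hjI hji => Set.indicator_of_notMem (hj j hjI hji) _,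
      Finset.sum_eq_single_of_mem i hi fun j hjI hji => Set.indicator_of_notMem (hj j hjI hji) _,
      Set.indicator_of_mem hx, Set.indicator_of_mem hx]
  · push Not at h
    rw [Finset.sum_eq_zero fun j hj => Set.indicator_of_notMem (h j hj) _,
      Finset.sum_eq_zero fun j hj => Set.indicator_of_notMem (h j hj) _, hq]

theorem sq_eLpNorm_two {S E : Type*} [MeasurableSpace S] {μ : Measure S} [NormedAddCommGroup E]
    (f : S → E) : (eLpNorm f 2 μ) ^ 2 = ∫⁻ x, ‖f x‖ₑ ^ 2 ∂μ := by
  have h := eLpNorm_nnreal_pow_eq_lintegral (f := f) (μ := μ) (p := 2) two_ne_zero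
  simpa using h

variable {Ω E : Type*} [NormedAddCommGroup E] {T : ℝ≥0}

/-- The process `Φ 1_{(s, t]}`. -/
noncomputable def cell (s t : Set.Iic T) (Φ : Ω → E) : Set.Iic T × Ω → E :=
  (Set.Ioc s t ×ˢ Set.univ).indicator fun p => Φ p.2

theorem cell_apply (s t : Set.Iic T) (Φ : Ω → E) (r : Set.Iic T) (ω : Ω) :
    cell s t Φ (r, ω) = (Set.Ioc s t).indicator (fun _ => Φ ω) r := by
  classical
  by_cases h : r ∈ Set.Ioc s t <;> simp [cell, h]

theorem cell_add_cell {r s t : Set.Iic T} (hrs : r ≤ s) (hst : s ≤ t) (Φ : Ω → E) :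
    cell r s Φ + cell s t Φ = cell r t Φ := by
  refine (Set.indicator_union_of_disjoint ?_ fun p : Set.Iic T × Ω => Φ p.2).symm.trans ?_
  swap
  · rw [← Set.union_prod, Set.Ioc_union_Ioc_eq_Ioc hrs hst]; rfl
  rw [Set.disjoint_prod]
  left
  rw [Set.disjoint_left]
  exact fun x hx hx' => absurd hx.2 (not_le.2 hx'.1)

@[simp]
theorem cell_self (s : Set.Iic T) (Φ : Ω → E) : cell s s Φ = 0 := by
  ext p; simp [cell]

theorem cell_sub (s t : Set.Iic T) (Φ Φ' : Ω → E) :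
    cell s t (Φ - Φ') = cell s t Φ - cell s t Φ' := by
  rw [cell, cell, cell, ← Set.indicator_sub']; rfl

theorem cell_add (s t : Set.Iic T) (Φ Φ' : Ω → E) :
    cell s t (Φ + Φ') = cell s t Φ + cell s t Φ' := by
  rw [cell, cell, cell, ← Set.indicator_add']; rfl

variable [mΩ : MeasurableSpace Ω] {P : Measure Ω}

theorem measurableSet_Ioc_prod_univ (s t : Set.Iic T) :
    MeasurableSet (Set.Ioc s t ×ˢ (Set.univ : Set Ω)) :=
  measurableSet_Ioc.prod MeasurableSet.univ

theorem memLp_cell [SFinite P] (s t : Set.Iic T) {Φ : Ω → E} (hΦ : MemLp Φ 2 P) :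
    MemLp (cell s t Φ) 2 ((timeMeasure T).prod P) :=
  (hΦ.comp_snd (timeMeasure T)).indicator (measurableSet_Ioc_prod_univ s t)

theorem lintegral_indicator_Ioc_prod [SFinite P] (s t : Set.Iic T) {f : Ω → ℝ≥0∞}
    (hf : AEMeasurable f P) :
    ∫⁻ p, (Set.Ioc s t ×ˢ (Set.univ : Set Ω)).indicator (fun p => f p.2) p ∂(timeMeasure T).prod P
      = ENNReal.ofReal ((t : ℝ≥0) - (s : ℝ≥0)) * ∫⁻ ω, f ω ∂P := by
  rw [lintegral_indicator (measurableSet_Ioc_prod_univ s t), ← Measure.prod_restrict,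
    Measure.restrict_univ, lintegral_prod _ hf.comp_snd]
  simp [timeMeasure_Ioc, mul_comm]

theorem eLpNorm_cell [SFinite P] (s t : Set.Iic T) {Φ : Ω → E} (hΦ : MemLp Φ 2 P) :
    (eLpNorm (cell s t Φ) 2 ((timeMeasure T).prod P)) ^ 2
      = ENNReal.ofReal ((t : ℝ≥0) - (s : ℝ≥0)) * (eLpNorm Φ 2 P) ^ 2 := by
  rw [sq_eLpNorm_two, sq_eLpNorm_two, ← lintegral_indicator_Ioc_prod s t (hΦ.1.enorm.pow_const 2)]
  congr 1
  ext1 p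
  classical
  by_cases h : p ∈ Set.Ioc s t ×ˢ (Set.univ : Set Ω) <;> simp [cell, h]

end TimeSpace

/-! ### Sums of increments over consecutive intervals -/

section Partition

variable {Ω : Type*} [mΩ : MeasurableSpace Ω] {P : Measure Ω} [IsProbabilityMeasure P]
  {U V : Type*} [NormedAddCommGroup U] [InnerProductSpace ℝ U]
  [NormedAddCommGroup V] [InnerProductSpace ℝ V]
  {L : ℝ≥0 → U →ₗ[ℝ] (Ω →ₘ[P] ℝ)}

/-- The bounds for the increments of `L` on `[0, T]`, as provided by
`exists_isNoise_increment`. -/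
structure IncrementBounds (hL : IsCylindricalLevy P L) (hL2 : HasWeakSecondMoments P L) (T : ℝ≥0)
    (K₁ K₂ : ℝ) : Prop where
  nonneg₁ : 0 ≤ K₁
  nonneg₂ : 0 ≤ K₂
  isNoise : ∀ s t : ℝ≥0, s ≤ t → t ≤ T →
    IsNoise (cylFiltration P L s) (incrementLp hL hL2 s t) (K₁ * (t - s)) (K₂ * (t - s))

variable [CompleteSpace U]

/-- `Y = J_{s,t}(Φ)` for a square integrable `F_s`-measurable `Φ`, described by the integral
against the noise `L(t) - L(s)`. -/
structure IsIncr (hL : IsCylindricalLevy P L) (hL2 : HasWeakSecondMoments P L) (s t : ℝ≥0)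
    (Φ : Ω → HilbertSchmidt U V) (Y : Ω → V) : Prop where
  meas : StronglyMeasurable[cylFiltration P L s] Φ
  memLp : MemLp Φ 2 P
  integral : IsNoiseIntegral (incrementLp hL hL2 s t) Φ Y

variable {hL : IsCylindricalLevy P L} {hL2 : HasWeakSecondMoments P L} {T : ℝ≥0} {K₁ K₂ : ℝ}
  {r s t : ℝ≥0} {Φ Φ' : Ω → HilbertSchmidt U V} {Y Y' : Ω → V}

theorem IncrementBounds.exists_isIncr [CompleteSpace V] (hB : IncrementBounds hL hL2 T K₁ K₂)
    (hst : s ≤ t) (htT : t ≤ T) (hΦ : StronglyMeasurable[cylFiltration P L s] Φ)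
    (hΦ2 : MemLp Φ 2 P) : ∃ Y, IsIncr hL hL2 s t Φ Y :=
  (hB.isNoise s t hst htT).exists_isNoiseIntegral hΦ hΦ2 |>.imp fun _ h => ⟨hΦ, hΦ2, h⟩

namespace IsIncr

theorem ae_eq (hB : IncrementBounds hL hL2 T K₁ K₂) (hst : s ≤ t) (htT : t ≤ T)
    (h : IsIncr hL hL2 s t Φ Y) (h' : IsIncr hL hL2 s t Φ Y') : Y =ᵐ[P] Y' :=
  h.integral.ae_eq (hB.isNoise s t hst htT) h.meas h.memLp h'.integral

theorem add (hB : IncrementBounds hL hL2 T K₁ K₂) (hst : s ≤ t) (htT : t ≤ T)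
    (h : IsIncr hL hL2 s t Φ Y) (h' : IsIncr hL hL2 s t Φ' Y') :
    IsIncr hL hL2 s t (Φ + Φ') (Y + Y') :=
  ⟨h.meas.add h'.meas, h.memLp.add h'.memLp,
    h.integral.add (hB.isNoise s t hst htT) h.meas h.memLp h'.meas h'.memLp h'.integral⟩

theorem sub (hB : IncrementBounds hL hL2 T K₁ K₂) (hst : s ≤ t) (htT : t ≤ T)
    (h : IsIncr hL hL2 s t Φ Y) (h' : IsIncr hL hL2 s t Φ' Y') :
    IsIncr hL hL2 s t (Φ - Φ') (Y - Y') :=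
  ⟨h.meas.sub h'.meas, h.memLp.sub h'.memLp,
    h.integral.sub (hB.isNoise s t hst htT) h.meas h.memLp h'.meas h'.memLp h'.integral⟩

theorem zero : IsIncr hL hL2 s t (0 : Ω → HilbertSchmidt U V) 0 :=
  ⟨stronglyMeasurable_zero, MemLp.zero, IsNoiseIntegral.zero⟩

/-- Additivity of the increments in time. -/
theorem concat (hB : IncrementBounds hL hL2 T K₁ K₂) (hrs : r ≤ s) (hst : s ≤ t) (htT : t ≤ T)
    (h : IsIncr hL hL2 r s Φ Y) (h' : IsIncr hL hL2 s t Φ Y') :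
    IsIncr hL hL2 r t Φ (Y + Y') := by
  refine ⟨h.meas, h.memLp, ?_⟩
  rw [← incrementLp_add r s t]
  exact h.integral.add_noise (hB.isNoise r s hrs (hst.trans htT)) (hB.isNoise s t hst htT) h.meas
    h'.meas h.memLp h'.integral

theorem ae_eq_zero (h : IsIncr hL hL2 t t Φ Y) : Y =ᵐ[P] 0 := by
  refine ae_eq_of_eLpNorm_sub_eq_zero h.integral.1 MemLp.zero ?_
  have h1 := h.integral.2
  have h2 : ∀ F, noiseSum (incrementLp hL hL2 t t) F Φ =ᵐ[P] 0 := fun F => by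
    filter_upwards [Lp.coeFn_zero ℝ 2 P] with ω hω
    simp [noiseSum, incrementLp_self]
  have h4 : ∀ F, eLpNorm (noiseSum (incrementLp hL hL2 t t) F Φ - Y) 2 P = eLpNorm (Y - 0) 2 P :=
    fun F => by
      rw [eLpNorm_sub_comm]
      exact eLpNorm_congr_ae ((EventuallyEq.refl _ Y).sub (h2 F))
  simp only [h4] at h1
  exact tendsto_nhds_unique tendsto_const_nhds h1

theorem eLpNorm_le (hB : IncrementBounds hL hL2 T K₁ K₂) (hst : s ≤ t) (htT : t ≤ T)
    (h : IsIncr hL hL2 s t Φ Y) :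
    eLpNorm Y 2 P ≤ ENNReal.ofReal (√(K₁ * (t - s))) * eLpNorm Φ 2 P :=
  h.integral.eLpNorm_le (hB.isNoise s t hst htT) h.meas h.memLp

theorem aestronglyMeasurable [CompleteSpace V] (hB : IncrementBounds hL hL2 T K₁ K₂) (hst : s ≤ t)
    (htT : t ≤ T) (h : IsIncr hL hL2 s t Φ Y) : AEStronglyMeasurable[cylFiltration P L t] Y P :=
  h.integral.aestronglyMeasurable (hB.isNoise s t hst htT) h.meas h.memLp
    ((cylFiltration P L).mono hst) ((cylFiltration P L).le t)
    fun u => aestronglyMeasurable_incrementLp hst le_rfl u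

end IsIncr

/-- The basic `L²`-estimate: by a discrete Gronwall argument, the square norm of a sum of increments
over consecutive intervals is bounded by the sum of the square norms. The cross terms are controlled
by the mean of `L`. -/
theorem integral_norm_sum_increments_sq_le [CompleteSpace V] [TopologicalSpace.SeparableSpace V]
    [P.IsComplete] (hB : IncrementBounds hL hL2 T K₁ K₂) {p : ℕ → ℝ≥0} (hp : Monotone p)
    (hpT : ∀ k, p k ≤ T) {Φ : ℕ → Ω → HilbertSchmidt U V} {X : ℕ → Ω → V} (N : ℕ)
    (hX : ∀ k < N, IsIncr hL hL2 (p k) (p (k + 1)) (Φ k) (X k)) :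
    AEStronglyMeasurable[cylFiltration P L (p N)] (∑ k ∈ Finset.range N, X k) P ∧
    MemLp (∑ k ∈ Finset.range N, X k) 2 P ∧
    ∫ ω, ‖(∑ k ∈ Finset.range N, X k) ω‖ ^ 2 ∂P ≤ Real.exp (K₂ * (p N - p 0)) * ((K₁ + K₂) *
      ∑ k ∈ Finset.range N, ((p (k + 1) : ℝ) - p k) * ∫ ω, ‖Φ k ω‖ ^ 2 ∂P) := by
  have : SecondCountableTopology V := UniformSpace.secondCountable_of_separable V
  induction N with
  | zero => exact ⟨stronglyMeasurable_zero.aestronglyMeasurable, MemLp.zero, by simp⟩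
  | succ N ih =>
    obtain ⟨hm, h2, hle⟩ := ih fun k hk => hX k (hk.trans N.lt_succ_self)
    have hXN := hX N N.lt_succ_self
    have hpN : p N ≤ p (N + 1) := hp N.le_succ
    have hδ : (0 : ℝ) ≤ p (N + 1) - p N := sub_nonneg.2 (by exact_mod_cast hpN)
    simp only [Finset.sum_range_succ]
    set S := ∑ k ∈ Finset.range N, X k with hS
    have hn := hB.isNoise _ _ hpN (hpT _)
    have hXm : AEStronglyMeasurable[cylFiltration P L (p (N + 1))] (X N) P :=
      hXN.aestronglyMeasurable hB hpN (hpT _)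
    have hmono : AEStronglyMeasurable[cylFiltration P L (p (N + 1))] S P :=
      hm.mono ((cylFiltration P L).mono hpN)
    have hSm : StronglyMeasurable[cylFiltration P L (p N)] S := stronglyMeasurable_cylFiltration hm
    refine ⟨?_, h2.add hXN.integral.1, ?_⟩
    · exact (hmono.add hXm)
    have hsq : ∫ ω, ‖(S + X N) ω‖ ^ 2 ∂P
        = ∫ ω, ‖S ω‖ ^ 2 ∂P + 2 * ∫ ω, inner ℝ (S ω) (X N ω) ∂P + ∫ ω, ‖X N ω‖ ^ 2 ∂P := by
      simp_rw [Pi.add_apply, norm_add_sq_real]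
      rw [integral_add, integral_add, integral_const_mul]
      · exact h2.integrable_norm_pow two_ne_zero
      · exact (integrable_inner h2 hXN.integral.1).const_mul _
      · exact (h2.integrable_norm_pow two_ne_zero).add
          ((integrable_inner h2 hXN.integral.1).const_mul _)
      · exact hXN.integral.1.integrable_norm_pow two_ne_zero
    have hin := hXN.integral.abs_integral_inner_le hn hXN.meas hXN.memLp hSm h2
    have hsqX := hXN.integral.integral_norm_sq_le hn hXN.meas hXN.memLp
    have hcs : ∫ ω, ‖S ω‖ * ‖Φ N ω‖ ∂P
        ≤ (∫ ω, ‖S ω‖ ^ 2 ∂P + ∫ ω, ‖Φ N ω‖ ^ 2 ∂P) / 2 := by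
      rw [← integral_add (h2.integrable_norm_pow two_ne_zero)
        (hXN.memLp.integrable_norm_pow two_ne_zero), ← integral_div]
      refine integral_mono (h2.norm.integrable_mul hXN.memLp.norm)
        (((h2.integrable_norm_pow two_ne_zero).add
        (hXN.memLp.integrable_norm_pow two_ne_zero)).div_const _) fun ω => ?_
      have := sq_nonneg (‖S ω‖ - ‖Φ N ω‖)
      change ‖S ω‖ * ‖Φ N ω‖ ≤ (‖S ω‖ ^ 2 + ‖Φ N ω‖ ^ 2) / 2
      linarith
    set a := ∫ ω, ‖S ω‖ ^ 2 ∂P with ha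
    set b := ∫ ω, ‖Φ N ω‖ ^ 2 ∂P with hb
    have ha0 : 0 ≤ a := integral_nonneg fun ω => by positivity
    have hb0 : 0 ≤ b := integral_nonneg fun ω => by positivity
    set δ : ℝ := p (N + 1) - p N with hδd
    have h3 : ∫ ω, ‖(S + X N) ω‖ ^ 2 ∂P ≤ (1 + K₂ * δ) * a + (K₁ + K₂) * (δ * b) := by
      rw [hsq]
      have h4 := (abs_le.1 hin).2
      have h5 := mul_le_mul_of_nonneg_left hcs (mul_nonneg hB.nonneg₂ hδ)
      nlinarith
    have h6 : 1 + K₂ * δ ≤ Real.exp (K₂ * δ) := by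
      have := Real.add_one_le_exp (K₂ * δ); linarith
    have h7 : Real.exp (K₂ * (p (N + 1) - p 0)) =
        Real.exp (K₂ * δ) * Real.exp (K₂ * (p N - p 0)) := by
      rw [← Real.exp_add]; congr 1; rw [hδd]; ring
    have hK : 0 ≤ K₁ + K₂ := add_nonneg hB.nonneg₁ hB.nonneg₂
    have h8 : 1 ≤ Real.exp (K₂ * (p (N + 1) - p 0)) := by
      refine Real.one_le_exp (mul_nonneg hB.nonneg₂ (sub_nonneg.2 ?_))
      exact_mod_cast hp (Nat.zero_le _)
    calc _ ≤ (1 + K₂ * δ) * a + (K₁ + K₂) * (δ * b) := h3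
      _ ≤ Real.exp (K₂ * δ) * (Real.exp (K₂ * (p N - p 0)) * ((K₁ + K₂) *
          ∑ k ∈ Finset.range N, ((p (k + 1) : ℝ) - p k) * ∫ ω, ‖Φ k ω‖ ^ 2 ∂P))
          + Real.exp (K₂ * (p (N + 1) - p 0)) * ((K₁ + K₂) * (δ * b)) := by
        refine add_le_add (mul_le_mul h6 hle ha0 (Real.exp_pos _).le) ?_
        exact le_mul_of_one_le_left (by positivity) h8
      _ = _ := by rw [h7]; ring

end Partition

/-! ### Dyadic grids -/

section Grid

variable {T : ℝ≥0}

/-- The dyadic grid point `k T / 2^n`, capped at `T`. -/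
noncomputable def gridPt (T : ℝ≥0) (n k : ℕ) : Set.Iic T :=
  ⟨min (T * k / 2 ^ n) T, Set.mem_Iic.2 (min_le_right _ _)⟩

theorem gridPt_mono (n : ℕ) : Monotone (gridPt T n) := fun a b hab => by
  refine Subtype.coe_le_coe.1 (show min _ _ ≤ min _ _ from min_le_min_right _ ?_)
  gcongr

theorem gridPt_coe_le (n k : ℕ) : (gridPt T n k : ℝ≥0) ≤ T := (gridPt T n k).2

theorem gridPt_coe_mono (n k : ℕ) : (gridPt T n k : ℝ≥0) ≤ gridPt T n (k + 1) :=
  gridPt_mono n k.le_succ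

theorem coe_gridPt {n k : ℕ} (hk : k ≤ 2 ^ n) : (gridPt T n k : ℝ≥0) = T * k / 2 ^ n := by
  refine (show min _ _ = _ from min_eq_left ?_)
  rw [div_le_iff₀ (by positivity)]
  gcongr
  exact_mod_cast hk

@[simp]
theorem gridPt_zero (n : ℕ) : gridPt T n 0 = ⊥ := by
  refine Subtype.ext ?_
  rw [coe_gridPt (Nat.zero_le _)]
  simp

theorem coe_gridPt_last (n : ℕ) : (gridPt T n (2 ^ n) : ℝ≥0) = T := by
  rw [coe_gridPt le_rfl]
  push_cast
  field_simp

theorem gridPt_lt_succ (hT : 0 < T) {n k : ℕ} (hk : k < 2 ^ n) :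
    gridPt T n k < gridPt T n (k + 1) := by
  refine Subtype.coe_lt_coe.1 ?_
  rw [coe_gridPt hk.le, coe_gridPt hk]
  gcongr
  simp

theorem gridPt_succ_two_mul (n k : ℕ) : gridPt T (n + 1) (2 * k) = gridPt T n k := by
  refine Subtype.ext ?_
  simp only [gridPt]
  congr 1
  push_cast
  rw [pow_succ]
  field_simp

theorem gridPt_add_mul_two_pow (n m k : ℕ) : gridPt T (n + m) (2 ^ m * k) = gridPt T n k := by
  induction m with
  | zero => simp
  | succ m ih =>
    have h : 2 ^ (m + 1) * k = 2 * (2 ^ m * k) := by ring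
    rw [h, ← add_assoc, gridPt_succ_two_mul, ih]

/-- The index of the first grid point which is not smaller than `s`. -/
noncomputable def ceilIdx (n : ℕ) (s : Set.Iic T) : ℕ := ⌈(s : ℝ≥0) * 2 ^ n / T⌉₊

theorem ceilIdx_mono (n : ℕ) : Monotone (ceilIdx (T := T) n) := fun s t hst => by
  refine Nat.ceil_mono ?_
  have : (s : ℝ≥0) ≤ t := hst
  gcongr

theorem ceilIdx_le (n : ℕ) (s : Set.Iic T) : ceilIdx n s ≤ 2 ^ n := by
  refine Nat.ceil_le.2 ?_
  push_cast
  refine div_le_of_le_mul₀ zero_le zero_le ?_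
  rw [mul_comm]
  have : (s : ℝ≥0) ≤ T := s.2
  gcongr

theorem le_gridPt_ceilIdx (hT : 0 < T) (n : ℕ) (s : Set.Iic T) : s ≤ gridPt T n (ceilIdx n s) := by
  refine Subtype.coe_le_coe.1 ?_
  rw [coe_gridPt (ceilIdx_le n s), le_div_iff₀ (by positivity), mul_comm T, ← div_le_iff₀ hT]
  exact Nat.le_ceil _

theorem gridPt_ceilIdx_le (hT : 0 < T) (n : ℕ) (s : Set.Iic T) :
    (gridPt T n (ceilIdx n s) : ℝ≥0) ≤ s + T / 2 ^ n := by
  rw [coe_gridPt (ceilIdx_le n s), div_le_iff₀ (by positivity), add_mul,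
    div_mul_cancel₀ _ (by positivity)]
  have h : (ceilIdx n s : ℝ≥0) ≤ (s : ℝ≥0) * 2 ^ n / T + 1 :=
    (Nat.ceil_lt_add_one zero_le).le
  calc T * (ceilIdx n s : ℝ≥0) ≤ T * ((s : ℝ≥0) * 2 ^ n / T + 1) := by gcongr
    _ = _ := by field_simp

theorem gridPt_pairwiseDisjoint (n : ℕ) {i j : ℕ} (hij : i ≠ j) :
    Disjoint (Set.Ioc (gridPt T n i) (gridPt T n (i + 1)))
      (Set.Ioc (gridPt T n j) (gridPt T n (j + 1))) :=
  (gridPt_mono n).pairwise_disjoint_on_Ioc_succ hij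

theorem apply_sum_cell {Ω E F : Type*} [NormedAddCommGroup E] [AddCommMonoid F] (n : ℕ)
    (Φ : ℕ → Ω → E) (q : E → F) (hq : q 0 = 0) (p : Set.Iic T × Ω) :
    q ((∑ k ∈ Finset.range (2 ^ n), cell (gridPt T n k) (gridPt T n (k + 1)) (Φ k)) p)
      = ∑ k ∈ Finset.range (2 ^ n),
        (Set.Ioc (gridPt T n k) (gridPt T n (k + 1)) ×ˢ (Set.univ : Set Ω)).indicator
          (fun p => q (Φ k p.2)) p := by
  rw [Finset.sum_apply]
  have hA : ∀ i ∈ Finset.range (2 ^ n), ∀ j ∈ Finset.range (2 ^ n), i ≠ j →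
      Disjoint (Set.Ioc (gridPt T n i) (gridPt T n (i + 1)) ×ˢ (Set.univ : Set Ω))
        (Set.Ioc (gridPt T n j) (gridPt T n (j + 1)) ×ˢ (Set.univ : Set Ω)) :=
    fun i _ j _ hij => Set.disjoint_prod.2 (Or.inl (gridPt_pairwiseDisjoint n hij))
  exact apply_sum_indicator (Finset.range (2 ^ n)) hA (fun k p => Φ k p.2) q hq p

end Grid

/-! ### The stochastic integral as a closed operator -/

section ItoIntegral

variable {Ω : Type*} [mΩ : MeasurableSpace Ω] {P : Measure Ω} [IsProbabilityMeasure P]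
  {U V : Type*} [NormedAddCommGroup U] [InnerProductSpace ℝ U] [CompleteSpace U]
  [NormedAddCommGroup V] [InnerProductSpace ℝ V]
  {L : ℝ≥0 → U →ₗ[ℝ] (Ω →ₘ[P] ℝ)}

/-- `Z` is the integral of the process `g = ∑_k Φ_k 1_{(t_k, t_{k+1}]}` over the `n`-th dyadic
grid. -/
def IsGridIntegral (hL : IsCylindricalLevy P L) (hL2 : HasWeakSecondMoments P L) (T : ℝ≥0) (n : ℕ)
    (g : Set.Iic T × Ω → HilbertSchmidt U V) (Z : Ω → V) : Prop :=
  ∃ (Φ : ℕ → Ω → HilbertSchmidt U V) (X : ℕ → Ω → V),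
    (∀ k < 2 ^ n, IsIncr hL hL2 (gridPt T n k) (gridPt T n (k + 1)) (Φ k) (X k)) ∧
    g = ∑ k ∈ Finset.range (2 ^ n), cell (gridPt T n k) (gridPt T n (k + 1)) (Φ k) ∧
    Z =ᵐ[P] ∑ k ∈ Finset.range (2 ^ n), X k

/-- `Y` is the stochastic integral of `g` over `[0, T]`: the pair `(g, Y)` belongs to the
`L²`-closure of the graph of the integral on dyadic simple processes. -/
def IsItoIntegral (hL : IsCylindricalLevy P L) (hL2 : HasWeakSecondMoments P L) (T : ℝ≥0)
    (g : Set.Iic T × Ω → HilbertSchmidt U V) (Y : Ω → V) : Prop :=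
  MemLp g 2 ((timeMeasure T).prod P) ∧ MemLp Y 2 P ∧ ∀ ε : ℝ≥0∞, ε ≠ 0 →
    ∃ (n : ℕ) (g' : Set.Iic T × Ω → HilbertSchmidt U V) (Z : Ω → V),
      IsGridIntegral hL hL2 T n g' Z ∧ eLpNorm (g' - g) 2 ((timeMeasure T).prod P) ≤ ε ∧
      eLpNorm (Z - Y) 2 P ≤ ε

variable {hL : IsCylindricalLevy P L} {hL2 : HasWeakSecondMoments P L} {T : ℝ≥0} {K₁ K₂ : ℝ}
  {n m : ℕ} {g g' : Set.Iic T × Ω → HilbertSchmidt U V} {Y Y' Z Z' : Ω → V}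

namespace IsGridIntegral

theorem memLp_left (h : IsGridIntegral hL hL2 T n g Z) : MemLp g 2 ((timeMeasure T).prod P) := by
  obtain ⟨Φ, X, hX, rfl, -⟩ := h
  exact memLp_finsetSum' _ fun k hk => memLp_cell _ _ (hX k (Finset.mem_range.1 hk)).memLp

theorem memLp_right (h : IsGridIntegral hL hL2 T n g Z) : MemLp Z 2 P := by
  obtain ⟨Φ, X, hX, -, hZ⟩ := h
  exact (memLp_congr_ae hZ).2
    (memLp_finsetSum' _ fun k hk => (hX k (Finset.mem_range.1 hk)).integral.1)

theorem congr (h : IsGridIntegral hL hL2 T n g Z) (hZ : Z =ᵐ[P] Z') :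
    IsGridIntegral hL hL2 T n g Z' := by
  obtain ⟨Φ, X, hX, hg, hZX⟩ := h
  exact ⟨Φ, X, hX, hg, hZ.symm.trans hZX⟩

theorem add (hB : IncrementBounds hL hL2 T K₁ K₂) (h : IsGridIntegral hL hL2 T n g Z)
    (h' : IsGridIntegral hL hL2 T n g' Z') : IsGridIntegral hL hL2 T n (g + g') (Z + Z') := by
  obtain ⟨Φ, X, hX, rfl, hZ⟩ := h
  obtain ⟨Φ', X', hX', rfl, hZ'⟩ := h'
  refine ⟨fun k => Φ k + Φ' k, fun k => X k + X' k, fun k hk =>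
    (hX k hk).add hB (gridPt_coe_mono n k) (gridPt_coe_le n _) (hX' k hk), ?_, ?_⟩
  · simp_rw [cell_add, Finset.sum_add_distrib]
  · rw [Finset.sum_add_distrib]
    exact hZ.add hZ'

theorem sub (hB : IncrementBounds hL hL2 T K₁ K₂) (h : IsGridIntegral hL hL2 T n g Z)
    (h' : IsGridIntegral hL hL2 T n g' Z') : IsGridIntegral hL hL2 T n (g - g') (Z - Z') := by
  obtain ⟨Φ, X, hX, rfl, hZ⟩ := h
  obtain ⟨Φ', X', hX', rfl, hZ'⟩ := h'
  refine ⟨fun k => Φ k - Φ' k, fun k => X k - X' k, fun k hk =>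
    (hX k hk).sub hB (gridPt_coe_mono n k) (gridPt_coe_le n _) (hX' k hk), ?_, ?_⟩
  · simp_rw [cell_sub, Finset.sum_sub_distrib]
  · rw [Finset.sum_sub_distrib]
    exact hZ.sub hZ'

theorem zero : IsGridIntegral hL hL2 T n (0 : Set.Iic T × Ω → HilbertSchmidt U V) 0 := by
  refine ⟨fun _ => 0, fun _ => 0, fun _ _ => IsIncr.zero, ?_, ?_⟩
  · have : ∀ s t : Set.Iic T, cell s t (0 : Ω → HilbertSchmidt U V) = 0 := fun s t => by
      have := cell_sub s t (0 : Ω → HilbertSchmidt U V) 0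
      rwa [sub_self, sub_self] at this
    simp [this]
  · simp

theorem sum (hB : IncrementBounds hL hL2 T K₁ K₂) {ι : Type*} (I : Finset ι)
    {G : ι → Set.Iic T × Ω → HilbertSchmidt U V} {W : ι → Ω → V}
    (h : ∀ i ∈ I, IsGridIntegral hL hL2 T n (G i) (W i)) :
    IsGridIntegral hL hL2 T n (∑ i ∈ I, G i) (∑ i ∈ I, W i) := by
  classical
  induction I using Finset.induction_on with
  | empty => exact zero
  | insert i I hi ih =>
    rw [Finset.sum_insert hi, Finset.sum_insert hi]
    exact (h i (Finset.mem_insert_self _ _)).add hB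
      (ih fun j hj => h j (Finset.mem_insert_of_mem hj))

theorem single {k : ℕ} (hk : k < 2 ^ n) {Φ : Ω → HilbertSchmidt U V}
    (h : IsIncr hL hL2 (gridPt T n k) (gridPt T n (k + 1)) Φ Y) :
    IsGridIntegral hL hL2 T n (cell (gridPt T n k) (gridPt T n (k + 1)) Φ) Y := by
  classical
  have hc : ∀ s t : Set.Iic T, cell s t (0 : Ω → HilbertSchmidt U V) = 0 := fun s t => by
    have := cell_sub s t (0 : Ω → HilbertSchmidt U V) 0
    rwa [sub_self, sub_self] at this
  refine ⟨fun j => if j = k then Φ else 0, fun j => if j = k then Y else 0, fun j _ => ?_, ?_, ?_⟩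
  · by_cases hjk : j = k
    · simpa [hjk] using h
    · simpa [hjk] using IsIncr.zero
  · rw [Finset.sum_eq_single k]
    · simp
    · intro j _ hj; simp [hj, hc]
    · intro hk'; exact absurd (Finset.mem_range.2 hk) hk'
  · rw [Finset.sum_ite_eq' , if_pos (Finset.mem_range.2 hk)]

/-- An increment between two grid points is the sum of the increments over the cells in between. -/
theorem of_isIncr [CompleteSpace V] (hB : IncrementBounds hL hL2 T K₁ K₂) {i j : ℕ} (hij : i ≤ j)
    (hj : j ≤ 2 ^ n)
    {Φ : Ω → HilbertSchmidt U V} (h : IsIncr hL hL2 (gridPt T n i) (gridPt T n j) Φ Y) :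
    IsGridIntegral hL hL2 T n (cell (gridPt T n i) (gridPt T n j) Φ) Y := by
  induction j, hij using Nat.le_induction generalizing Y with
  | base =>
    rw [cell_self]
    exact zero.congr h.ae_eq_zero.symm
  | succ j hij ih =>
    have h1 : (gridPt T n i : ℝ≥0) ≤ gridPt T n j := gridPt_mono n hij
    obtain ⟨Y₁, hY₁⟩ := hB.exists_isIncr h1 (gridPt_coe_le n j) h.meas h.memLp
    obtain ⟨Y₂, hY₂⟩ := hB.exists_isIncr (gridPt_coe_mono n j) (gridPt_coe_le n (j + 1))
      (h.meas.mono ((cylFiltration P L).mono h1)) h.memLp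
    have h2 := hY₁.concat hB h1 (gridPt_coe_mono n j) (gridPt_coe_le n _) hY₂
    rw [← cell_add_cell (gridPt_mono n hij) (gridPt_mono n j.le_succ)]
    refine ((ih (by omega) hY₁).add hB (single (by omega) hY₂)).congr ?_
    exact h2.ae_eq hB (h1.trans (gridPt_coe_mono n j)) (gridPt_coe_le n _) h

theorem refine_succ [CompleteSpace V] (hB : IncrementBounds hL hL2 T K₁ K₂)
    (h : IsGridIntegral hL hL2 T n g Z) : IsGridIntegral hL hL2 T (n + 1) g Z := by
  obtain ⟨Φ, X, hX, rfl, hZ⟩ := h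
  refine (sum hB _ fun k hk => ?_).congr hZ.symm
  have hk := Finset.mem_range.1 hk
  have h1 := hX k hk
  rw [← gridPt_succ_two_mul n k, ← gridPt_succ_two_mul n (k + 1)] at h1 ⊢
  exact of_isIncr hB (by omega) (by rw [pow_succ]; omega) h1

theorem refine_le [CompleteSpace V] (hB : IncrementBounds hL hL2 T K₁ K₂) (hnm : n ≤ m)
    (h : IsGridIntegral hL hL2 T n g Z) : IsGridIntegral hL hL2 T m g Z := by
  induction m, hnm using Nat.le_induction with
  | base => exact h
  | succ m _ ih => exact ih.refine_succ hB

/-- Simple processes on a grid are simple processes in the sense of the definition of the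
integral. -/
theorem isSimpleIntegral [CompleteSpace V] [TopologicalSpace.SeparableSpace V]
    (hB : IncrementBounds hL hL2 T K₁ K₂) (hT : 0 < T)
    (h : IsGridIntegral hL hL2 T n g Z) : IsSimpleIntegral P L T g Z := by
  obtain ⟨Φ, X, hX, hg, hZ⟩ := h
  refine ⟨2 ^ n, gridPt T n, Φ, X, ?_, coe_gridPt_last n, fun k hk => gridPt_lt_succ hT hk,
    fun k hk => ?_, fun t ω => ?_, ?_⟩
  · rw [gridPt_zero]; rfl
  · exact (hX k hk).integral.isIncrement
      (hB.isNoise _ _ (gridPt_coe_mono n k) (gridPt_coe_le n _)) (hX k hk).meas (hX k hk).memLp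
  · simp only [hg, Finset.sum_apply, cell_apply]
  · filter_upwards [hZ] with ω hω
    rw [hω, Finset.sum_apply]

end IsGridIntegral

theorem sq_eLpNorm_eq_ofReal {S E : Type*} [MeasurableSpace S] {μ : Measure S}
    [NormedAddCommGroup E] {f : S → E} (hf : MemLp f 2 μ) :
    (eLpNorm f 2 μ) ^ 2 = ENNReal.ofReal (∫ x, ‖f x‖ ^ 2 ∂μ) := by
  rw [← sq_toReal_eLpNorm_two hf, ENNReal.ofReal_pow ENNReal.toReal_nonneg,
    ENNReal.ofReal_toReal hf.2.ne]

/-- The norm bound of the stochastic integral operator. -/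
noncomputable def itoConst (K₁ K₂ : ℝ) (T : ℝ≥0) : ℝ := √(Real.exp (K₂ * T) * (K₁ + K₂))

variable [CompleteSpace V] [TopologicalSpace.SeparableSpace V] [P.IsComplete]

theorem IsGridIntegral.eLpNorm_le (hB : IncrementBounds hL hL2 T K₁ K₂)
    (h : IsGridIntegral hL hL2 T n g Z) :
    eLpNorm Z 2 P ≤ ENNReal.ofReal (itoConst K₁ K₂ T) * eLpNorm g 2 ((timeMeasure T).prod P) := by
  have hg2 := h.memLp_left
  obtain ⟨Φ, X, hX, hg, hZ⟩ := h
  have hK : 0 ≤ Real.exp (K₂ * T) * (K₁ + K₂) :=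
    mul_nonneg (Real.exp_pos _).le (add_nonneg hB.nonneg₁ hB.nonneg₂)
  obtain ⟨-, h2, hle⟩ := integral_norm_sum_increments_sq_le hB (p := fun k => gridPt T n k)
    (fun a b hab => gridPt_mono n hab) (fun k => gridPt_coe_le n k) (2 ^ n) hX
  have hcell : (eLpNorm g 2 ((timeMeasure T).prod P)) ^ 2 = ENNReal.ofReal
      (∑ k ∈ Finset.range (2 ^ n), (((gridPt T n (k + 1) : ℝ≥0) : ℝ) - (gridPt T n k : ℝ≥0)) *
        ∫ ω, ‖Φ k ω‖ ^ 2 ∂P) := by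
    rw [ENNReal.ofReal_sum_of_nonneg]
    · have h1 : ∀ p, ‖g p‖ₑ ^ 2 = ∑ k ∈ Finset.range (2 ^ n),
          (Set.Ioc (gridPt T n k) (gridPt T n (k + 1)) ×ˢ (Set.univ : Set Ω)).indicator
            (fun p => ‖Φ k p.2‖ₑ ^ 2) p := fun p => by
        rw [hg]
        exact apply_sum_cell n Φ (fun x => ‖x‖ₑ ^ 2) (by simp) p
      rw [sq_eLpNorm_two, lintegral_congr h1, lintegral_finsetSum']
      · refine Finset.sum_congr rfl fun k hk => ?_
        have hk' := hX k (Finset.mem_range.1 hk)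
        rw [lintegral_indicator_Ioc_prod _ _ (hk'.memLp.1.enorm.pow_const 2), ← sq_eLpNorm_two,
          sq_eLpNorm_eq_ofReal hk'.memLp, ENNReal.ofReal_mul]
        exact sub_nonneg.2 (by exact_mod_cast gridPt_coe_mono n k)
      · intro k hk
        exact ((hX k (Finset.mem_range.1 hk)).memLp.1.enorm.pow_const 2).comp_snd.indicator
          (measurableSet_Ioc_prod_univ _ _)
    · exact fun k _ => mul_nonneg (sub_nonneg.2 (by exact_mod_cast gridPt_coe_mono n k))
        (integral_nonneg fun ω => by positivity)
  rw [eLpNorm_congr_ae hZ, ← ENNReal.pow_le_pow_left_iff two_ne_zero, mul_pow, hcell, itoConst,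
    ← ENNReal.ofReal_pow (Real.sqrt_nonneg _), Real.sq_sqrt hK, sq_eLpNorm_eq_ofReal h2,
    ← ENNReal.ofReal_mul hK]
  refine ENNReal.ofReal_le_ofReal (hle.trans ?_)
  rw [← mul_assoc]
  refine mul_le_mul_of_nonneg_right (mul_le_mul_of_nonneg_right (Real.exp_le_exp.2 ?_)
    (add_nonneg hB.nonneg₁ hB.nonneg₂)) (Finset.sum_nonneg fun k _ =>
      mul_nonneg (sub_nonneg.2 (by exact_mod_cast gridPt_coe_mono n k))
        (integral_nonneg fun ω => by positivity))
  rw [coe_gridPt_last, gridPt_zero]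
  exact mul_le_mul_of_nonneg_left (by simp) hB.nonneg₂

namespace IsItoIntegral

omit [CompleteSpace V] [TopologicalSpace.SeparableSpace V] [P.IsComplete] in
theorem of_isGridIntegral (h : IsGridIntegral hL hL2 T n g Z) : IsItoIntegral hL hL2 T g Z :=
  ⟨h.memLp_left, h.memLp_right, fun ε _ => ⟨n, g, Z, h, by simp, by simp⟩⟩

omit [CompleteSpace V] [TopologicalSpace.SeparableSpace V] [P.IsComplete] in
theorem congr (h : IsItoIntegral hL hL2 T g Y) (hY : Y =ᵐ[P] Y') : IsItoIntegral hL hL2 T g Y' := by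
  refine ⟨h.1, (memLp_congr_ae hY).1 h.2.1, fun ε hε => ?_⟩
  obtain ⟨n, g', Z, h1, h2, h3⟩ := h.2.2 ε hε
  refine ⟨n, g', Z, h1, h2, ?_⟩
  rwa [eLpNorm_congr_ae ((EventuallyEq.refl _ Z).sub hY.symm)]

omit [CompleteSpace V] [TopologicalSpace.SeparableSpace V] [P.IsComplete] in
theorem congr_left (h : IsItoIntegral hL hL2 T g Y)
    (hg : g =ᵐ[(timeMeasure T).prod P] g') : IsItoIntegral hL hL2 T g' Y := by
  refine ⟨(memLp_congr_ae hg).1 h.1, h.2.1, fun ε hε => ?_⟩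
  obtain ⟨n, g₁, Z, h1, h2, h3⟩ := h.2.2 ε hε
  refine ⟨n, g₁, Z, h1, ?_, h3⟩
  rwa [eLpNorm_congr_ae ((EventuallyEq.refl _ g₁).sub hg.symm)]

omit [CompleteSpace V] [TopologicalSpace.SeparableSpace V] [P.IsComplete] in
/-- The graph of the integral is closed. -/
theorem of_approx (hg : MemLp g 2 ((timeMeasure T).prod P)) (hY : MemLp Y 2 P)
    (h : ∀ ε : ℝ≥0∞, ε ≠ 0 → ∃ g' Y', IsItoIntegral hL hL2 T g' Y' ∧
      eLpNorm (g' - g) 2 ((timeMeasure T).prod P) ≤ ε ∧ eLpNorm (Y' - Y) 2 P ≤ ε) :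
    IsItoIntegral hL hL2 T g Y := by
  refine ⟨hg, hY, fun ε hε => ?_⟩
  have hε2 : ε / 2 ≠ 0 := (ENNReal.half_pos hε).ne'
  obtain ⟨g₁, Y₁, h1, hg₁, hY₁⟩ := h (ε / 2) hε2
  obtain ⟨n, g₂, Z, h2, hg₂, hZ⟩ := h1.2.2 (ε / 2) hε2
  refine ⟨n, g₂, Z, h2, ?_, ?_⟩
  · refine (eLpNorm_sub_triangle h2.memLp_left h1.1 hg).trans ?_
    rw [← ENNReal.add_halves ε]
    exact add_le_add hg₂ hg₁
  · refine (eLpNorm_sub_triangle h2.memLp_right h1.2.1 hY).trans ?_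
    rw [← ENNReal.add_halves ε]
    exact add_le_add hZ hY₁

omit [TopologicalSpace.SeparableSpace V] [P.IsComplete] in
theorem sub (hB : IncrementBounds hL hL2 T K₁ K₂) (h : IsItoIntegral hL hL2 T g Y)
    (h' : IsItoIntegral hL hL2 T g' Y') : IsItoIntegral hL hL2 T (g - g') (Y - Y') := by
  refine ⟨h.1.sub h'.1, h.2.1.sub h'.2.1, fun ε hε => ?_⟩
  have hε2 : ε / 2 ≠ 0 := (ENNReal.half_pos hε).ne'
  obtain ⟨n, g₁, Z₁, h1, hg₁, hZ₁⟩ := h.2.2 (ε / 2) hε2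
  obtain ⟨m, g₂, Z₂, h2, hg₂, hZ₂⟩ := h'.2.2 (ε / 2) hε2
  refine ⟨max n m, g₁ - g₂, Z₁ - Z₂, (h1.refine_le hB (le_max_left _ _)).sub hB
    (h2.refine_le hB (le_max_right _ _)), ?_, ?_⟩
  · have e : g₁ - g₂ - (g - g') = (g₁ - g) - (g₂ - g') := by abel
    rw [e, ← ENNReal.add_halves ε]
    exact (eLpNorm_sub_le (h1.memLp_left.sub h.1).1 (h2.memLp_left.sub h'.1).1 one_le_two).trans
      (add_le_add hg₁ hg₂)
  · have e : Z₁ - Z₂ - (Y - Y') = (Z₁ - Y) - (Z₂ - Y') := by abel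
    rw [e, ← ENNReal.add_halves ε]
    exact (eLpNorm_sub_le (h1.memLp_right.sub h.2.1).1 (h2.memLp_right.sub h'.2.1).1
      one_le_two).trans (add_le_add hZ₁ hZ₂)

omit [CompleteSpace V] [TopologicalSpace.SeparableSpace V] [P.IsComplete] in
theorem zero : IsItoIntegral hL hL2 T (0 : Set.Iic T × Ω → HilbertSchmidt U V) 0 :=
  of_isGridIntegral (IsGridIntegral.zero (n := 0))

omit [TopologicalSpace.SeparableSpace V] [P.IsComplete] in
theorem add (hB : IncrementBounds hL hL2 T K₁ K₂) (h : IsItoIntegral hL hL2 T g Y)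
    (h' : IsItoIntegral hL hL2 T g' Y') : IsItoIntegral hL hL2 T (g + g') (Y + Y') := by
  have h1 := h.sub hB (zero.sub hB h')
  simpa using h1

/-- Boundedness of the integral operator. -/
theorem eLpNorm_le (hB : IncrementBounds hL hL2 T K₁ K₂) (h : IsItoIntegral hL hL2 T g Y) :
    eLpNorm Y 2 P ≤ ENNReal.ofReal (itoConst K₁ K₂ T) * eLpNorm g 2 ((timeMeasure T).prod P) := by
  set C := ENNReal.ofReal (itoConst K₁ K₂ T) with hC
  refine ENNReal.le_of_forall_pos_le_add fun ε hε _ => ?_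
  have hC1 : 1 + C ≠ 0 := by simp
  have hC2 : 1 + C ≠ ∞ := by simp [hC]
  have hε' : (ε : ℝ≥0∞) / (1 + C) ≠ 0 :=
    ENNReal.div_ne_zero.2 ⟨by exact_mod_cast hε.ne', hC2⟩
  obtain ⟨n, g₁, Z, h1, hg₁, hZ⟩ := h.2.2 _ hε'
  calc eLpNorm Y 2 P ≤ eLpNorm (Z - Y) 2 P + eLpNorm Z 2 P := eLpNorm_le_add h.2.1 h1.memLp_right
    _ ≤ ε / (1 + C) + C * (ε / (1 + C) + eLpNorm g 2 ((timeMeasure T).prod P)) := by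
        refine add_le_add hZ ((h1.eLpNorm_le hB).trans (mul_le_mul_right ?_ _))
        refine (eLpNorm_le_add h1.memLp_left h.1).trans (add_le_add ?_ le_rfl)
        rwa [eLpNorm_sub_comm]
    _ = (1 + C) * (ε / (1 + C)) + C * eLpNorm g 2 ((timeMeasure T).prod P) := by ring
    _ = C * eLpNorm g 2 ((timeMeasure T).prod P) + ε := by
        rw [ENNReal.mul_div_cancel hC1 hC2, add_comm]

theorem eLpNorm_sub_le (hB : IncrementBounds hL hL2 T K₁ K₂) (h : IsItoIntegral hL hL2 T g Y)
    (h' : IsItoIntegral hL hL2 T g' Y') : eLpNorm (Y - Y') 2 P ≤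
      ENNReal.ofReal (itoConst K₁ K₂ T) * eLpNorm (g - g') 2 ((timeMeasure T).prod P) :=
  (h.sub hB h').eLpNorm_le hB

theorem ae_eq (hB : IncrementBounds hL hL2 T K₁ K₂) (h : IsItoIntegral hL hL2 T g Y)
    (h' : IsItoIntegral hL hL2 T g Y') : Y =ᵐ[P] Y' := by
  refine ae_eq_of_eLpNorm_sub_eq_zero h.2.1 h'.2.1 (le_antisymm ?_ bot_le)
  simpa using h.eLpNorm_sub_le hB h'

/-- The integral extends to every `L²`-limit of integrable processes. -/
theorem exists_of_approx (hB : IncrementBounds hL hL2 T K₁ K₂)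
    (hg : MemLp g 2 ((timeMeasure T).prod P))
    (h : ∀ ε : ℝ≥0∞, ε ≠ 0 → ∃ g' Y', IsItoIntegral hL hL2 T g' Y' ∧
      eLpNorm (g' - g) 2 ((timeMeasure T).prod P) ≤ ε) : ∃ Y, IsItoIntegral hL hL2 T g Y := by
  set C := itoConst K₁ K₂ T with hC
  have hC0 : 0 ≤ C := Real.sqrt_nonneg _
  choose G Y hGY hG using fun n : ℕ => h (ENNReal.ofReal (1 / ((n : ℝ) + 1)))
    (by simpa using by positivity)
  have hdist : ∀ n m N, N ≤ n → N ≤ m → dist ((hGY n).2.1.toLp (Y n)) ((hGY m).2.1.toLp (Y m))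
      ≤ C * (2 * (1 / ((N : ℝ) + 1))) := fun n m N hn hm => by
    rw [Lp.dist_def, eLpNorm_congr_ae ((MemLp.coeFn_toLp _).sub (MemLp.coeFn_toLp _))]
    refine ENNReal.toReal_le_of_le_ofReal (by positivity) ?_
    refine ((hGY n).eLpNorm_sub_le hB (hGY m)).trans ?_
    rw [ENNReal.ofReal_mul hC0, two_mul, ENNReal.ofReal_add (by positivity) (by positivity)]
    refine mul_le_mul_right ((eLpNorm_sub_triangle (hGY n).1 hg (hGY m).1).trans
      (add_le_add ?_ ?_)) _
    · exact (hG n).trans (ENNReal.ofReal_le_ofReal (Nat.one_div_le_one_div hn))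
    · rw [eLpNorm_sub_comm]
      exact (hG m).trans (ENNReal.ofReal_le_ofReal (Nat.one_div_le_one_div hm))
  have hb : Tendsto (fun N : ℕ => C * (2 * (1 / ((N : ℝ) + 1)))) atTop (𝓝 0) := by
    have := (tendsto_one_div_add_atTop_nhds_zero_nat (𝕜 := ℝ)).const_mul 2 |>.const_mul C
    simpa using this
  obtain ⟨Y₀, hY₀⟩ := cauchySeq_tendsto_of_complete (cauchySeq_of_le_tendsto_0 _ hdist hb)
  refine ⟨Y₀, of_approx hg (Lp.memLp Y₀) fun ε hε => ?_⟩
  have h1 := (Lp.tendsto_Lp_iff_tendsto_eLpNorm' _ _).1 hY₀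
  have h2 : Tendsto (fun n : ℕ => ENNReal.ofReal (1 / ((n : ℝ) + 1))) atTop (𝓝 0) := by
    have := ENNReal.tendsto_ofReal (tendsto_one_div_add_atTop_nhds_zero_nat (𝕜 := ℝ))
    simpa using this
  obtain ⟨n, hn1, hn2⟩ := ((ENNReal.tendsto_nhds_zero.1 h1 ε (pos_iff_ne_zero.2 hε)).and
    (ENNReal.tendsto_nhds_zero.1 h2 ε (pos_iff_ne_zero.2 hε))).exists
  refine ⟨G n, Y n, hGY n, (hG n).trans hn2, ?_⟩
  rwa [eLpNorm_congr_ae ((MemLp.coeFn_toLp (hGY n).2.1).sub (EventuallyEq.refl _ _))] at hn1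

end IsItoIntegral
end ItoIntegral

theorem tendsto_ofReal_const_div_add_one (c : ℝ) :
    Tendsto (fun n : ℕ => ENNReal.ofReal (c / ((n : ℝ) + 1))) atTop (𝓝 0) := by
  have h := (tendsto_one_div_add_atTop_nhds_zero_nat (𝕜 := ℝ)).const_mul c
  simp only [mul_one_div, mul_zero] at h
  simpa using ENNReal.tendsto_ofReal h

/-! ### Norms of processes which are constant on a cell -/

section Cell

variable {Ω E : Type*} [NormedAddCommGroup E] {T : ℝ≥0} [mΩ : MeasurableSpace Ω] {P : Measure Ω}

theorem eLpNorm_cell_le [SFinite P] {s t : Set.Iic T} (hst : s ≤ t) {Φ : Ω → E}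
    (hΦ : MemLp Φ 2 P) : eLpNorm (cell s t Φ) 2 ((timeMeasure T).prod P)
      ≤ ENNReal.ofReal (√((t : ℝ≥0) - (s : ℝ≥0))) * eLpNorm Φ 2 P := by
  have h0 : (0 : ℝ) ≤ (t : ℝ≥0) - (s : ℝ≥0) := sub_nonneg.2 (by exact_mod_cast hst)
  rw [← ENNReal.pow_le_pow_left_iff two_ne_zero, mul_pow, eLpNorm_cell s t hΦ,
    ← ENNReal.ofReal_pow (Real.sqrt_nonneg _), Real.sq_sqrt h0]

theorem integral_norm_cell [SFinite P] {s t : Set.Iic T} (hst : s ≤ t) (Φ : Ω → E) :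
    ∫ p, ‖cell s t Φ p‖ ∂(timeMeasure T).prod P
      = (((t : ℝ≥0) : ℝ) - (s : ℝ≥0)) * ∫ ω, ‖Φ ω‖ ∂P := by
  have h0 : (0 : ℝ) ≤ (t : ℝ≥0) - (s : ℝ≥0) := sub_nonneg.2 (by exact_mod_cast hst)
  simp_rw [cell, norm_indicator_eq_indicator_norm]
  rw [integral_indicator (measurableSet_Ioc_prod_univ s t), ← Measure.prod_restrict,
    Measure.restrict_univ, integral_fun_snd fun ω => ‖Φ ω‖, measureReal_restrict_apply_univ,
    measureReal_def, timeMeasure_Ioc, ENNReal.toReal_ofReal h0, smul_eq_mul]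

omit mΩ in
theorem indicator_cell (s t a b : Set.Iic T) (Φ : Ω → E) :
    (Set.Ioc s t ×ˢ Set.univ).indicator (cell a b Φ) = cell (s ⊔ a) (t ⊓ b) Φ := by
  rw [cell, cell, Set.indicator_indicator, Set.prod_inter_prod, Set.Ioc_inter_Ioc, Set.univ_inter]

end Cell

theorem tendsto_integral_norm_of_eLpNorm_two {S E : Type*} [MeasurableSpace S] {μ : Measure S}
    [IsFiniteMeasure μ] [NormedAddCommGroup E] {ι : Type*} {l : Filter ι} {f : ι → S → E}
    {g : S → E} (hf : ∀ i, MemLp (f i) 2 μ) (hg : MemLp g 2 μ)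
    (h : Tendsto (fun i => eLpNorm (f i - g) 2 μ) l (𝓝 0)) :
    Tendsto (fun i => ∫ x, ‖f i x‖ ∂μ) l (𝓝 (∫ x, ‖g x‖ ∂μ)) := by
  refine tendsto_integral_of_L1' _ hg.1.norm
    (Eventually.of_forall fun i => ((hf i).integrable one_le_two).norm) ?_
  have hc : μ Set.univ ^ (1 / (1 : ℝ≥0∞).toReal - 1 / (2 : ℝ≥0∞).toReal) ≠ ∞ :=
    ENNReal.rpow_ne_top_of_nonneg (by norm_num) (measure_ne_top _ _)
  have h1 := ENNReal.Tendsto.mul_const h (Or.inr hc)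
  rw [zero_mul] at h1
  refine tendsto_of_tendsto_of_tendsto_of_le_of_le tendsto_const_nhds h1 (fun _ => bot_le)
    fun i => ?_
  refine (eLpNorm_mono fun x => ?_).trans
    (eLpNorm_le_eLpNorm_mul_rpow_measure_univ one_le_two ((hf i).sub hg).1)
  rw [Real.norm_eq_abs]
  exact abs_norm_sub_norm_le _ _

/-! ### Comparison with general simple processes -/

section ItoIntegral

variable {Ω : Type*} [mΩ : MeasurableSpace Ω] {P : Measure Ω} [IsProbabilityMeasure P]
  {U V : Type*} [NormedAddCommGroup U] [InnerProductSpace ℝ U] [CompleteSpace U]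
  [NormedAddCommGroup V] [InnerProductSpace ℝ V] [CompleteSpace V]
  {L : ℝ≥0 → U →ₗ[ℝ] (Ω →ₘ[P] ℝ)}
  {hL : IsCylindricalLevy P L} {hL2 : HasWeakSecondMoments P L} {T : ℝ≥0} {K₁ K₂ : ℝ}
  {n m : ℕ} {g g' : Set.Iic T × Ω → HilbertSchmidt U V} {Y Y' Z Z' : Ω → V}
  {s t : Set.Iic T} {Φ : Ω → HilbertSchmidt U V}

theorem IsItoIntegral.sum (hB : IncrementBounds hL hL2 T K₁ K₂) {ι : Type*} (I : Finset ι)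
    {G : ι → Set.Iic T × Ω → HilbertSchmidt U V} {W : ι → Ω → V}
    (h : ∀ i ∈ I, IsItoIntegral hL hL2 T (G i) (W i)) :
    IsItoIntegral hL hL2 T (∑ i ∈ I, G i) (∑ i ∈ I, W i) := by
  classical
  induction I using Finset.induction_on with
  | empty => exact zero
  | insert i I hi ih =>
    rw [Finset.sum_insert hi, Finset.sum_insert hi]
    exact (h i (Finset.mem_insert_self _ _)).add hB
      (ih fun j hj => h j (Finset.mem_insert_of_mem hj))

/-- The integral over an arbitrary cell: its end points are approximated by dyadic points from the
right. -/
theorem IsIncr.isItoIntegral (hB : IncrementBounds hL hL2 T K₁ K₂) (hT : 0 < T) (hst : s ≤ t)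
    (h : IsIncr hL hL2 s t Φ Y) : IsItoIntegral hL hL2 T (cell s t Φ) Y := by
  refine IsItoIntegral.of_approx (memLp_cell s t h.memLp) h.integral.1 fun ε hε => ?_
  have hlim : Tendsto (fun n : ℕ => ENNReal.ofReal (√((1 + K₁) * (T / 2 ^ n))) * eLpNorm Φ 2 P)
      atTop (𝓝 0) := by
    have h1 : Tendsto (fun n : ℕ => √((1 + K₁) * ((T : ℝ) / 2 ^ n))) atTop (𝓝 0) := by
      have := (((tendsto_pow_atTop_nhds_zero_of_lt_one (r := (1 / 2 : ℝ)) (by norm_num)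
        (by norm_num)).const_mul (T : ℝ)).const_mul (1 + K₁)).sqrt
      simpa [div_eq_mul_inv] using this
    have h2 := ENNReal.Tendsto.mul_const (ENNReal.tendsto_ofReal h1) (b := eLpNorm Φ 2 P)
      (Or.inr h.memLp.2.ne)
    simpa using h2
  obtain ⟨n, hn⟩ := (ENNReal.tendsto_nhds_zero.1 hlim (ε / 2) (ENNReal.half_pos hε)).exists
  set B := ENNReal.ofReal (√((1 + K₁) * (T / 2 ^ n))) * eLpNorm Φ 2 P with hBdef
  -- `(sn, tn]` is a union of grid cells, and it differs from `(s, t]` by two short intervals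
  set sn := gridPt T n (ceilIdx n s) with hsn
  set tn := gridPt T n (ceilIdx n t) with htn
  have hs1 : s ≤ sn := le_gridPt_ceilIdx hT n s
  have ht1 : t ≤ tn := le_gridPt_ceilIdx hT n t
  have hst' : sn ≤ tn := gridPt_mono n (ceilIdx_mono n hst)
  have hcs1 : (s : ℝ≥0) ≤ sn := hs1
  have hct1 : (t : ℝ≥0) ≤ tn := ht1
  have hcst : (s : ℝ≥0) ≤ t := hst
  have hcst' : (sn : ℝ≥0) ≤ tn := hst'
  have hgap : ∀ r : Set.Iic T, (((gridPt T n (ceilIdx n r) : ℝ≥0) : ℝ) - (r : ℝ≥0)) ≤ T / 2 ^ n :=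
    fun r => by
      have := gridPt_ceilIdx_le hT n r
      have h3 : ((gridPt T n (ceilIdx n r) : ℝ≥0) : ℝ) ≤ (r : ℝ≥0) + T / 2 ^ n := by
        exact_mod_cast this
      linarith
  have hK := hB.nonneg₁
  have hcellB : ∀ r : Set.Iic T, eLpNorm (cell r (gridPt T n (ceilIdx n r)) Φ) 2
      ((timeMeasure T).prod P) ≤ B := fun r => by
    refine (eLpNorm_cell_le (le_gridPt_ceilIdx hT n r) h.memLp).trans ?_
    refine mul_le_mul_left (ENNReal.ofReal_le_ofReal (Real.sqrt_le_sqrt ((hgap r).trans ?_))) _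
    exact le_mul_of_one_le_left (by positivity) (by linarith)
  have hincB : ∀ {r : Set.Iic T} {X : Ω → V},
      IsIncr hL hL2 r (gridPt T n (ceilIdx n r)) Φ X → eLpNorm X 2 P ≤ B := fun {r X} hX => by
    refine (hX.eLpNorm_le hB (le_gridPt_ceilIdx hT n r) (gridPt_coe_le n _)).trans ?_
    refine mul_le_mul_left (ENNReal.ofReal_le_ofReal (Real.sqrt_le_sqrt ?_)) _
    have h5 : (0 : ℝ) ≤ (gridPt T n (ceilIdx n r) : ℝ≥0) - (r : ℝ≥0) :=
      sub_nonneg.2 (by exact_mod_cast le_gridPt_ceilIdx hT n r)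
    exact mul_le_mul (by linarith) (hgap r) h5 (by linarith)
  obtain ⟨Ya, hYa⟩ := hB.exists_isIncr hcs1 (gridPt_coe_le n _) h.meas h.memLp
  obtain ⟨Yb, hYb⟩ := hB.exists_isIncr hcst' (gridPt_coe_le n _)
    (h.meas.mono ((cylFiltration P L).mono hcs1)) h.memLp
  obtain ⟨Yc, hYc⟩ := hB.exists_isIncr hct1 (gridPt_coe_le n _)
    (h.meas.mono ((cylFiltration P L).mono hcst)) h.memLp
  have e1 := (hYa.concat hB hcs1 hcst' (gridPt_coe_le n _) hYb).ae_eq hB (hcs1.trans hcst')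
    (gridPt_coe_le n _) (h.concat hB hcst hct1 (gridPt_coe_le n _) hYc)
  have e2 : Yb - Y =ᵐ[P] Yc - Ya := by
    filter_upwards [e1] with ω hω
    simp only [Pi.add_apply, Pi.sub_apply] at hω ⊢
    rw [sub_eq_sub_iff_add_eq_add, add_comm, hω, add_comm]
  have e3 : cell sn tn Φ - cell s t Φ = cell t tn Φ - cell s sn Φ := by
    have := (cell_add_cell hs1 hst' Φ).trans (cell_add_cell hst ht1 Φ).symm
    rw [sub_eq_sub_iff_add_eq_add, add_comm, this, add_comm]
  refine ⟨cell sn tn Φ, Yb, .of_isGridIntegral (IsGridIntegral.of_isIncr hB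
    (ceilIdx_mono n hst) (ceilIdx_le n t) hYb), ?_, ?_⟩
  · rw [e3, ← ENNReal.add_halves ε]
    exact (eLpNorm_sub_le (memLp_cell _ _ h.memLp).1 (memLp_cell _ _ h.memLp).1 one_le_two).trans
      (add_le_add ((hcellB t).trans hn) ((hcellB s).trans hn))
  · rw [eLpNorm_congr_ae e2, ← ENNReal.add_halves ε]
    exact (eLpNorm_sub_le hYc.integral.1.1 hYa.integral.1.1 one_le_two).trans
      (add_le_add ((hincB hYc).trans hn) ((hincB hYa).trans hn))

variable [TopologicalSpace.SeparableSpace V] [P.IsComplete]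

omit [P.IsComplete] in
/-- The integral of a simple process on an arbitrary partition belongs to the closure of the dyadic
graph. -/
theorem IsSimpleIntegral.isItoIntegral (hB : IncrementBounds hL hL2 T K₁ K₂) (hT : 0 < T)
    (h : IsSimpleIntegral P L T g Y) : IsItoIntegral hL hL2 T g Y := by
  obtain ⟨N, τ, Φ, X, -, -, hτ, hX, hg, hY⟩ := h
  have h1 : ∀ k ∈ Finset.range N, IsItoIntegral hL hL2 T (cell (τ k) (τ (k + 1)) (Φ k)) (X k) :=
    fun k hk => by
      have hk := Finset.mem_range.1 hk
      have hi := hX k hk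
      have hle : (τ k : ℝ≥0) ≤ τ (k + 1) := (hτ k hk).le
      exact IsIncr.isItoIntegral hB hT (hτ k hk).le
        ⟨hi.1, hi.2.1, hi.isNoiseIntegral (hB.isNoise _ _ hle (τ (k + 1)).2)⟩
  have h2 := IsItoIntegral.sum hB _ h1
  have e : ∑ k ∈ Finset.range N, cell (τ k) (τ (k + 1)) (Φ k) = g := by
    ext1 ⟨t, ω⟩
    simp only [hg, Finset.sum_apply, cell_apply]
  rw [e] at h2
  refine h2.congr ?_
  filter_upwards [hY] with ω hω
  rw [hω, Finset.sum_apply]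

/-- The closure of the dyadic graph is the continuous extension from all simple processes. -/
theorem IsItoIntegral.isStochIntegral (hB : IncrementBounds hL hL2 T K₁ K₂) (hT : 0 < T)
    {Ψ : Set.Iic T → Ω → HilbertSchmidt U V} (hΨ : IsIntegrand P L T Ψ)
    (h : IsItoIntegral hL hL2 T (Function.uncurry Ψ) Y) : IsStochIntegral P L T Ψ Y := by
  refine ⟨hΨ, h.2.1, ?_, fun G Z hGZ hG => ?_⟩
  · choose n G Z hGZ hG hZ using fun n : ℕ => h.2.2 (ENNReal.ofReal (1 / ((n : ℝ) + 1)))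
      (by simpa using by positivity)
    exact ⟨G, Z, fun k => (hGZ k).isSimpleIntegral hB hT,
      tendsto_of_tendsto_of_tendsto_of_le_of_le tendsto_const_nhds
        (tendsto_ofReal_const_div_add_one 1) (fun _ => bot_le) hG,
      tendsto_of_tendsto_of_tendsto_of_le_of_le tendsto_const_nhds
        (tendsto_ofReal_const_div_add_one 1) (fun _ => bot_le) hZ⟩
  · have h1 := ENNReal.Tendsto.const_mul hG (a := ENNReal.ofReal (itoConst K₁ K₂ T))
      (Or.inr (by simp))
    rw [mul_zero] at h1
    exact tendsto_of_tendsto_of_tendsto_of_le_of_le tendsto_const_nhds h1 (fun _ => bot_le)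
      fun k => ((hGZ k).isItoIntegral hB hT).eLpNorm_sub_le hB h

/-! ### Predictable integrands -/

theorem predictable_le (𝓕 : Filtration (Set.Iic T) mΩ) :
    𝓕.predictable ≤ (inferInstance : MeasurableSpace (Set.Iic T × Ω)) :=
  measurableSpace_le_predictable_of_measurableSet
    (fun A hA => (measurableSet_singleton _).prod (𝓕.le _ A hA))
    fun _ A hA => measurableSet_Ioi.prod (𝓕.le _ A hA)

omit [TopologicalSpace.SeparableSpace V] [P.IsComplete] in
theorem exists_isItoIntegral_Ioi_prod (hB : IncrementBounds hL hL2 T K₁ K₂) (hT : 0 < T)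
    (φ : HilbertSchmidt U V) (i : Set.Iic T) {A : Set Ω}
    (hA : MeasurableSet[cylFiltration P L i] A) :
    ∃ Y, IsItoIntegral hL hL2 T ((Set.Ioi i ×ˢ A).indicator fun _ => φ) Y := by
  classical
  have hiT : (i : ℝ≥0) ≤ ((⊤ : Set.Iic T) : ℝ≥0) := le_top (a := i)
  have hA' : StronglyMeasurable[cylFiltration P L i] (A.indicator fun _ : Ω => φ) :=
    stronglyMeasurable_const.indicator hA
  obtain ⟨Y, hY⟩ := hB.exists_isIncr hiT (⊤ : Set.Iic T).2 hA'
    ((memLp_const φ).indicator ((cylFiltration P L).le _ _ hA))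
  refine ⟨Y, ?_⟩
  have := hY.isItoIntegral hB hT le_top
  convert this using 1
  ext1 ⟨r, ω⟩
  by_cases h1 : i < r <;> by_cases h2 : ω ∈ A <;> simp [cell_apply, h1, h2]

/-- The sets with integrable indicator form a λ-system which contains the generators of the
predictable σ-algebra. -/
theorem exists_isItoIntegral_indicator (hB : IncrementBounds hL hL2 T K₁ K₂) (hT : 0 < T)
    (φ : HilbertSchmidt U V) {G : Set (Set.Iic T × Ω)}
    (hG : MeasurableSet[(cylFiltrationOn P L T).predictable] G) :
    ∃ Y, IsItoIntegral hL hL2 T (G.indicator fun _ => φ) Y := by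
  have hle := predictable_le (cylFiltrationOn P L T)
  have hnull : ∀ A : Set Ω, (timeMeasure T).prod P ({⊥} ×ˢ A) = 0 := fun A => by
    refine measure_mono_null (Set.prod_mono le_rfl (Set.subset_univ A)) ?_
    rw [Measure.prod_prod, timeMeasure_singleton, zero_mul]
  have hmem : ∀ {H : Set (Set.Iic T × Ω)}, MeasurableSet H →
      MemLp (H.indicator fun _ => φ) 2 ((timeMeasure T).prod P) := fun hH =>
    (memLp_const φ).indicator hH
  have huniv : ∃ Y, IsItoIntegral hL hL2 T
      ((Set.univ : Set (Set.Iic T × Ω)).indicator fun _ => φ) Y := by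
    obtain ⟨Y, hY⟩ := exists_isItoIntegral_Ioi_prod hB hT φ ⊥ (A := Set.univ) MeasurableSet.univ
    refine ⟨Y, hY.congr_left (indicator_ae_eq_of_ae_eq_set ?_)⟩
    rw [ae_eq_univ]
    refine measure_mono_null ?_ (hnull Set.univ)
    rintro ⟨r, ω⟩ h
    simp only [Set.mem_compl_iff, Set.mem_prod, Set.mem_Ioi, Set.mem_univ, and_true, not_lt,
      le_bot_iff] at h
    simp [h]
  refine MeasurableSpace.induction_on_inter (m := (cylFiltrationOn P L T).predictable)
    (C := fun G _ => ∃ Y, IsItoIntegral hL hL2 T (G.indicator fun _ => φ) Y)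
    rfl ?_ ?_ ?_ ?_ ?_ G hG
  · rintro _ (⟨A, hA, rfl⟩ | ⟨i, A, hA, rfl⟩) _ (⟨A', hA', rfl⟩ | ⟨j, A', hA', rfl⟩) hne
    · exact Or.inl ⟨A ∩ A', MeasurableSet.inter hA hA', by rw [Set.prod_inter_prod, Set.inter_self]⟩
    · obtain ⟨⟨r, ω⟩, h1, h2⟩ := hne
      exact absurd (show j < r from h2.1) (by rw [show r = ⊥ from h1.1]; exact not_lt_bot)
    · obtain ⟨⟨r, ω⟩, h1, h2⟩ := hne
      exact absurd (show i < r from h1.1) (by rw [show r = ⊥ from h2.1]; exact not_lt_bot)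
    · refine Or.inr ⟨i ⊔ j, A ∩ A', ?_, by rw [Set.prod_inter_prod, Set.Ioi_inter_Ioi]⟩
      exact MeasurableSet.inter ((cylFiltrationOn P L T).mono le_sup_left _ hA)
        ((cylFiltrationOn P L T).mono le_sup_right _ hA')
  · exact ⟨0, by rw [Set.indicator_empty]; exact IsItoIntegral.zero⟩
  · rintro _ (⟨A, hA, rfl⟩ | ⟨i, A, hA, rfl⟩)
    · refine ⟨0, IsItoIntegral.zero.congr_left ?_⟩
      exact (indicator_meas_zero (hnull A)).symm
    · exact exists_isItoIntegral_Ioi_prod hB hT φ i hA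
  · rintro H hH ⟨Y, hY⟩
    obtain ⟨Y', hY'⟩ := huniv
    refine ⟨Y' - Y, ?_⟩
    rw [Set.compl_eq_univ_sdiff, Set.indicator_sdiff (Set.subset_univ H)]
    exact hY'.sub hB hY
  · intro f hd hf hY
    choose Y hY using hY
    have hfm : ∀ i, MeasurableSet (f i) := fun i => hle _ (hf i)
    refine IsItoIntegral.exists_of_approx hB (hmem (MeasurableSet.iUnion hfm)) fun ε hε => ?_
    have hc : Tendsto (fun n : ℕ => ‖φ‖ₑ *
        (timeMeasure T).prod P (⋃ i ≥ n, f i) ^ (1 / (2 : ℝ≥0∞).toReal)) atTop (𝓝 0) := by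
      have h1 := (tendsto_measure_biUnion_Ici_zero_of_pairwise_disjoint
        (μ := (timeMeasure T).prod P) (fun i => (hfm i).nullMeasurableSet) hd)
      have h2 := (ENNReal.continuous_rpow_const (y := 1 / (2 : ℝ≥0∞).toReal)).tendsto 0 |>.comp h1
      have h3 := ENNReal.Tendsto.const_mul h2 (a := ‖φ‖ₑ) (Or.inr (by simp))
      rw [ENNReal.zero_rpow_of_pos (by norm_num), mul_zero] at h3
      exact h3
    obtain ⟨n, hn⟩ := (ENNReal.tendsto_nhds_zero.1 hc ε (pos_iff_ne_zero.2 hε)).exists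
    refine ⟨_, _, IsItoIntegral.sum hB (Finset.range n) fun i _ => hY i, le_trans ?_ hn⟩
    refine le_trans (eLpNorm_mono (g := (⋃ i ≥ n, f i).indicator fun _ => φ) fun p => ?_)
      (eLpNorm_indicator_const_le φ 2)
    rw [Pi.sub_apply, Finset.sum_apply]
    by_cases hp : p ∈ ⋃ i, f i
    · obtain ⟨i, hi⟩ := Set.mem_iUnion.1 hp
      have hj : ∀ j, j ≠ i → p ∉ f j := fun j hji hpj =>
        Set.disjoint_left.1 (hd hji) hpj hi
      rw [Set.indicator_of_mem hp]
      by_cases hin : i < n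
      · rw [Finset.sum_eq_single_of_mem i (Finset.mem_range.2 hin) fun j _ hji =>
          Set.indicator_of_notMem (hj j hji) _, Set.indicator_of_mem hi, sub_self, norm_zero]
        exact norm_nonneg _
      · have hmem : p ∈ ⋃ i ≥ n, f i := Set.mem_iUnion₂.2 ⟨i, not_lt.1 hin, hi⟩
        rw [Finset.sum_eq_zero fun j hjn => Set.indicator_of_notMem (hj j fun hji => hin
          (hji ▸ Finset.mem_range.1 hjn)) _, Set.indicator_of_mem hmem, zero_sub, norm_neg]
    · rw [Set.indicator_of_notMem hp, Finset.sum_eq_zero fun j _ => Set.indicator_of_notMem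
        (fun h => hp (Set.mem_iUnion.2 ⟨j, h⟩)) _, sub_self, norm_zero]
      exact norm_nonneg _

/-- Every square integrable predictable process is integrable. -/
theorem exists_isItoIntegral (hB : IncrementBounds hL hL2 T K₁ K₂) (hT : 0 < T)
    (hg : StronglyMeasurable[(cylFiltrationOn P L T).predictable] g)
    (hg2 : MemLp g 2 ((timeMeasure T).prod P)) : ∃ Y, IsItoIntegral hL hL2 T g Y := by
  refine IsItoIntegral.exists_of_approx hB hg2 fun ε hε => ?_
  obtain ⟨f, ⟨n, A, φ, hA, -, hf⟩, hfg⟩ :=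
    exists_isSimpleMap_eLpNorm_sub_le (predictable_le (cylFiltrationOn P L T)) hg hg2 hε
  choose Y hY using fun i => exists_isItoIntegral_indicator hB hT (φ i) (hA i)
  have e : f = ∑ i, (A i).indicator fun _ => φ i := by ext1 p; rw [hf, Finset.sum_apply]
  exact ⟨f, ∑ i, Y i, e ▸ IsItoIntegral.sum hB Finset.univ fun i _ => hY i, hfg⟩

/-! ### The integral over a subinterval -/

/-- `Y = ∫_s^t g dL`, together with the facts that `Y` is `F_t`-measurable and that the
conditional drift of the integral is bounded by `K₂ ∫_s^t ‖g‖`. -/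
structure IsIntegralOver (hL : IsCylindricalLevy P L) (hL2 : HasWeakSecondMoments P L) (K₂ : ℝ)
    (s t : Set.Iic T) (g : Set.Iic T × Ω → HilbertSchmidt U V) (Y : Ω → V) : Prop where
  isItoIntegral : IsItoIntegral hL hL2 T ((Set.Ioc s t ×ˢ Set.univ).indicator g) Y
  aestronglyMeasurable : AEStronglyMeasurable[cylFiltration P L t] Y P
  drift : ∀ (c : ℝ) (W : Ω → V), 0 ≤ c → StronglyMeasurable[cylFiltration P L s] W →
    (∀ ω, ‖W ω‖ ≤ c) → |∫ ω, inner ℝ (W ω) (Y ω) ∂P| ≤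
      K₂ * c * ∫ p, ‖(Set.Ioc s t ×ˢ Set.univ).indicator g p‖ ∂(timeMeasure T).prod P

omit [InnerProductSpace ℝ V] [CompleteSpace V] [TopologicalSpace.SeparableSpace V]
  [P.IsComplete] in
theorem memLp_of_norm_le {W : Ω → V} {𝓖 : MeasurableSpace Ω} (h𝓖 : 𝓖 ≤ mΩ)
    (hW : StronglyMeasurable[𝓖] W) {c : ℝ} (hc : ∀ ω, ‖W ω‖ ≤ c) : MemLp W 2 P :=
  .of_bound (hW.mono h𝓖).aestronglyMeasurable c (Eventually.of_forall hc)

omit [TopologicalSpace.SeparableSpace V] [P.IsComplete] in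
theorem exists_isIntegralOver_cell (hB : IncrementBounds hL hL2 T K₁ K₂) (hT : 0 < T)
    {a b : Set.Iic T} (h : StronglyMeasurable[cylFiltration P L a] Φ)
    (hΦ2 : MemLp Φ 2 P) : ∃ Y, IsIntegralOver hL hL2 K₂ s t (cell a b Φ) Y := by
  rcases le_total (s ⊔ a) (t ⊓ b) with hab | hab
  · have hab' : ((s ⊔ a : Set.Iic T) : ℝ≥0) ≤ (t ⊓ b : Set.Iic T) := hab
    obtain ⟨Y, hY⟩ := hB.exists_isIncr hab' (t ⊓ b).2
      (h.mono ((cylFiltration P L).mono (show (a : ℝ≥0) ≤ (s ⊔ a : Set.Iic T) from le_sup_right)))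
      hΦ2
    refine ⟨Y, ?_, ?_, fun c W hc hW hWc => ?_⟩
    · rw [indicator_cell]
      exact hY.isItoIntegral hB hT hab
    · exact (hY.aestronglyMeasurable hB hab' (t ⊓ b).2).mono
        ((cylFiltration P L).mono (show ((t ⊓ b : Set.Iic T) : ℝ≥0) ≤ t from inf_le_left))
    · have h1 := hY.integral.abs_integral_inner_le (hB.isNoise _ _ hab' (t ⊓ b).2) hY.meas hY.memLp
        (hW.mono ((cylFiltration P L).mono (show (s : ℝ≥0) ≤ (s ⊔ a : Set.Iic T) from le_sup_left)))
        (memLp_of_norm_le ((cylFiltration P L).le s) hW hWc)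
      rw [indicator_cell, integral_norm_cell hab]
      refine h1.trans ?_
      have h2 : ∫ ω, ‖W ω‖ * ‖Φ ω‖ ∂P ≤ c * ∫ ω, ‖Φ ω‖ ∂P := by
        rw [← integral_const_mul]
        have hΦ1 := (hΦ2.integrable one_le_two).norm
        refine integral_mono_of_nonneg (Eventually.of_forall fun ω => by positivity)
          (hΦ1.const_mul c) (Eventually.of_forall fun ω => ?_)
        exact mul_le_mul_of_nonneg_right (hWc ω) (norm_nonneg _)
      have h3 : (0 : ℝ) ≤ ((t ⊓ b : Set.Iic T) : ℝ≥0) - ((s ⊔ a : Set.Iic T) : ℝ≥0) :=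
        sub_nonneg.2 (by exact_mod_cast hab')
      refine (mul_le_mul_of_nonneg_left h2 (mul_nonneg hB.nonneg₂ h3)).trans_eq (by ring)
  · have e : (Set.Ioc s t ×ˢ (Set.univ : Set Ω)).indicator (cell a b Φ) = 0 := by
      rw [indicator_cell, cell, Set.Ioc_eq_empty (not_lt.2 hab), Set.empty_prod,
        Set.indicator_empty]
      rfl
    refine ⟨0, ?_, stronglyMeasurable_zero.aestronglyMeasurable, fun c W _ _ _ => ?_⟩
    · rw [e]; exact IsItoIntegral.zero
    · simp [e]

omit [TopologicalSpace.SeparableSpace V] [P.IsComplete] in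
theorem IsGridIntegral.exists_isIntegralOver (hB : IncrementBounds hL hL2 T K₁ K₂) (hT : 0 < T)
    (h : IsGridIntegral hL hL2 T n g Z) :
    ∃ Y, IsIntegralOver hL hL2 K₂ s t g Y := by
  obtain ⟨Φ, X, hX, hg, -⟩ := h
  have hX' : ∀ k ∈ Finset.range (2 ^ n), ∃ Y, IsIntegralOver hL hL2 K₂ s t
      (cell (gridPt T n k) (gridPt T n (k + 1)) (Φ k)) Y := fun k hk =>
    exists_isIntegralOver_cell hB hT (hX k (Finset.mem_range.1 hk)).meas
      (hX k (Finset.mem_range.1 hk)).memLp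
  choose! Y hY using hX'
  have e : (Set.Ioc s t ×ˢ (Set.univ : Set Ω)).indicator g = ∑ k ∈ Finset.range (2 ^ n),
      (Set.Ioc s t ×ˢ Set.univ).indicator (cell (gridPt T n k) (gridPt T n (k + 1)) (Φ k)) := by
    rw [hg, Finset.indicator_sum]
  refine ⟨∑ k ∈ Finset.range (2 ^ n), Y k, ?_, ?_, fun c W hc hW hWc => ?_⟩
  · rw [e]
    exact IsItoIntegral.sum hB _ fun k hk => (hY k hk).isItoIntegral
  · refine Finset.sum_induction Y (fun f => AEStronglyMeasurable[cylFiltration P L t] f P)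
      (fun _ _ h h' => h.add h') stronglyMeasurable_zero.aestronglyMeasurable
      fun k hk => (hY k hk).aestronglyMeasurable
  · have hW2 : MemLp W 2 P := memLp_of_norm_le ((cylFiltration P L).le s) hW hWc
    have e1 : ∫ ω, inner ℝ (W ω) ((∑ k ∈ Finset.range (2 ^ n), Y k) ω) ∂P
        = ∑ k ∈ Finset.range (2 ^ n), ∫ ω, inner ℝ (W ω) (Y k ω) ∂P := by
      rw [← integral_finsetSum _ fun k hk => integrable_inner hW2 (hY k hk).isItoIntegral.2.1]
      simp_rw [Finset.sum_apply, inner_sum]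
    have e2 : ∀ p, ‖(Set.Ioc s t ×ˢ (Set.univ : Set Ω)).indicator g p‖
        = ∑ k ∈ Finset.range (2 ^ n), ‖(Set.Ioc s t ×ˢ (Set.univ : Set Ω)).indicator
          (cell (gridPt T n k) (gridPt T n (k + 1)) (Φ k)) p‖ := fun p => by
      classical
      by_cases hp : p ∈ Set.Ioc s t ×ˢ (Set.univ : Set Ω)
      · simp only [Set.indicator_of_mem hp]
        rw [hg, apply_sum_cell n Φ (fun x => ‖x‖) norm_zero p]
        simp only [cell, norm_indicator_eq_indicator_norm]
      · simp only [Set.indicator_of_notMem hp, norm_zero, Finset.sum_const_zero]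
    rw [e1, integral_congr_ae (Eventually.of_forall e2), integral_finsetSum, Finset.mul_sum]
    · exact (Finset.abs_sum_le_sum_abs _ _).trans
        (Finset.sum_le_sum fun k hk => (hY k hk).drift c W hc hW hWc)
    · exact fun k hk => ((hY k hk).isItoIntegral.1.integrable one_le_two).norm

/-- The integral over a subinterval exists; measurability and drift bound pass from dyadic simple
processes to `L²`-limits. -/
theorem IsItoIntegral.exists_isIntegralOver (hB : IncrementBounds hL hL2 T K₁ K₂) (hT : 0 < T)
    (h : IsItoIntegral hL hL2 T g Y) :
    ∃ Y', IsIntegralOver hL hL2 K₂ s t g Y' := by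
  have hI := measurableSet_Ioc_prod_univ (Ω := Ω) s t
  choose n G Z hGZ hG hZ using fun n : ℕ => h.2.2 (ENNReal.ofReal (1 / ((n : ℝ) + 1)))
    (by simpa using by positivity)
  choose X hX using fun k => (hGZ k).exists_isIntegralOver hB hT
  have hG' : Tendsto (fun k => eLpNorm ((Set.Ioc s t ×ˢ Set.univ).indicator (G k)
      - (Set.Ioc s t ×ˢ Set.univ).indicator g) 2 ((timeMeasure T).prod P)) atTop (𝓝 0) := by
    refine tendsto_of_tendsto_of_tendsto_of_le_of_le tendsto_const_nhds
      (tendsto_ofReal_const_div_add_one 1) (fun _ => bot_le) fun k => ?_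
    rw [← Set.indicator_sub']
    exact (eLpNorm_indicator_le _).trans (hG k)
  obtain ⟨Y', hY'⟩ := exists_of_approx hB (h.1.indicator hI) fun ε hε =>
    (ENNReal.tendsto_nhds_zero.1 hG' ε (pos_iff_ne_zero.2 hε)).exists.elim fun k hk =>
      ⟨_, _, (hX k).isItoIntegral, hk⟩
  have hX' : Tendsto (fun k => eLpNorm (X k - Y') 2 P) atTop (𝓝 0) := by
    have h1 := ENNReal.Tendsto.const_mul hG' (a := ENNReal.ofReal (itoConst K₁ K₂ T))
      (Or.inr (by simp))
    rw [mul_zero] at h1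
    exact tendsto_of_tendsto_of_tendsto_of_le_of_le tendsto_const_nhds h1 (fun _ => bot_le)
      fun k => (hX k).isItoIntegral.eLpNorm_sub_le hB hY'
  refine ⟨Y', hY', ?_, fun c W hc hW hWc => ?_⟩
  · refine aestronglyMeasurable_of_eLpNorm_approx ((cylFiltration P L).le t) hY'.2.1 fun ε hε => ?_
    obtain ⟨k, hk⟩ := (ENNReal.tendsto_nhds_zero.1 hX' ε (pos_iff_ne_zero.2 hε)).exists
    exact ⟨X k, (hX k).isItoIntegral.2.1, (hX k).aestronglyMeasurable, hk⟩
  · have hW2 : MemLp W 2 P := memLp_of_norm_le ((cylFiltration P L).le s) hW hWc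
    refine le_of_tendsto_of_tendsto'
      (tendsto_integral_inner hW2 (fun k => (hX k).isItoIntegral.2.1) hY'.2.1 hX').abs
      ((tendsto_integral_norm_of_eLpNorm_two (fun k => (hX k).isItoIntegral.1) hY'.1
        hG').const_mul (K₂ * c)) fun k => (hX k).drift c W hc hW hWc

end ItoIntegral

/-! ### Counting oscillations along a finite path -/

section Moves

variable {V : Type*} [NormedAddCommGroup V]

/-- The anchor follows the path `y`: it stays where it is until the path is at distance at least
`ε` from it, and then it moves to the current position of the path. -/
noncomputable def anchor (ε : ℝ) (y : ℕ → V) : ℕ → V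
  | 0 => y 0
  | k + 1 => if ε ≤ ‖y (k + 1) - anchor ε y k‖ then y (k + 1) else anchor ε y k

/-- The number of moves of the anchor up to the given time. -/
noncomputable def moves (ε : ℝ) (y : ℕ → V) : ℕ → ℕ
  | 0 => 0
  | k + 1 => if ε ≤ ‖y (k + 1) - anchor ε y k‖ then moves ε y k + 1 else moves ε y k

variable {ε : ℝ} {y : ℕ → V}

theorem norm_sub_anchor_lt (hε : 0 < ε) (k : ℕ) : ‖y k - anchor ε y k‖ < ε := by
  cases k with
  | zero => simpa [anchor] using hε
  | succ k =>
    rw [anchor]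
    split_ifs with h
    · simpa using hε
    · exact not_le.1 h

theorem moves_mono : Monotone (moves ε y) := by
  refine monotone_nat_of_le_succ fun k => ?_
  rw [moves]
  split_ifs <;> omega

theorem moves_le (k : ℕ) : moves ε y k ≤ k := by
  induction k with
  | zero => simp [moves]
  | succ k ih =>
    rw [moves]
    split_ifs <;> omega

theorem anchor_eq_of_moves_eq {i j : ℕ} (hij : i ≤ j) (h : moves ε y j = moves ε y i) :
    anchor ε y j = anchor ε y i := by
  induction j, hij using Nat.le_induction with
  | base => rfl
  | succ j hij ih =>
    have h1 : moves ε y i ≤ moves ε y j := moves_mono hij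
    rw [moves] at h
    rw [anchor]
    split_ifs at h ⊢
    · omega
    · exact ih h

/-- An oscillation of size `2ε` forces a move of the anchor. -/
theorem moves_lt_of_two_mul_le (hε : 0 < ε) {i j : ℕ} (hij : i ≤ j) (h : 2 * ε ≤ ‖y j - y i‖) :
    moves ε y i < moves ε y j := by
  refine lt_of_le_of_ne (moves_mono hij) fun he => ?_
  have h1 := anchor_eq_of_moves_eq hij he.symm
  have h2 := norm_sub_anchor_lt (y := y) hε i
  have h3 := norm_sub_anchor_lt (y := y) hε j
  rw [h1] at h3
  have h4 : ‖y j - y i‖ ≤ ‖y j - anchor ε y i‖ + ‖y i - anchor ε y i‖ := by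
    have := norm_sub_le (y j - anchor ε y i) (y i - anchor ε y i)
    rwa [sub_sub_sub_cancel_right] at this
  linarith

/-- The number of moves is controlled by the square norms of the increments of the path and a
discrete stochastic integral of a bounded process. -/
theorem sq_mul_moves_le [InnerProductSpace ℝ V] (hε : 0 ≤ ε) (N : ℕ) :
    ε ^ 2 * moves ε y N ≤ ∑ k ∈ Finset.range N, (‖y (k + 1) - y k‖ ^ 2
      + 2 * inner ℝ (y k - anchor ε y k) (y (k + 1) - y k)) := by
  suffices h : ε ^ 2 * moves ε y N + ‖y N - anchor ε y N‖ ^ 2 ≤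
      ∑ k ∈ Finset.range N, (‖y (k + 1) - y k‖ ^ 2
        + 2 * inner ℝ (y k - anchor ε y k) (y (k + 1) - y k)) by
    have := sq_nonneg ‖y N - anchor ε y N‖
    linarith
  induction N with
  | zero => simp [moves, anchor]
  | succ N ih =>
    rw [Finset.sum_range_succ]
    have e : ‖y (N + 1) - anchor ε y N‖ ^ 2 = ‖y N - anchor ε y N‖ ^ 2
        + 2 * inner ℝ (y N - anchor ε y N) (y (N + 1) - y N) + ‖y (N + 1) - y N‖ ^ 2 := by
      rw [← norm_add_sq_real]
      congr 2
      abel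
    rw [anchor, moves]
    split_ifs with h
    · have h1 := pow_le_pow_left₀ hε h 2
      push_cast
      simp only [sub_self, norm_zero]
      nlinarith
    · linarith

end Moves

/-! ### Right limits along a dense set -/

section RightLimits

variable {ι V : Type*} [LinearOrder ι] [TopologicalSpace ι] [OrderTopology ι]
  [NormedAddCommGroup V] {D : Set ι}

theorem neBot_nhdsWithin_Ioi_inter (hD : ∀ a b, a < b → (Set.Ioo a b ∩ D).Nonempty) {t u : ι}
    (htu : t < u) : (𝓝[Set.Ioi t ∩ D] t).NeBot := by
  rw [nhdsWithin_inter', inf_principal_neBot_iff]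
  intro s hs
  obtain ⟨v, hv, hvs⟩ := (mem_nhdsGT_iff_exists_Ioo_subset' htu).1 hs
  exact (hD t v hv).mono fun x hx => ⟨hvs hx.1, hx.2⟩

theorem neBot_nhdsWithin_Iio_inter (hD : ∀ a b, a < b → (Set.Ioo a b ∩ D).Nonempty) {t u : ι}
    (hut : u < t) : (𝓝[Set.Iio t ∩ D] t).NeBot := by
  rw [nhdsWithin_inter', inf_principal_neBot_iff]
  intro s hs
  obtain ⟨v, hv, hvs⟩ := (mem_nhdsLT_iff_exists_Ioo_subset' hut).1 hs
  exact (hD v t hv).mono fun x hx => ⟨hvs hx.1, hx.2⟩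

/-- The right limits along a dense set of a function which has right and left limits along this set
form a càdlàg function. -/
theorem isCadlag_of_tendsto (hD : ∀ a b, a < b → (Set.Ioo a b ∩ D).Nonempty) {f r : ι → V}
    (hr : ∀ t u, t < u → Tendsto f (𝓝[Set.Ioi t ∩ D] t) (𝓝 (r t)))
    (hl : ∀ t u, u < t → ∃ l, Tendsto f (𝓝[Set.Iio t ∩ D] t) (𝓝 l)) : IsCadlag r := by
  have key : ∀ {s v : ι} {x : V} {δ : ℝ}, s < v →
      (∀ p ∈ Set.Ioo s v ∩ D, dist (f p) x ≤ δ) → dist (r s) x ≤ δ := fun {s v x δ} hsv h => by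
    have := neBot_nhdsWithin_Ioi_inter hD hsv
    refine le_of_tendsto ((hr s v hsv).dist tendsto_const_nhds) ?_
    rw [nhdsWithin_inter']
    filter_upwards [mem_inf_of_left (Ioo_mem_nhdsGT hsv),
      mem_inf_of_right (mem_principal_self D)] with p hp hpD
    exact h p ⟨hp, hpD⟩
  intro t
  constructor
  · by_cases ht : ∃ u, t < u
    · obtain ⟨u, hu⟩ := ht
      refine Metric.tendsto_nhds.2 fun δ hδ => ?_
      have h1 := Metric.tendsto_nhds.1 (hr t u hu) (δ / 2) (half_pos hδ)
      rw [nhdsWithin_inter', eventually_inf_principal] at h1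
      obtain ⟨v, hv, hvs⟩ := (mem_nhdsGT_iff_exists_Ioo_subset' hu).1 h1
      filter_upwards [Ioo_mem_nhdsGT hv] with s hs
      refine (key hs.2 fun p hp => ?_).trans_lt (half_lt_self hδ)
      exact (hvs ⟨hs.1.trans hp.1.1, hp.1.2⟩ hp.2).le
    · push Not at ht
      have : Set.Ioi t = ∅ := Set.eq_empty_of_forall_notMem fun u hu => absurd hu (not_lt.2 (ht u))
      rw [this]
      simp [ContinuousWithinAt]
  · by_cases ht : ∃ u, u < t
    · obtain ⟨u, hu⟩ := ht
      obtain ⟨l, hl⟩ := hl t u hu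
      refine ⟨l, Metric.tendsto_nhds.2 fun δ hδ => ?_⟩
      have h1 := Metric.tendsto_nhds.1 hl (δ / 2) (half_pos hδ)
      rw [nhdsWithin_inter', eventually_inf_principal] at h1
      obtain ⟨v, hv, hvs⟩ := (mem_nhdsLT_iff_exists_Ioo_subset' hu).1 h1
      filter_upwards [Ioo_mem_nhdsLT hv] with s hs
      refine (key hs.2 fun p hp => ?_).trans_lt (half_lt_self hδ)
      exact (hvs ⟨hs.1.trans hp.1.1, hp.1.2⟩ hp.2).le
    · push Not at ht
      have : Set.Iio t = ∅ := Set.eq_empty_of_forall_notMem fun u hu => absurd hu (not_lt.2 (ht u))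
      rw [this, nhdsWithin_empty]
      exact ⟨0, tendsto_bot⟩

end RightLimits

/-! ### One-sided limits along the dyadic points -/

section Dyadic

variable {T : ℝ≥0} {V : Type*} [NormedAddCommGroup V]

/-- The dyadic points of `[0, T]`. -/
def dyadic (T : ℝ≥0) : Set (Set.Iic T) := {p | ∃ n, ∃ k ≤ 2 ^ n, p = gridPt T n k}

theorem nonempty_Ioo_inter_dyadic (hT : 0 < T) (a b : Set.Iic T) (hab : a < b) :
    (Set.Ioo a b ∩ dyadic T).Nonempty := by
  have hab' : (a : ℝ≥0) < b := hab
  obtain ⟨m, ham, hmb⟩ := exists_between hab'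
  let m' : Set.Iic T := ⟨m, hmb.le.trans b.2⟩
  have h1 : Tendsto (fun n : ℕ => m + T / 2 ^ n) atTop (𝓝 m) := by
    have h2 := (NNReal.tendsto_pow_atTop_nhds_zero_of_lt_one (r := 1 / 2)
      (by rw [← NNReal.coe_lt_coe]; norm_num)).const_mul T |>.const_add m
    simpa [div_eq_mul_inv] using h2
  obtain ⟨n, hn⟩ := (h1.eventually (gt_mem_nhds hmb)).exists
  refine ⟨gridPt T n (ceilIdx n m'), ⟨?_, ?_⟩, n, _, ceilIdx_le n m', rfl⟩
  · exact lt_of_lt_of_le (show a < m' from ham) (le_gridPt_ceilIdx hT n m')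
  · exact Subtype.coe_lt_coe.1 ((gridPt_ceilIdx_le hT n m').trans_lt hn)

theorem eventually_exists_eq_gridPt {p : Set.Iic T} (hp : p ∈ dyadic T) :
    ∃ n₀, ∀ n ≥ n₀, ∃ k, p = gridPt T n k := by
  obtain ⟨n₀, k, -, rfl⟩ := hp
  refine ⟨n₀, fun n hn => ?_⟩
  obtain ⟨m, rfl⟩ := Nat.exists_eq_add_of_le hn
  exact ⟨2 ^ m * k, (gridPt_add_mul_two_pow n₀ m k).symm⟩

/-- On all sufficiently fine grids, the anchor has moved at least `K` times until `u`. -/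
def MovesBefore (f : Set.Iic T → V) (ε : ℝ) (K : ℕ) (u : Set.Iic T) : Prop :=
  ∃ n₀, ∀ n ≥ n₀, ∀ j, u ≤ gridPt T n j → K ≤ moves ε (fun k => f (gridPt T n k)) j

variable {f : Set.Iic T → V} {ε : ℝ} {K : ℕ}

/-- A pair of dyadic points with a large increment contributes one more move. -/
theorem MovesBefore.succ (hε : 0 < ε) {u p q u' : Set.Iic T} (h : MovesBefore f ε K u)
    (hup : u ≤ p) (hpq : p < q) (hqu : q < u') (hp : p ∈ dyadic T) (hq : q ∈ dyadic T)
    (hf : 2 * ε ≤ ‖f q - f p‖) : MovesBefore f ε (K + 1) u' := by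
  obtain ⟨n₀, h⟩ := h
  obtain ⟨n₁, h₁⟩ := eventually_exists_eq_gridPt hp
  obtain ⟨n₂, h₂⟩ := eventually_exists_eq_gridPt hq
  refine ⟨max n₀ (max n₁ n₂), fun n hn j hj => ?_⟩
  obtain ⟨k₁, rfl⟩ := h₁ n (by omega)
  obtain ⟨k₂, rfl⟩ := h₂ n (by omega)
  have h12 : k₁ < k₂ := (gridPt_mono n).reflect_lt hpq
  have h2j : k₂ < j := (gridPt_mono n).reflect_lt (hqu.trans_le hj)
  have h3 := h n (by omega) k₁ hup
  have h4 := moves_lt_of_two_mul_le (y := fun k => f (gridPt T n k)) hε h12.le hf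
  have h5 := moves_mono (ε := ε) (y := fun k => f (gridPt T n k)) h2j.le
  omega

/-- The path `f` oscillates finitely often along the dyadic points: for every `ε`, the number of
moves of the anchor does not tend to infinity as the grid is refined. -/
def FinitelyOscillating (f : Set.Iic T → V) : Prop :=
  ∀ m : ℕ, ∃ R : ℕ, ∃ᶠ n in atTop,
    moves (1 / ((m : ℝ) + 1)) (fun k => f (gridPt T n k)) (2 ^ n) ≤ R

theorem FinitelyOscillating.exists_not_movesBefore (h : FinitelyOscillating f) (m : ℕ) :
    ∃ K, ∀ u, ¬ MovesBefore f (1 / ((m : ℝ) + 1)) K u := by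
  obtain ⟨R, hR⟩ := h m
  refine ⟨R + 1, fun u ⟨n₀, hu⟩ => ?_⟩
  obtain ⟨n, hn, hn₀⟩ := (hR.and_eventually (eventually_ge_atTop n₀)).exists
  have := hu n hn₀ (2 ^ n) (Subtype.coe_le_coe.1 (by rw [coe_gridPt_last]; exact u.2))
  omega

theorem exists_tendsto_of_forall_norm_sub_lt [CompleteSpace V] {l : Filter (Set.Iic T)} [l.NeBot]
    (h : ∀ m : ℕ, ∃ s ∈ l, ∀ p ∈ s, ∀ q ∈ s, p < q → ‖f q - f p‖ < 2 * (1 / ((m : ℝ) + 1))) :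
    ∃ x, Tendsto f l (𝓝 x) := by
  refine CompleteSpace.complete (Metric.cauchy_iff.2 ⟨inferInstance, fun δ hδ => ?_⟩)
  obtain ⟨m, hm⟩ := exists_nat_one_div_lt (half_pos hδ)
  obtain ⟨s, hs, hsf⟩ := h m
  refine ⟨f '' s, image_mem_map hs, ?_⟩
  rintro _ ⟨p, hp, rfl⟩ _ ⟨q, hq, rfl⟩
  rcases lt_trichotomy p q with hpq | rfl | hpq
  · rw [dist_comm, dist_eq_norm]
    exact (hsf p hp q hq hpq).trans_le (by linarith)
  · simpa using hδ
  · rw [dist_eq_norm]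
    exact (hsf q hq p hp hpq).trans_le (by linarith)

/-- Otherwise there are pairs of dyadic points with increment at least `2ε` in every interval `(t,
v)`, and arbitrarily many of them can be arranged one before the other, approaching `t`. -/
theorem FinitelyOscillating.exists_tendsto_right [CompleteSpace V] (hT : 0 < T)
    (h : FinitelyOscillating f) {t u : Set.Iic T} (htu : t < u) :
    ∃ x, Tendsto f (𝓝[Set.Ioi t ∩ dyadic T] t) (𝓝 x) := by
  have := neBot_nhdsWithin_Ioi_inter (nonempty_Ioo_inter_dyadic hT) htu
  refine exists_tendsto_of_forall_norm_sub_lt fun m => ?_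
  by_contra! hc
  have hpair : ∀ v, t < v → ∃ p ∈ dyadic T, ∃ q ∈ dyadic T, t < p ∧ p < q ∧ q < v ∧
      2 * (1 / ((m : ℝ) + 1)) ≤ ‖f q - f p‖ := fun v hv => by
    obtain ⟨p, hp, q, hq, hpq, hf⟩ := hc (Set.Ioo t v ∩ dyadic T) (by
      rw [nhdsWithin_inter']
      exact inter_mem_inf (Ioo_mem_nhdsGT hv) (mem_principal_self _))
    exact ⟨p, hp.2, q, hq.2, hp.1.1, hpq, hq.1.2, hf⟩
  have hall : ∀ K v, t < v → MovesBefore f (1 / ((m : ℝ) + 1)) K v := fun K => by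
    induction K with
    | zero => exact fun v _ => ⟨0, fun _ _ _ _ => Nat.zero_le _⟩
    | succ K ih =>
      intro v hv
      obtain ⟨p, hp, q, hq, htp, hpq, hqv, hf⟩ := hpair v hv
      exact (ih p htp).succ (by positivity) le_rfl hpq hqv hp hq hf
  obtain ⟨K, hK⟩ := h.exists_not_movesBefore m
  exact hK u (hall K u htu)

/-- Otherwise there are pairs of dyadic points with increment at least `2ε` in every interval `(v,
t)`, and arbitrarily many of them can be arranged one after the other, approaching `t`. -/
theorem FinitelyOscillating.exists_tendsto_left [CompleteSpace V] (hT : 0 < T)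
    (h : FinitelyOscillating f) {t u : Set.Iic T} (hut : u < t) :
    ∃ x, Tendsto f (𝓝[Set.Iio t ∩ dyadic T] t) (𝓝 x) := by
  have := neBot_nhdsWithin_Iio_inter (nonempty_Ioo_inter_dyadic hT) hut
  refine exists_tendsto_of_forall_norm_sub_lt fun m => ?_
  by_contra! hc
  have hpair : ∀ v, v < t → ∃ p ∈ dyadic T, ∃ q ∈ dyadic T, v < p ∧ p < q ∧ q < t ∧
      2 * (1 / ((m : ℝ) + 1)) ≤ ‖f q - f p‖ := fun v hv => by
    obtain ⟨p, hp, q, hq, hpq, hf⟩ := hc (Set.Ioo v t ∩ dyadic T) (by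
      rw [nhdsWithin_inter']
      exact inter_mem_inf (Ioo_mem_nhdsLT hv) (mem_principal_self _))
    exact ⟨p, hp.2, q, hq.2, hp.1.1, hpq, hq.1.2, hf⟩
  have hall : ∀ K, ∃ v, v < t ∧ MovesBefore f (1 / ((m : ℝ) + 1)) K v := fun K => by
    induction K with
    | zero => exact ⟨u, hut, 0, fun _ _ _ _ => Nat.zero_le _⟩
    | succ K ih =>
      obtain ⟨v, hv, hK⟩ := ih
      obtain ⟨p, hp, q, hq, htp, hpq, hqt, hf⟩ := hpair v hv
      obtain ⟨w, ⟨hqw, hwt⟩, -⟩ := nonempty_Ioo_inter_dyadic hT q t hqt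
      exact ⟨w, hwt, hK.succ (by positivity) htp.le hpq hqw hp hq hf⟩
  obtain ⟨K, hK⟩ := h.exists_not_movesBefore m
  obtain ⟨v, -, hv⟩ := hall K
  exact hK v hv

end Dyadic

/-! ### Càdlàg modifications -/

section Regularization

variable {Ω : Type*} [mΩ : MeasurableSpace Ω] {P : Measure Ω} [IsProbabilityMeasure P]
  {V : Type*} [NormedAddCommGroup V] [InnerProductSpace ℝ V] {T : ℝ≥0}

/-- A square integrable adapted process whose increments are controlled by the increments of two
functions `A` and `B`: the second moments by those of `A`, the conditional means by those of `B`. -/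
structure HasControlledIncrements (P : Measure Ω) (𝓕 : Filtration (Set.Iic T) mΩ)
    (Y : Set.Iic T → Ω → V) (A B : Set.Iic T → ℝ) : Prop where
  adapted : StronglyAdapted 𝓕 Y
  memLp : ∀ t, MemLp (Y t) 2 P
  sq_le : ∀ s t, s ≤ t → ∫ ω, ‖Y t ω - Y s ω‖ ^ 2 ∂P ≤ A t - A s
  drift_le : ∀ s t, s ≤ t → ∀ (c : ℝ) (W : Ω → V), 0 ≤ c → StronglyMeasurable[𝓕 s] W →
    (∀ ω, ‖W ω‖ ≤ c) → |∫ ω, inner ℝ (W ω) (Y t ω - Y s ω) ∂P| ≤ c * (B t - B s)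

variable {𝓕 : Filtration (Set.Iic T) mΩ} {Y : Set.Iic T → Ω → V} {A B : Set.Iic T → ℝ} {ε : ℝ}

omit [InnerProductSpace ℝ V] in
theorem stronglyMeasurable_anchor (hY : StronglyAdapted 𝓕 Y) (ε : ℝ) (n k : ℕ) :
    StronglyMeasurable[𝓕 (gridPt T n k)] fun ω => anchor ε (fun k => Y (gridPt T n k) ω) k := by
  induction k with
  | zero => exact hY _
  | succ k ih =>
    have h1 := ih.mono (𝓕.mono (gridPt_mono n k.le_succ))
    simp only [anchor]
    refine StronglyMeasurable.ite ?_ (hY _) h1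
    exact measurableSet_le stronglyMeasurable_const.measurable
      ((hY (gridPt T n (k + 1))).sub h1).norm.measurable

omit [InnerProductSpace ℝ V] in
theorem measurable_moves (hY : StronglyAdapted 𝓕 Y) (ε : ℝ) (n k : ℕ) :
    Measurable fun ω => moves ε (fun k => Y (gridPt T n k) ω) k := by
  induction k with
  | zero => exact measurable_const
  | succ k ih =>
    simp only [moves]
    refine Measurable.ite ?_ (ih.add_const 1) ih
    exact measurableSet_le measurable_const
      (((hY _).mono (𝓕.le _)).sub ((stronglyMeasurable_anchor hY ε n k).mono
        (𝓕.le _))).norm.measurable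

theorem HasControlledIncrements.integral_moves_le (h : HasControlledIncrements P 𝓕 Y A B)
    (hε : 0 < ε) (n N : ℕ) :
    ∫ ω, ε ^ 2 * moves ε (fun k => Y (gridPt T n k) ω) N ∂P ≤
      (A (gridPt T n N) - A ⊥) + 2 * (ε * (B (gridPt T n N) - B ⊥)) := by
  have hW : ∀ k, StronglyMeasurable[𝓕 (gridPt T n k)] fun ω =>
      Y (gridPt T n k) ω - anchor ε (fun k => Y (gridPt T n k) ω) k := fun k =>
    (h.adapted _).sub (stronglyMeasurable_anchor h.adapted ε n k)
  have hWb : ∀ k ω, ‖Y (gridPt T n k) ω - anchor ε (fun k => Y (gridPt T n k) ω) k‖ ≤ ε :=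
    fun k ω => (norm_sub_anchor_lt (y := fun k => Y (gridPt T n k) ω) hε k).le
  have hΔ : ∀ k, MemLp (fun ω => Y (gridPt T n (k + 1)) ω - Y (gridPt T n k) ω) 2 P := fun k =>
    (h.memLp _).sub (h.memLp _)
  have hsq : ∀ k, Integrable (fun ω => ‖Y (gridPt T n (k + 1)) ω - Y (gridPt T n k) ω‖ ^ 2) P :=
    fun k => (hΔ k).integrable_norm_pow two_ne_zero
  have hin : ∀ k, Integrable (fun ω => 2 * inner ℝ
      (Y (gridPt T n k) ω - anchor ε (fun k => Y (gridPt T n k) ω) k)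
      (Y (gridPt T n (k + 1)) ω - Y (gridPt T n k) ω)) P := fun k =>
    (integrable_inner (memLp_of_norm_le (𝓕.le _) (hW k) (hWb k)) (hΔ k)).const_mul 2
  have hm : Integrable (fun ω => ε ^ 2 * (moves ε (fun k => Y (gridPt T n k) ω) N : ℝ)) P := by
    refine Integrable.const_mul (Integrable.of_bound (C := N) ?_
      (Eventually.of_forall fun ω => ?_)) _
    · exact (measurable_from_nat.comp (measurable_moves h.adapted ε n N)).aestronglyMeasurable
    · rw [Real.norm_natCast]
      exact_mod_cast moves_le N
  calc _ ≤ ∫ ω, ∑ k ∈ Finset.range N, (‖Y (gridPt T n (k + 1)) ω - Y (gridPt T n k) ω‖ ^ 2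
        + 2 * inner ℝ (Y (gridPt T n k) ω - anchor ε (fun k => Y (gridPt T n k) ω) k)
          (Y (gridPt T n (k + 1)) ω - Y (gridPt T n k) ω)) ∂P :=
        integral_mono hm (integrable_finsetSum _ fun k _ => (hsq k).add (hin k)) fun ω =>
          sq_mul_moves_le (y := fun k => Y (gridPt T n k) ω) hε.le N
    _ = ∑ k ∈ Finset.range N, (∫ ω, ‖Y (gridPt T n (k + 1)) ω - Y (gridPt T n k) ω‖ ^ 2 ∂P
        + 2 * ∫ ω, inner ℝ (Y (gridPt T n k) ω - anchor ε (fun k => Y (gridPt T n k) ω) k)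
          (Y (gridPt T n (k + 1)) ω - Y (gridPt T n k) ω) ∂P) := by
        refine (integral_finsetSum _ fun k _ => (hsq k).add (hin k)).trans ?_
        refine Finset.sum_congr rfl fun k _ => ?_
        rw [← integral_const_mul]
        exact integral_add (hsq k) (hin k)
    _ ≤ ∑ k ∈ Finset.range N, ((A (gridPt T n (k + 1)) - A (gridPt T n k))
        + 2 * (ε * (B (gridPt T n (k + 1)) - B (gridPt T n k)))) := by
        refine Finset.sum_le_sum fun k _ => add_le_add (h.sq_le _ _ (gridPt_mono n k.le_succ)) ?_
        refine mul_le_mul_of_nonneg_left ((le_abs_self _).trans ?_) two_pos.le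
        exact h.drift_le _ _ (gridPt_mono n k.le_succ) ε _ hε.le (hW k) (hWb k)
    _ = _ := by
        rw [Finset.sum_add_distrib, ← Finset.mul_sum, ← Finset.mul_sum,
          Finset.sum_range_sub (fun k => A (gridPt T n k)),
          Finset.sum_range_sub (fun k => B (gridPt T n k)), gridPt_zero]

/-- Almost all paths oscillate finitely often, by Fatou's lemma: the bound of the expected number of
moves does not depend on the grid. -/
theorem HasControlledIncrements.ae_finitelyOscillating (h : HasControlledIncrements P 𝓕 Y A B) :
    ∀ᵐ ω ∂P, FinitelyOscillating fun t => Y t ω := by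
  refine ae_all_iff.2 fun m => ?_
  set ε : ℝ := 1 / ((m : ℝ) + 1) with hεd
  have hε : 0 < ε := by positivity
  let F : ℕ → Ω → ℝ≥0∞ := fun n ω =>
    ENNReal.ofReal (ε ^ 2 * moves ε (fun k => Y (gridPt T n k) ω) (2 ^ n))
  set M : ℝ := (A ⊤ - A ⊥) + 2 * (ε * (B ⊤ - B ⊥)) with hM
  have hFm : ∀ n, Measurable (F n) := fun n =>
    ((measurable_from_nat.comp (measurable_moves h.adapted ε n (2 ^ n))).const_mul
      (ε ^ 2)).ennreal_ofReal
  have hF : ∀ n, ∫⁻ ω, F n ω ∂P ≤ ENNReal.ofReal M := fun n => by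
    have hlast : gridPt T n (2 ^ n) = ⊤ := Subtype.ext (coe_gridPt_last n)
    have h1 := h.integral_moves_le hε n (2 ^ n)
    rw [hlast] at h1
    rw [← ofReal_integral_eq_lintegral_ofReal _ (Eventually.of_forall fun ω => by positivity)]
    · exact ENNReal.ofReal_le_ofReal h1
    · refine Integrable.const_mul (Integrable.of_bound (C := (2 ^ n : ℕ)) ?_
        (Eventually.of_forall fun ω => ?_)) _
      · exact (measurable_from_nat.comp
          (measurable_moves h.adapted ε n (2 ^ n))).aestronglyMeasurable
      · rw [Real.norm_natCast]
        exact_mod_cast moves_le (2 ^ n)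
  have hlim : ∫⁻ ω, liminf (fun n => F n ω) atTop ∂P < ∞ := by
    refine (lintegral_liminf_le hFm).trans_lt (lt_of_le_of_lt (b := ENNReal.ofReal M) ?_
      ENNReal.ofReal_lt_top)
    exact liminf_le_of_le (by isBoundedDefault) fun b hb => by
      obtain ⟨n, hn⟩ := hb.exists
      exact hn.trans (hF n)
  filter_upwards [ae_lt_top (Measurable.liminf hFm) hlim.ne] with ω hω
  obtain ⟨R, hR⟩ := exists_nat_gt ((liminf (fun n => F n ω) atTop).toReal / ε ^ 2)
  refine ⟨R, ?_⟩
  have h2 : liminf (fun n => F n ω) atTop < ENNReal.ofReal (ε ^ 2 * R) := by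
    rw [ENNReal.lt_ofReal_iff_toReal_lt hω.ne, mul_comm]
    exact (div_lt_iff₀ (by positivity)).1 hR
  refine (frequently_lt_of_liminf_lt (by isBoundedDefault) h2).mono fun n hn => ?_
  have h3 := (ENNReal.ofReal_lt_ofReal_iff_of_nonneg (by positivity)).1 hn
  have h4 : (moves ε (fun k => Y (gridPt T n k) ω) (2 ^ n) : ℝ) < R :=
    lt_of_mul_lt_mul_left h3 (by positivity)
  exact_mod_cast h4.le

/-- A process with controlled increments has a càdlàg modification, if the second moments of the
increments are controlled by a right-continuous function. -/
theorem HasControlledIncrements.exists_isCadlag [CompleteSpace V]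
    (h : HasControlledIncrements P 𝓕 Y A B) (hT : 0 < T)
    (hA : ∀ t, ContinuousWithinAt A (Set.Ioi t) t) :
    ∃ I : Set.Iic T → Ω → V, (∀ ω, IsCadlag fun t => I t ω) ∧ ∀ t, I t =ᵐ[P] Y t := by
  classical
  have hD := nonempty_Ioo_inter_dyadic hT
  -- the right limit along the dyadic points for good paths, the path `0` for the others
  have hex : ∀ (ω : Ω) (t : Set.Iic T), ∃ x : V, (FinitelyOscillating (fun t => Y t ω) →
      (∀ u, t < u → Tendsto (fun t => Y t ω) (𝓝[Set.Ioi t ∩ dyadic T] t) (𝓝 x)) ∧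
      (t = ⊤ → x = Y t ω)) ∧ (¬ FinitelyOscillating (fun t => Y t ω) → x = 0) := fun ω t => by
    by_cases hω : FinitelyOscillating fun t => Y t ω
    · by_cases ht : t = ⊤
      · refine ⟨Y t ω, fun _ => ⟨fun u hu => ?_, fun _ => rfl⟩, fun h => absurd hω h⟩
        exact absurd hu (ht ▸ not_top_lt)
      · obtain ⟨x, hx⟩ := hω.exists_tendsto_right hT (lt_top_iff_ne_top.2 ht)
        exact ⟨x, fun _ => ⟨fun _ _ => hx, fun h => absurd h ht⟩, fun h => absurd hω h⟩
    · exact ⟨0, fun h => absurd h hω, fun _ => rfl⟩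
  choose I hI hI0 using hex
  refine ⟨fun t ω => I ω t, fun ω => ?_, fun t => ?_⟩
  · by_cases hω : FinitelyOscillating fun t => Y t ω
    · exact isCadlag_of_tendsto hD (fun t u htu => (hI ω t hω).1 u htu)
        fun t u hut => hω.exists_tendsto_left hT hut
    · have : (fun t => I ω t) = fun _ => 0 := funext fun t => hI0 ω t hω
      rw [this]
      exact fun t => ⟨continuousWithinAt_const, 0, tendsto_const_nhds⟩
  · by_cases ht : t = ⊤
    · filter_upwards [h.ae_finitelyOscillating] with ω hω
      exact (hI ω t hω).2 ht
    · have htu := lt_top_iff_ne_top.2 ht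
      have := neBot_nhdsWithin_Ioi_inter hD htu
      obtain ⟨p, hp⟩ := exists_seq_tendsto (𝓝[Set.Ioi t ∩ dyadic T] t)
      have hpt : ∀ᶠ n in atTop, t ≤ p n := by
        filter_upwards [hp.eventually self_mem_nhdsWithin] with n hn
        exact le_of_lt hn.1
      have hAp : Tendsto (fun n => A (p n) - A t) atTop (𝓝 0) := by
        have h1 := ((hA t).tendsto.comp (hp.mono_right
          (nhdsWithin_mono t Set.inter_subset_left))).sub_const (A t)
        rwa [sub_self] at h1
      -- along a dyadic sequence, `Y` tends to `Y t` in `L²` and to `I · t` on almost every path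
      have hL2 : Tendsto (fun n => eLpNorm (Y (p n) - Y t) 2 P) atTop (𝓝 0) := by
        have h2 : Tendsto (fun n => ENNReal.ofReal (√(A (p n) - A t))) atTop (𝓝 0) := by
          simpa using ENNReal.tendsto_ofReal hAp.sqrt
        refine tendsto_of_tendsto_of_tendsto_of_le_of_le' tendsto_const_nhds h2
          (Eventually.of_forall fun _ => bot_le) ?_
        filter_upwards [hpt] with n hn
        have h3 := h.sq_le t (p n) hn
        have h4 : 0 ≤ ∫ ω, ‖Y (p n) ω - Y t ω‖ ^ 2 ∂P := integral_nonneg fun ω => by positivity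
        rw [← ENNReal.pow_le_pow_left_iff two_ne_zero,
          sq_eLpNorm_eq_ofReal ((h.memLp (p n)).sub (h.memLp t)),
          ← ENNReal.ofReal_pow (Real.sqrt_nonneg _), Real.sq_sqrt (h4.trans h3)]
        exact ENNReal.ofReal_le_ofReal h3
      obtain ⟨ns, hns, hae⟩ := (tendstoInMeasure_of_tendsto_eLpNorm two_ne_zero
        (fun n => (h.memLp (p n)).1) (h.memLp t).1 hL2).exists_seq_tendsto_ae
      filter_upwards [h.ae_finitelyOscillating, hae] with ω hω hω'
      exact tendsto_nhds_unique
        ((((hI ω t hω).1 ⊤ htu).comp hp).comp hns.tendsto_atTop) hω'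

end Regularization

/-! ### Regularity of the integral process -/

section IntegralProcess

variable {Ω : Type*} [mΩ : MeasurableSpace Ω] {P : Measure Ω} {T : ℝ≥0}

theorem setIntegral_Ioc_prod_sub {h : Set.Iic T × Ω → ℝ}
    (hh : Integrable h ((timeMeasure T).prod P)) {s t : Set.Iic T} (hst : s ≤ t) :
    ∫ p in Set.Ioc s t ×ˢ (Set.univ : Set Ω), h p ∂(timeMeasure T).prod P
      = ∫ p in Set.Ioc ⊥ t ×ˢ (Set.univ : Set Ω), h p ∂(timeMeasure T).prod P
        - ∫ p in Set.Ioc ⊥ s ×ˢ (Set.univ : Set Ω), h p ∂(timeMeasure T).prod P := by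
  rw [eq_sub_iff_add_eq', ← setIntegral_union _ (measurableSet_Ioc_prod_univ s t)
    hh.integrableOn hh.integrableOn, ← Set.union_prod, Set.Ioc_union_Ioc_eq_Ioc bot_le hst]
  rw [Set.disjoint_prod]
  refine Or.inl (Set.disjoint_left.2 fun x hx hx' => absurd hx.2 (not_le.2 hx'.1))

theorem continuousWithinAt_setIntegral_Ioc_prod {h : Set.Iic T × Ω → ℝ}
    (hh : Integrable h ((timeMeasure T).prod P)) (t : Set.Iic T) :
    ContinuousWithinAt (fun t => ∫ p in Set.Ioc ⊥ t ×ˢ (Set.univ : Set Ω), h p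
      ∂(timeMeasure T).prod P) (Set.Ioi t) t := by
  have e : ∀ t : Set.Iic T, ∫ p in Set.Ioc ⊥ t ×ˢ (Set.univ : Set Ω), h p ∂(timeMeasure T).prod P
      = ∫ p, (Set.Ioc ⊥ t ×ˢ (Set.univ : Set Ω)).indicator h p ∂(timeMeasure T).prod P := fun t =>
    (integral_indicator (measurableSet_Ioc_prod_univ ⊥ t)).symm
  simp_rw [ContinuousWithinAt, e]
  refine tendsto_integral_filter_of_dominated_convergence (fun p => ‖h p‖)
    (Eventually.of_forall fun s => hh.1.indicator (measurableSet_Ioc_prod_univ ⊥ s))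
    (Eventually.of_forall fun s => Eventually.of_forall fun p => norm_indicator_le_norm_self _ _)
    hh.norm (Eventually.of_forall fun p => tendsto_nhds_of_eventually_eq ?_)
  classical
  by_cases hp : p.1 ≤ t
  · filter_upwards [self_mem_nhdsWithin] with s hs
    have h1 : p.1 ≤ s := hp.trans (le_of_lt hs)
    by_cases hb : ⊥ < p.1 <;> simp [Set.indicator, hp, h1, hb]
  · filter_upwards [Ioo_mem_nhdsGT (not_le.1 hp)] with s hs
    simp [Set.indicator, hp, hs.2]

variable [IsProbabilityMeasure P]
  {V : Type*} [NormedAddCommGroup V] [InnerProductSpace ℝ V] [CompleteSpace V]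

/-- Without drift, the process is a martingale: test its increments with `1_G v` for `G ∈ F_s`. -/
theorem HasControlledIncrements.martingale {𝓕 : Filtration (Set.Iic T) mΩ}
    {Y : Set.Iic T → Ω → V} {A B : Set.Iic T → ℝ} (h : HasControlledIncrements P 𝓕 Y A B)
    (hB : B = 0) :
    Martingale Y 𝓕 P := by
  have hY : ∀ t, Integrable (Y t) P := fun t => (h.memLp t).integrable one_le_two
  refine ⟨h.adapted, fun s t hst => ?_⟩
  refine (ae_eq_condExp_of_forall_setIntegral_eq (𝓕.le s) (hY t) (fun _ _ _ => (hY s).integrableOn)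
    (fun G hG _ => ?_) (h.adapted s).aestronglyMeasurable).symm
  have hG' := 𝓕.le s _ hG
  rw [eq_comm, ← sub_eq_zero, ← integral_sub (hY t).integrableOn (hY s).integrableOn]
  refine ext_inner_left ℝ fun v => ?_
  have hi : Integrable (fun ω => Y t ω - Y s ω) (P.restrict G) :=
    ((hY t).sub (hY s)).integrableOn
  rw [inner_zero_right, ← integral_inner hi]
  have h1 := h.drift_le s t hst ‖v‖ (G.indicator fun _ => v) (norm_nonneg _)
    (stronglyMeasurable_const.indicator hG) fun ω => norm_indicator_le_norm_self _ _
  simp only [hB, Pi.zero_apply, sub_self, mul_zero] at h1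
  have h2 := abs_nonpos_iff.1 h1
  rw [← integral_indicator hG', ← h2]
  congr 1
  ext1 ω
  classical
  by_cases hω : ω ∈ G <;> simp [hω]

variable [TopologicalSpace.SeparableSpace V] [P.IsComplete]
  {U : Type*} [NormedAddCommGroup U] [InnerProductSpace ℝ U] [CompleteSpace U]
  {L : ℝ≥0 → U →ₗ[ℝ] (Ω →ₘ[P] ℝ)}
  {hL : IsCylindricalLevy P L} {hL2 : HasWeakSecondMoments P L} {K₁ K₂ : ℝ}

omit [CompleteSpace V] [TopologicalSpace.SeparableSpace V] [P.IsComplete] in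
theorem IsIntegrand.memLp {Ψ : Set.Iic T → Ω → HilbertSchmidt U V} (h : IsIntegrand P L T Ψ) :
    MemLp (Function.uncurry Ψ) 2 ((timeMeasure T).prod P) := by
  have hm : AEStronglyMeasurable (Function.uncurry Ψ) ((timeMeasure T).prod P) :=
    (h.1.mono (predictable_le _)).aestronglyMeasurable
  refine ⟨hm, ?_⟩
  have h1 : eLpNorm (Function.uncurry Ψ) 2 ((timeMeasure T).prod P) ^ 2 < ∞ := by
    rw [sq_eLpNorm_two, lintegral_prod_symm _ (hm.enorm.pow_const 2)]
    exact h.2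
  exact (ENNReal.pow_lt_top_iff.1 h1).resolve_right two_ne_zero

omit [IsProbabilityMeasure P] [CompleteSpace V] [TopologicalSpace.SeparableSpace V]
  [P.IsComplete] in
theorem IsIntegrand.indicator_Iic {Ψ : Set.Iic T → Ω → HilbertSchmidt U V}
    (h : IsIntegrand P L T Ψ) (t : Set.Iic T) :
    IsIntegrand P L T fun s ω => (Set.Iic t).indicator (fun r => Ψ r ω) s := by
  classical
  refine ⟨?_, lt_of_le_of_lt (lintegral_mono fun ω => lintegral_mono fun s => ?_) h.2⟩
  · have hI : MeasurableSet[(cylFiltrationOn P L T).predictable]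
        (Set.Iic t ×ˢ (Set.univ : Set Ω)) := by
      have h1 := measurableSet_predictable_Ioi_prod (𝓕 := cylFiltrationOn P L T) (i := t)
        (s := Set.univ) MeasurableSet.univ
      have h2 : Set.Iic t ×ˢ (Set.univ : Set Ω) = (Set.Ioi t ×ˢ Set.univ)ᶜ := by
        ext p; simp
      rw [h2]
      exact h1.compl
    have h3 := StronglyMeasurable.indicator h.1 hI
    have e : Function.uncurry (fun s ω => (Set.Iic t).indicator (fun r => Ψ r ω) s)
        = (Set.Iic t ×ˢ (Set.univ : Set Ω)).indicator (Function.uncurry Ψ) := by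
      ext1 ⟨s, ω⟩
      by_cases hs : s ≤ t <;> simp [Set.indicator, hs]
    rw [IsStronglyPredictable, e]
    exact h3
  · gcongr
    exact enorm_indicator_le_enorm_self _ _

/-- The integral process `Y(t) = ∫_0^t g dL` has controlled increments: the boundedness of the
integral operator gives the bound of the second moments, and the drift bound that of the conditional
means. -/
theorem IsItoIntegral.exists_hasControlledIncrements (hB : IncrementBounds hL hL2 T K₁ K₂)
    (hT : 0 < T) {g : Set.Iic T × Ω → HilbertSchmidt U V} {Y₀ : Ω → V}
    (h : IsItoIntegral hL hL2 T g Y₀) :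
    ∃ Y : Set.Iic T → Ω → V,
      (∀ t, IsItoIntegral hL hL2 T ((Set.Ioc ⊥ t ×ˢ Set.univ).indicator g) (Y t)) ∧
      HasControlledIncrements P (cylFiltrationOn P L T) Y
        (fun t => itoConst K₁ K₂ T ^ 2 *
          ∫ p in Set.Ioc ⊥ t ×ˢ (Set.univ : Set Ω), ‖g p‖ ^ 2 ∂(timeMeasure T).prod P)
        (fun t => K₂ * ∫ p in Set.Ioc ⊥ t ×ˢ (Set.univ : Set Ω), ‖g p‖
          ∂(timeMeasure T).prod P) := by
  have : SecondCountableTopology V := UniformSpace.secondCountable_of_separable V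
  have hC : 0 ≤ itoConst K₁ K₂ T := Real.sqrt_nonneg _
  choose Y hY using fun t : Set.Iic T => h.exists_isIntegralOver (s := ⊥) (t := t) hB hT
  have hincr : ∀ s t : Set.Iic T, s ≤ t →
      IsItoIntegral hL hL2 T ((Set.Ioc s t ×ˢ Set.univ).indicator g) (Y t - Y s) :=
    fun s t hst => by
      have h1 := (hY t).isItoIntegral.sub hB (hY s).isItoIntegral
      convert h1 using 1
      have hd : Disjoint (Set.Ioc ⊥ s ×ˢ (Set.univ : Set Ω)) (Set.Ioc s t ×ˢ Set.univ) :=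
        Set.disjoint_prod.2 (Or.inl
          (Set.disjoint_left.2 fun x hx hx' => absurd hx.2 (not_le.2 hx'.1)))
      rw [eq_sub_iff_add_eq', ← Set.Ioc_union_Ioc_eq_Ioc bot_le hst, Set.union_prod]
      exact (Set.indicator_union_of_disjoint hd g).symm
  refine ⟨Y, fun t => (hY t).isItoIntegral, ?_, fun t => (hY t).isItoIntegral.2.1,
    fun s t hst => ?_, fun s t hst c W hc hW hWc => ?_⟩
  · exact fun t => stronglyMeasurable_cylFiltration (hY t).aestronglyMeasurable
  · have h1 := hincr s t hst
    have h2 := h1.eLpNorm_le hB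
    rw [← ENNReal.pow_le_pow_left_iff two_ne_zero, mul_pow, sq_eLpNorm_eq_ofReal h1.2.1,
      sq_eLpNorm_eq_ofReal h1.1, ← ENNReal.ofReal_pow hC, ← ENNReal.ofReal_mul (by positivity),
      ENNReal.ofReal_le_ofReal_iff (mul_nonneg (by positivity)
        (integral_nonneg fun p => by positivity))] at h2
    refine h2.trans_eq ?_
    rw [← mul_sub, ← setIntegral_Ioc_prod_sub (h.1.integrable_norm_pow two_ne_zero) hst,
      ← integral_indicator (measurableSet_Ioc_prod_univ s t)]
    congr 2
    ext1 p
    classical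
    by_cases hp : p ∈ Set.Ioc s t ×ˢ (Set.univ : Set Ω)
    · rw [Set.indicator_of_mem hp, Set.indicator_of_mem hp]
    · rw [Set.indicator_of_notMem hp, Set.indicator_of_notMem hp]
      simp
  · obtain ⟨Z, hZ⟩ := h.exists_isIntegralOver (s := s) (t := t) hB hT
    have h1 := hZ.drift c W hc hW hWc
    have h2 : ∫ ω, inner ℝ (W ω) (Y t ω - Y s ω) ∂P = ∫ ω, inner ℝ (W ω) (Z ω) ∂P := by
      refine integral_congr_ae ?_
      filter_upwards [(hincr s t hst).ae_eq hB hZ.isItoIntegral] with ω hω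
      rw [← hω, Pi.sub_apply]
    rw [h2, ← mul_sub, ← setIntegral_Ioc_prod_sub (h.1.integrable one_le_two).norm hst,
      ← integral_indicator (measurableSet_Ioc_prod_univ s t)]
    simp_rw [norm_indicator_eq_indicator_norm] at h1
    exact h1.trans_eq (by ring)

omit [CompleteSpace V] [TopologicalSpace.SeparableSpace V] [P.IsComplete] in
theorem uncurry_indicator_Iic_ae_eq (Ψ : Set.Iic T → Ω → HilbertSchmidt U V) (t : Set.Iic T) :
    (Set.Ioc ⊥ t ×ˢ (Set.univ : Set Ω)).indicator (Function.uncurry Ψ)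
      =ᵐ[(timeMeasure T).prod P]
      Function.uncurry fun s ω => (Set.Iic t).indicator (fun r => Ψ r ω) s := by
  classical
  have hnull : (timeMeasure T).prod P ({⊥} ×ˢ (Set.univ : Set Ω)) = 0 := by
    rw [Measure.prod_prod, timeMeasure_singleton, zero_mul]
  filter_upwards [measure_eq_zero_iff_ae_notMem.1 hnull] with ⟨s, ω⟩ hs
  have hs' : ⊥ < s := bot_lt_iff_ne_bot.2 fun h => hs ⟨h, trivial⟩
  by_cases hst : s ≤ t <;> simp [Set.indicator, hst, hs']

end IntegralProcess
end CylLevy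

theorem mainTheorem4
    {Ω : Type*} [mΩ : MeasurableSpace Ω] (P : Measure Ω) [IsProbabilityMeasure P] [P.IsComplete]
    {U : Type*} [NormedAddCommGroup U] [InnerProductSpace ℝ U] [CompleteSpace U]
    [TopologicalSpace.SeparableSpace U]
    {V : Type*} [NormedAddCommGroup V] [InnerProductSpace ℝ V] [CompleteSpace V]
    [TopologicalSpace.SeparableSpace V]
    (L : ℝ≥0 → U →ₗ[ℝ] (Ω →ₘ[P] ℝ))
    (hL : CylLevy.IsCylindricalLevy P L) (hL2 : CylLevy.HasWeakSecondMoments P L)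
    (T : ℝ≥0) (hT : 0 < T)
    (Ψ : Set.Iic T → Ω → CylLevy.HilbertSchmidt U V) (hΨ : CylLevy.IsIntegrand P L T Ψ) :
    ∃ I : Set.Iic T → Ω → V,
      StronglyAdapted (CylLevy.cylFiltrationOn P L T) I ∧
      (∀ t, MemLp (I t) 2 P) ∧
      (∀ ω, CylLevy.IsCadlag (fun t => I t ω)) ∧
      (∀ t, CylLevy.IsStochIntegralUpTo P L T Ψ t (I t)) ∧
      (CylLevy.IsCylindricalMartingale P L →
        Martingale I (CylLevy.cylFiltrationOn P L T) P) := by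
  have : SecondCountableTopology V := UniformSpace.secondCountable_of_separable V
  obtain ⟨K₁, K₂, hK₁, hK₂, hmart, hnoise⟩ := CylLevy.exists_isNoise_increment hL hL2 T
  have hB : CylLevy.IncrementBounds hL hL2 T K₁ K₂ := ⟨hK₁, hK₂, hnoise⟩
  obtain ⟨Y₀, hY₀⟩ := CylLevy.exists_isItoIntegral (V := V) hB hT hΨ.1 hΨ.memLp
  obtain ⟨Y, hYint, hY⟩ := hY₀.exists_hasControlledIncrements hB hT
  obtain ⟨I, hcad, hIY⟩ := hY.exists_isCadlag hT fun t =>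
    (CylLevy.continuousWithinAt_setIntegral_Ioc_prod
      (hΨ.memLp.integrable_norm_pow two_ne_zero) t).const_mul _
  have hI : StronglyAdapted (CylLevy.cylFiltrationOn P L T) I := fun t =>
    CylLevy.stronglyMeasurable_cylFiltration
      ((hY.adapted t).aestronglyMeasurable.congr (hIY t).symm)
  refine ⟨I, hI, fun t => (memLp_congr_ae (hIY t)).2 (hY.memLp t), hcad, fun t => ?_, fun hM => ?_⟩
  · exact (((hYint t).congr_left (CylLevy.uncurry_indicator_Iic_ae_eq Ψ t)).congr
      (hIY t).symm).isStochIntegral hB hT (hΨ.indicator_Iic t)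
  · have hYM := hY.martingale (funext fun t => by simp [hmart hM])
    refine ⟨hI, fun s t hst => ?_⟩
    exact (condExp_congr_ae (hIY t)).trans ((hYM.2 s t hst).trans (hIY s).symm)
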